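/- Let $\mathfrak g$ be the Lie algebra of a compact Lie group $G$, with a $G$-invariant inner product, and let $P$ be a principal $G$-bundle over Euclidean $\mathbb R^3$ with adjoint bundle $\mathfrak g_P$. Let $m_0=(\nabla_0,\Phi_0)$ be a smooth Bogomolny monopole of finite energy: a $G$-connection $\nabla_0$ on $P$ and a section $\Phi_0$ of $\mathfrak g_P$ with $\ast F_{\nabla_0}=d_{\nabla_0}\Phi_0$ and $|d_{\nabla_0}\Phi_0|\in L^2(\mathbb R^3)$. Assume the following. (a) *Asymptotics.* Let $\pi$ be the radial projection of $\mathbb R^3\setminus\{0\}$ to $\mathbb S^2$ and $r=|x|$. There are a $G$-bundle $P_\infty\to\mathbb S^2$ with a connection $\nabla^\infty$, smooth nonzero sections $\Phi_\infty,\kappa$ of $\operatorname{ad}(P_\infty)$, and, outside some ball, an isomorphism of $P$ with $\pi^*P_\infty$ under which $$\Phi_0=\pi^*\Phi_\infty-\tfrac1{2r}\pi^*\kappa+O(r^{-2}),\qquad d_{\nabla_0}\Phi_0=\tfrac1{2r^2}\,\pi^*\kappa\otimes dr+O(r^{-3}),$$ and $\nabla^\infty\Phi_\infty=0$, $F_{\nabla^\infty}=\tfrac12\kappa\otimes\mathrm{vol}_{\mathbb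 S^2}$, $[\Phi_\infty,\kappa]=0$. (b) *Maximal symmetry breaking.* $\Phi_\infty$ takes values in the interior of a Weyl chamber; equivalently, $\ker(\operatorname{ad}\Phi_\infty)$ is abelian at every point of $\mathbb S^2$. For $c=(a,\Psi)$ a section of $(\Lambda^1\oplus\Lambda^0)\otimes\mathfrak g_P$ put $$D(a,\Psi)=\bigl(\ast d_{\nabla_0}a-d_{\nabla_0}\Psi-[a,\Phi_0],\; d_{\nabla_0}^*a-[\Phi_0,\Psi]\bigr),$$ and let $D^*$ be the formal $L^2$-adjoint of $D$. Let $\|\cdot\|$ be the $L^2$-norm on $\mathbb R^3$, $\rho=(1+|x|^2)^{1/2}$, and let $\mathcal H_k$ ($k=0,1,2$) be the completion of the smooth compactly supported sections in the norm given by $\|c\|_{\mathcal H_0}=\|c\|$, $$\|c\|_{\mathcal H_1}^2=\|\nabla_0c\|^2+\|\rho^{-1}c\|^2+\|[\Phi_0,c]\|^2,$$ $$\|c\|_{\mathcal H_2}^2=\|\nabla_0^2c\|^2+\|\rho^{-1}\nabla_0c\|^2+\|[\Phi_0,\nabla_0c]\|^2+\|[\Phi_0,[\Phi_0,c]]\|^2+\|[\Phi_0,\rho^{-1}c]\|^2+\|\rho^{-2}c\|^2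 .$$ The elements of these spaces are regarded as locally square integrable sections, and derivatives are taken in the weak sense. Then there are constants $R>0$ and $C_{m_0}>0$, depending only on the monopole $m_0$, such that for all $c\in\mathcal H_1$ $$\|c\|_{\mathcal H_1}^2\le C_{m_0}\|D^*c\|_{\mathcal H_0}^2,\qquad \|c\|_{\mathcal H_1}^2\le C_{m_0}\bigl(\|Dc\|_{\mathcal H_0}^2+\|c\|_{L^2(B_R(0))}^2\bigr),$$ and for all $c\in\mathcal H_2$ one has $D^*c,\,Dc\in\mathcal H_1$ and $$\|c\|_{\mathcal H_2}^2\le C_{m_0}\bigl(\|D^*c\|_{\mathcal H_1}^2+\|c\|_{L^2(B_R(0))}^2\bigr),\qquad \|c\|_{\mathcal H_2}^2\le C_{m_0}\bigl(\|Dc\|_{\mathcal H_1}^2+\|c\|_{L^2(B_R(0))}^2\bigr).$$ Moreover, if $c\in\mathcal H_1$ and $D^*c\in\mathcal H_1$ or $Dc\in\mathcal H_1$, then $c\in\mathcal H_2$; so the last two inequalities also hold for every $c\in\mathcal H_1$, with the convention that $\|\cdot\|_{\mathcal H_k}=\infty$ off $\mathcal H_k$. -/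

import Mathlib

open scoped ContDiff ENNReal NNReal
open MeasureTheory Filter Topology

namespace BPS

/-- Euclidean three-space. -/
abbrev E3 : Type := EuclideanSpace ℝ (Fin 3)

/-- The standard basis vectors of `ℝ³`. -/
noncomputable def e (i : Fin 3) : E3 := EuclideanSpace.single i (1 : ℝ)

/-- A real Lie algebra with an `ad`-invariant inner product. In finite dimension these are exactly
the Lie algebras of compact Lie groups, equipped with an invariant inner product. -/
class InvariantLieAlgebra (𝔤 : Type*) [NormedAddCommGroup 𝔤] [InnerProductSpace ℝ 𝔤] extends
    Bracket 𝔤 𝔤 where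
  add_lie' : ∀ x y z : 𝔤, ⁅x + y, z⁆ = ⁅x, z⁆ + ⁅y, z⁆
  lie_add' : ∀ x y z : 𝔤, ⁅x, y + z⁆ = ⁅x, y⁆ + ⁅x, z⁆
  lie_self' : ∀ x : 𝔤, ⁅x, x⁆ = 0
  leibniz_lie' : ∀ x y z : 𝔤, ⁅x, ⁅y, z⁆⁆ = ⁅⁅x, y⁆, z⁆ + ⁅y, ⁅x, z⁆⁆
  lie_smul' : ∀ (t : ℝ) (x y : 𝔤), ⁅x, t • y⁆ = t • ⁅x, y⁆
  inner_lie' : ∀ x y z : 𝔤, inner ℝ ⁅x, y⁆ z = inner ℝ x ⁅y, z⁆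

section

variable {𝔤 : Type*} [NormedAddCommGroup 𝔤] [InnerProductSpace ℝ 𝔤] [InvariantLieAlgebra 𝔤]

/-- The underlying Lie ring, in Mathlib's sense. -/
instance instLieRing : LieRing 𝔤 where
  add_lie := InvariantLieAlgebra.add_lie'
  lie_add := InvariantLieAlgebra.lie_add'
  lie_self := InvariantLieAlgebra.lie_self'
  leibniz_lie := InvariantLieAlgebra.leibniz_lie'

/-- The underlying real Lie algebra, in Mathlib's sense. -/
instance instLieAlgebra : LieAlgebra ℝ 𝔤 where
  lie_smul := InvariantLieAlgebra.lie_smul'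

/-! ### Connections, curvature, monopoles

A principal bundle over `ℝ³` is trivial. In a trivialization a connection is `∇ = d + [A, ·]` with
a `𝔤`-valued one-form `A = ∑ A i dx^i`, and sections of the adjoint bundle are functions to `𝔤`. -/

/-- `∇_i s = ∂_i s + [A_i, s]`. -/
noncomputable def cov (A : Fin 3 → E3 → 𝔤) (i : Fin 3) (s : E3 → 𝔤) (x : E3) : 𝔤 :=
  fderiv ℝ s x (e i) + ⁅A i x, s x⁆

/-- `F_{ij} = ∂_i A_j - ∂_j A_i + [A_i, A_j]`. -/
noncomputable def curv (A : Fin 3 → E3 → 𝔤) (i j : Fin 3) (x : E3) : 𝔤 :=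
  fderiv ℝ (A j) x (e i) - fderiv ℝ (A i) x (e j) + ⁅A i x, A j x⁆

variable (𝔤) in
/-- A smooth finite energy Bogomolny monopole on `ℝ³`: a connection `∇ = d + [A, ·]` and a Higgs
field `Φ` with `∗F = d_∇ Φ` and `|d_∇ Φ| ∈ L²`. The component `(∗F)_i` is `F_{i+1,i+2}`, the indices
being taken modulo `3`. -/
structure Monopole where
  A : Fin 3 → E3 → 𝔤
  Φ : E3 → 𝔤
  smooth_A : ∀ i, ContDiff ℝ ∞ (A i)
  smooth_Φ : ContDiff ℝ ∞ Φ
  bogomolny : ∀ (i : Fin 3) (x : E3), curv A (i + 1) (i + 2) x = cov A i Φ x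
  finite_energy : ∀ i, MemLp (cov A i Φ) 2 volume

/-- The asymptotic behaviour of a monopole. Objects on the sphere `𝕊²` at infinity are
represented by their pullbacks under the radial projection `π : ℝ³ ∖ {0} → 𝕊²`:
sections of `ad P_∞` are functions on `ℝ³ ∖ {0}` which are homogeneous of degree `0`, and connections
on `P_∞` are one-forms on `ℝ³ ∖ {0}` with components homogeneous of degree `-1` and with vanishing
radial component. The pullback of the area form of `𝕊²` has components
`(π^* vol)_{i+1,i+2} = x_i / |x|³`. (`P_∞` is trivial, being isomorphic to the restriction of
a bundle on `ℝ³` to a sphere.) The isomorphism between `π^* ad P_∞` and `ad P` outside a ball is `u`. -/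
structure AsymptoticExpansion (m : Monopole 𝔤) where
  /-- the connection on `P_∞` -/
  Ainf : Fin 3 → E3 → 𝔤
  /-- the limit of the Higgs field -/
  Φinf : E3 → 𝔤
  /-- the charge -/
  κ : E3 → 𝔤
  /-- the isomorphism of bundles outside the ball of radius `R` -/
  u : E3 → 𝔤 →L[ℝ] 𝔤
  R : ℝ
  K : ℝ
  R_pos : 0 < R
  smooth_Ainf : ∀ i, ContDiffOn ℝ ∞ (Ainf i) {0}ᶜ
  smooth_Φinf : ContDiffOn ℝ ∞ Φinf {0}ᶜ
  smooth_κ : ContDiffOn ℝ ∞ κ {0}ᶜ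
  Ainf_smul : ∀ (i : Fin 3) (t : ℝ) (x : E3), 0 < t → x ≠ 0 → Ainf i (t • x) = t⁻¹ • Ainf i x
  Ainf_radial : ∀ x : E3, x ≠ 0 → ∑ i, x i • Ainf i x = 0
  Φinf_smul : ∀ (t : ℝ) (x : E3), 0 < t → x ≠ 0 → Φinf (t • x) = Φinf x
  κ_smul : ∀ (t : ℝ) (x : E3), 0 < t → x ≠ 0 → κ (t • x) = κ x
  Φinf_ne_zero : ∃ x : E3, x ≠ 0 ∧ Φinf x ≠ 0
  κ_ne_zero : ∃ x : E3, x ≠ 0 ∧ κ x ≠ 0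
  smooth_u : ContDiffOn ℝ ∞ u {x | R < ‖x‖}
  u_lie : ∀ x : E3, R < ‖x‖ → ∀ v w : 𝔤, u x ⁅v, w⁆ = ⁅u x v, u x w⁆
  u_norm : ∀ x : E3, R < ‖x‖ → ∀ v : 𝔤, ‖u x v‖ = ‖v‖
  /-- `Φ = Φ_∞ - κ / (2 r) + O(r⁻²)` -/
  expansion : ∀ x : E3, R < ‖x‖ →
    ‖m.Φ x - u x (Φinf x - (1 / (2 * ‖x‖)) • κ x)‖ ≤ K / ‖x‖ ^ 2
  /-- `d_∇ Φ = κ / (2 r²) ⊗ dr + O(r⁻³)`, where `dr = ∑ (x_i / r) dx^i` -/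
  expansion_deriv : ∀ x : E3, R < ‖x‖ → ∀ i : Fin 3,
    ‖cov m.A i m.Φ x - u x ((1 / (2 * ‖x‖ ^ 2) * (x i / ‖x‖)) • κ x)‖ ≤ K / ‖x‖ ^ 3
  /-- `∇^∞ Φ_∞ = 0` -/
  parallel : ∀ x : E3, x ≠ 0 → ∀ i : Fin 3, cov Ainf i Φinf x = 0
  /-- `F_{∇^∞} = ½ κ ⊗ vol` -/
  curvature : ∀ x : E3, x ≠ 0 → ∀ i : Fin 3,
    curv Ainf (i + 1) (i + 2) x = ((1 / 2 : ℝ) * (x i / ‖x‖ ^ 3)) • κ x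
  /-- `[Φ_∞, κ] = 0` -/
  commute : ∀ x : E3, x ≠ 0 → ⁅Φinf x, κ x⁆ = 0

/-- Maximal symmetry breaking: the kernel of `ad Φ_∞` is abelian at every point of the sphere at
infinity, i.e. `Φ_∞` has values in the interior of a Weyl chamber. -/
def AsymptoticExpansion.MaximalSymmetryBreaking {m : Monopole 𝔤} (d : AsymptoticExpansion m) :
    Prop :=
  ∀ x : E3, x ≠ 0 → ∀ v w : 𝔤, ⁅d.Φinf x, v⁆ = 0 → ⁅d.Φinf x, w⁆ = 0 → ⁅v, w⁆ = 0

/-! ### Sections of `(Λ¹ ⊕ Λ⁰) ⊗ 𝔤` -/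

variable (𝔤) in
/-- The fibre of `(Λ¹ ⊕ Λ⁰) ⊗ 𝔤`, with its Euclidean norm. For `c = (a, Ψ)`, `c.fst i` is the
`dx^i`-component of `a`, and `c.snd` is `Ψ`. -/
abbrev Fib : Type _ := WithLp 2 (PiLp 2 (fun _ : Fin 3 => 𝔤) × 𝔤)

/-- The pair `(a, Ψ)` as an element of the fibre. -/
def mkFib (a : Fin 3 → 𝔤) (Ψ : 𝔤) : Fib 𝔤 := WithLp.toLp 2 (WithLp.toLp 2 a, Ψ)

/-- The componentwise bracket `[X, c]`. -/
def adFib (X : 𝔤) (c : Fib 𝔤) : Fib 𝔤 := mkFib (fun i => ⁅X, c.fst i⁆) ⁅X, c.snd⁆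

/-- The smooth compactly supported sections. -/
def IsTest (φ : E3 → Fib 𝔤) : Prop := ContDiff ℝ ∞ φ ∧ HasCompactSupport φ

namespace Monopole

variable (m : Monopole 𝔤)

/-- The classical covariant derivative `∇_i c = ∂_i c + [A_i, c]` of a differentiable section. -/
noncomputable def covFib (i : Fin 3) (c : E3 → Fib 𝔤) (x : E3) : Fib 𝔤 :=
  fderiv ℝ c x (e i) + adFib (m.A i x) (c x)

/-- `g` is the covariant derivative `∇_i c` in the weak sense. -/
def IsWeakCov (i : Fin 3) (c g : E3 → Fib 𝔤) : Prop :=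
  LocallyIntegrable c volume ∧ LocallyIntegrable g volume ∧
    ∀ φ : E3 → Fib 𝔤, IsTest φ →
      ∫ x, inner ℝ (c x) (m.covFib i φ x) = -∫ x, inner ℝ (g x) (φ x)

open Classical in
/-- The weak covariant derivative `∇_i c` (unique almost everywhere; `0` if there is none). -/
noncomputable def wcov (i : Fin 3) (c : E3 → Fib 𝔤) : E3 → Fib 𝔤 :=
  if h : ∃ g, m.IsWeakCov i c g then h.choose else 0

/-- All first weak covariant derivatives exist. -/
def HasWeakGrad (c : E3 → Fib 𝔤) : Prop := ∀ i, ∃ g, m.IsWeakCov i c g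

/-- `D(a, Ψ) = (∗ d_∇ a - d_∇ Ψ - [a, Φ], d_∇^* a - [Φ, Ψ])`, with weak derivatives. Here
`(∗ d_∇ a)_i = ∇_{i+1} a_{i+2} - ∇_{i+2} a_{i+1}` and `d_∇^* a = - ∑ ∇_i a_i`. -/
noncomputable def D (c : E3 → Fib 𝔤) (x : E3) : Fib 𝔤 :=
  mkFib
    (fun i => ((m.wcov (i + 1) c x).fst (i + 2) - (m.wcov (i + 2) c x).fst (i + 1))
      - (m.wcov i c x).snd - ⁅(c x).fst i, m.Φ x⁆)
    (-(∑ i, (m.wcov i c x).fst i) - ⁅m.Φ x, (c x).snd⁆)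

/-- The formal `L²`-adjoint of `D`:
`D^*(b, η) = (∗ d_∇ b + d_∇ η - [Φ, b], - d_∇^* b + [Φ, η])`, with weak derivatives. -/
noncomputable def Dstar (c : E3 → Fib 𝔤) (x : E3) : Fib 𝔤 :=
  mkFib
    (fun i => ((m.wcov (i + 1) c x).fst (i + 2) - (m.wcov (i + 2) c x).fst (i + 1))
      + (m.wcov i c x).snd - ⁅m.Φ x, (c x).fst i⁆)
    ((∑ i, (m.wcov i c x).fst i) + ⁅m.Φ x, (c x).snd⁆)

end Monopole

/-! ### Function spaces -/

/-- `ρ = (1 + |x|²)^{1/2}`. -/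
noncomputable def rho (x : E3) : ℝ := Real.sqrt (1 + ‖x‖ ^ 2)

/-- The squared `L²`-norm on a set. -/
noncomputable def normSqL2On (s : Set E3) (c : E3 → Fib 𝔤) : ℝ≥0∞ := ∫⁻ x in s, ‖c x‖ₑ ^ 2

/-- The squared `L²`-norm, which is the squared norm of `𝓗₀`. -/
noncomputable def normSqH0 (c : E3 → Fib 𝔤) : ℝ≥0∞ := ∫⁻ x, ‖c x‖ₑ ^ 2

namespace Monopole

variable (m : Monopole 𝔤)

open Classical in
/-- The squared norm
`‖c‖²_{𝓗₁} = ‖∇c‖² + ‖ρ⁻¹ c‖² + ‖[Φ, c]‖²` (infinite if `∇c` does not exist weakly). -/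
noncomputable def normSqH1 (c : E3 → Fib 𝔤) : ℝ≥0∞ :=
  if m.HasWeakGrad c then
    (∑ i, normSqH0 (m.wcov i c)) + normSqH0 (fun x => (rho x)⁻¹ • c x)
      + normSqH0 (fun x => adFib (m.Φ x) (c x))
  else ∞

open Classical in
/-- The squared norm
`‖c‖²_{𝓗₂} = ‖∇²c‖² + ‖ρ⁻¹ ∇c‖² + ‖[Φ, ∇c]‖² + ‖[Φ, [Φ, c]]‖² + ‖[Φ, ρ⁻¹ c]‖² + ‖ρ⁻² c‖²`
(infinite if `∇c` or `∇²c` does not exist weakly). -/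
noncomputable def normSqH2 (c : E3 → Fib 𝔤) : ℝ≥0∞ :=
  if m.HasWeakGrad c ∧ ∀ j, m.HasWeakGrad (m.wcov j c) then
    (∑ i, ∑ j, normSqH0 (m.wcov i (m.wcov j c)))
      + (∑ i, normSqH0 (fun x => (rho x)⁻¹ • m.wcov i c x))
      + (∑ i, normSqH0 (fun x => adFib (m.Φ x) (m.wcov i c x)))
      + normSqH0 (fun x => adFib (m.Φ x) (adFib (m.Φ x) (c x)))
      + normSqH0 (fun x => adFib (m.Φ x) ((rho x)⁻¹ • c x))
      + normSqH0 (fun x => ((rho x) ^ 2)⁻¹ • c x)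
  else ∞

/-- `c ∈ 𝓗₁`, the completion of the smooth compactly supported sections in the `𝓗₁`-norm, realized
as the closure of these sections in the (complete) space of sections of finite `𝓗₁`-norm. -/
def MemH1 (c : E3 → Fib 𝔤) : Prop :=
  ∃ φ : ℕ → E3 → Fib 𝔤, (∀ n, IsTest (φ n)) ∧
    Tendsto (fun n => m.normSqH1 (fun x => c x - φ n x)) atTop (𝓝 0)

/-- `c ∈ 𝓗₂`, the completion of the smooth compactly supported sections in the `𝓗₂`-norm, realized
as the closure of these sections in the (complete) space of sections of finite `𝓗₂`-norm. -/
def MemH2 (c : E3 → Fib 𝔤) : Prop :=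
  ∃ φ : ℕ → E3 → Fib 𝔤, (∀ n, IsTest (φ n)) ∧
    Tendsto (fun n => m.normSqH2 (fun x => c x - φ n x)) atTop (𝓝 0)

end Monopole

end

end BPS

set_option linter.unusedSectionVars false

namespace BPS

variable {𝔤 : Type*} [NormedAddCommGroup 𝔤] [InnerProductSpace ℝ 𝔤] [InvariantLieAlgebra 𝔤]

/-! ### Algebra of the fibre -/

/-! Both `D` and `D^*` have the form `T = ∑ γ_j ∇_j + β [Φ, ·]` with constant isometric symbols
obeying Clifford relations. Expand `‖Tφ‖²` for a test function `φ` and integrate the cross terms by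
parts. Besides `‖∇φ‖² + ‖[Φ, φ]‖²` there remain two terms of order zero, one from the curvature and
one from `∇Φ`. By the Bogomolny equation they are multiples of the same integral, with total factor
`1 + s`, where `s = -1` for `D^*` and `s = 1` for `D` (`DiracCoeff.weitzenbock`). For `D^*` they
cancel, and Hardy's inequality supplies the term `‖ρ⁻¹φ‖²`; this is the global `𝓗₁` estimate.

For `D` a term quadratic in `φ` with coefficient `∇Φ = O(ρ⁻²)` survives. That decay is only critical
for Hardy's inequality, and maximal symmetry breaking has to help. The charge `κ` lies in the
centralizer of `Φ_∞`, which is abelian, so `ad κ` vanishes on `ker (ad Φ_∞)` and `|[κ, v]| ≤ C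
|[Φ_∞, v]|`. The constant is uniform over the sphere because `Φ_∞` is parallel: one polynomial
annihilates `ad Φ_∞` everywhere (`AsymptoticExpansion.norm_lie_charge_le`). Hence `|[∇Φ, v]| ≤ K
(ρ⁻² |[Φ, v]| + ρ⁻³ |v|)`, a factor `ρ⁻¹` better than what the `𝓗₁`-norm controls. Outside a large
ball the term is absorbed; inside it costs a local `L²`-norm (`DiracCoeff.coercive`).

For `𝓗₂` the `𝓗₁` estimate is applied to `∇_i φ`. The commutator of `T` with `∇_i` has order zero
and the same decay, so it is absorbed too. The zeroth order terms of the norm come from three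
sources: `[Φ, [Φ, φ]]` is read off from `[Φ, Tφ]`, the weight `ρ⁻²` from a weighted Hardy
inequality, and the mixed term from skewness of `ad Φ` (`DiracCoeff.elliptic`).

The inequalities extend to the completions by density. Regularity needs test functions `φ_n` with
both `φ_n → c` and `Tφ_n → Tc` in `𝓗₁`; the `𝓗₂` estimate for `φ_n - φ_m` then makes the sequence
Cauchy in `𝓗₂`. Such `φ_n` arise by cutting off and mollifying. In a global trivialization the
principal part of `T` has constant coefficients, so it commutes exactly with convolution. -/

theorem inner_lie_swap (X v w : 𝔤) : inner ℝ ⁅X, v⁆ w = -inner ℝ v ⁅X, w⁆ := by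
  have h : ⁅X, v⁆ = -⁅v, X⁆ := (lie_skew X v).symm
  rw [h, inner_neg_left]
  exact congrArg Neg.neg (InvariantLieAlgebra.inner_lie' v X w)

theorem Fib.ext {c c' : Fib 𝔤} (h : ∀ i, c.fst i = c'.fst i) (h' : c.snd = c'.snd) : c = c' := by
  apply (WithLp.ofLp_injective 2)
  refine Prod.ext ?_ h'
  apply (WithLp.ofLp_injective 2)
  funext i
  exact h i

@[simp] theorem mkFib_fst (a : Fin 3 → 𝔤) (Ψ : 𝔤) (i : Fin 3) : (mkFib a Ψ).fst i = a i := rfl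

@[simp] theorem mkFib_snd (a : Fin 3 → 𝔤) (Ψ : 𝔤) : (mkFib a Ψ).snd = Ψ := rfl

@[simp] theorem adFib_fst (X : 𝔤) (c : Fib 𝔤) (i : Fin 3) : (adFib X c).fst i = ⁅X, c.fst i⁆ := rfl

@[simp] theorem adFib_snd (X : 𝔤) (c : Fib 𝔤) : (adFib X c).snd = ⁅X, c.snd⁆ := rfl

theorem inner_fib (c c' : Fib 𝔤) :
    inner ℝ c c' = ∑ i, inner ℝ (c.fst i) (c'.fst i) + inner ℝ c.snd c'.snd := by
  rw [WithLp.prod_inner_apply, PiLp.inner_apply]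
  rfl

theorem norm_sq_fib (c : Fib 𝔤) : ‖c‖ ^ 2 = ∑ i, ‖c.fst i‖ ^ 2 + ‖c.snd‖ ^ 2 := by
  simp only [← real_inner_self_eq_norm_sq, inner_fib]

theorem adFib_skew (X : 𝔤) (v w : Fib 𝔤) : inner ℝ (adFib X v) w = -inner ℝ v (adFib X w) := by
  simp only [inner_fib, adFib_fst, adFib_snd, inner_lie_swap, Finset.sum_neg_distrib, neg_add]

theorem adFib_lie (X Y : 𝔤) (c : Fib 𝔤) :
    adFib X (adFib Y c) = adFib ⁅X, Y⁆ c + adFib Y (adFib X c) := by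
  apply Fib.ext
  · intro i
    exact leibniz_lie X Y (c.fst i)
  · exact leibniz_lie X Y c.snd

/-- `∑ |[X, c_i]|²` is controlled by a pointwise bound on `𝔤`. -/
theorem norm_adFib_le {X Y : 𝔤} {a b : ℝ} (ha : 0 ≤ a) (hb : 0 ≤ b)
    (h : ∀ v : 𝔤, ‖⁅X, v⁆‖ ≤ a * ‖⁅Y, v⁆‖ + b * ‖v‖) (c : Fib 𝔤) :
    ‖adFib X c‖ ≤ 2 * (a * ‖adFib Y c‖ + b * ‖c‖) := by
  have key : ∀ v : 𝔤, ‖⁅X, v⁆‖ ^ 2 ≤ 2 * (a ^ 2 * ‖⁅Y, v⁆‖ ^ 2 + b ^ 2 * ‖v‖ ^ 2) := by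
    intro v
    have := h v
    have h0 := norm_nonneg ⁅X, v⁆
    nlinarith [sq_nonneg (a * ‖⁅Y, v⁆‖ - b * ‖v‖)]
  have h1 : ‖adFib X c‖ ^ 2 ≤ 2 * (a ^ 2 * ‖adFib Y c‖ ^ 2 + b ^ 2 * ‖c‖ ^ 2) := by
    rw [norm_sq_fib, norm_sq_fib c, norm_sq_fib (adFib Y c)]
    simp only [adFib_fst, adFib_snd, Fin.sum_univ_three]
    linarith [key (c.fst 0), key (c.fst 1), key (c.fst 2), key c.snd]
  have h2 : 0 ≤ a * ‖adFib Y c‖ := by positivity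
  have h3 : 0 ≤ b * ‖c‖ := by positivity
  refine abs_le_of_sq_le_sq' ?_ (by positivity) |>.2
  nlinarith

section

variable [FiniteDimensional ℝ 𝔤]

/-- The adjoint representation as a continuous linear map. -/
noncomputable def adg : 𝔤 →L[ℝ] 𝔤 →L[ℝ] 𝔤 :=
  LinearMap.toContinuousLinearMap
    ((LinearMap.toContinuousLinearMap : (𝔤 →ₗ[ℝ] 𝔤) ≃ₗ[ℝ] (𝔤 →L[ℝ] 𝔤)).toLinearMap ∘ₗ
      LinearMap.mk₂ ℝ (fun X v : 𝔤 => ⁅X, v⁆) add_lie (fun t X v => smul_lie t X v) lie_add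
        (fun t X v => lie_smul t X v))

@[simp] theorem adg_apply (X v : 𝔤) : adg X v = ⁅X, v⁆ := rfl

/-- The componentwise adjoint representation as a continuous linear map. -/
noncomputable def adL : 𝔤 →L[ℝ] Fib 𝔤 →L[ℝ] Fib 𝔤 :=
  LinearMap.toContinuousLinearMap
    ((LinearMap.toContinuousLinearMap : (Fib 𝔤 →ₗ[ℝ] Fib 𝔤) ≃ₗ[ℝ] (Fib 𝔤 →L[ℝ] Fib 𝔤)).toLinearMap ∘ₗ
      LinearMap.mk₂ ℝ (fun (X : 𝔤) (c : Fib 𝔤) => adFib X c)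
        (fun X Y c => Fib.ext (fun i => add_lie X Y (c.fst i)) (add_lie X Y c.snd))
        (fun t X c => Fib.ext (fun i => smul_lie t X (c.fst i)) (smul_lie t X c.snd))
        (fun X c c' => Fib.ext (fun i => lie_add X (c.fst i) (c'.fst i)) (lie_add X c.snd c'.snd))
        (fun t X c => Fib.ext (fun i => lie_smul t X (c.fst i)) (lie_smul t X c.snd)))

theorem adL_apply (X : 𝔤) (c : Fib 𝔤) : adL X c = adFib X c := rfl

end

/-! ### Operators of Dirac type -/

variable (𝔤) in
/-- The coefficients of an operator `∑ γ_j ∇_j + β [Φ, ·]` of Dirac type. -/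
structure DiracOp where
  γ : Fin 3 → Fib 𝔤 →L[ℝ] Fib 𝔤
  β : Fib 𝔤 →L[ℝ] Fib 𝔤
  s : ℝ
  γ_ad : ∀ (j : Fin 3) (X : 𝔤) (v : Fib 𝔤), γ j (adFib X v) = adFib X (γ j v)
  β_ad : ∀ (X : 𝔤) (v : Fib 𝔤), β (adFib X v) = adFib X (β v)
  norm_γ : ∀ (j : Fin 3) (v : Fib 𝔤), ‖γ j v‖ = ‖v‖
  norm_β : ∀ v : Fib 𝔤, ‖β v‖ = ‖v‖
  γ_anti : ∀ (j k : Fin 3) (v w : Fib 𝔤), j ≠ k →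
    inner ℝ (γ j v) (γ k w) = -inner ℝ (γ k v) (γ j w)
  γ_β : ∀ (j : Fin 3) (v w : Fib 𝔤), inner ℝ (γ j v) (β w) = -inner ℝ (γ j w) (β v)
  -- As operators, `γ_{j+1}^* γ_{j+2} = s γ_j^* β`. This is what makes the curvature term
  -- `F_{j+1,j+2}` comparable with the term `∇_j Φ`.
  γ_γ : ∀ (j : Fin 3) (v w : Fib 𝔤),
    inner ℝ (γ (j + 1) v) (γ (j + 2) w) = s * inner ℝ (γ j v) (β w)

section

variable [FiniteDimensional ℝ 𝔤]

/-- The principal symbols of `D` (`t = -1`) and `D^*` (`t = 1`). -/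
noncomputable def symb (t : ℝ) (j : Fin 3) : Fib 𝔤 →L[ℝ] Fib 𝔤 :=
  LinearMap.toContinuousLinearMap
    { toFun := fun c => mkFib (fun i => if j = i then t • c.snd else
        if j = i + 1 then c.fst (i + 2) else -c.fst (i + 1)) (t • c.fst j)
      map_add' := by
        intro c c'
        apply Fib.ext
        · intro i
          simp only [mkFib_fst, WithLp.add_fst, WithLp.add_snd, PiLp.add_apply]
          split_ifs
          · exact smul_add _ _ _
          · rfl
          · exact neg_add _ _
        · exact smul_add _ _ _
      map_smul' := by
        intro r c
        apply Fib.ext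
        · intro i
          simp only [mkFib_fst, WithLp.smul_fst, WithLp.smul_snd, PiLp.smul_apply, RingHom.id_apply]
          split_ifs
          · exact smul_comm _ _ _
          · rfl
          · exact (smul_neg _ _).symm
        · exact smul_comm _ _ _ }

theorem symb_fst (t : ℝ) (j : Fin 3) (c : Fib 𝔤) (i : Fin 3) :
    (symb t j c).fst i = if j = i then t • c.snd else
        if j = i + 1 then c.fst (i + 2) else -c.fst (i + 1) := rfl

theorem symb_snd (t : ℝ) (j : Fin 3) (c : Fib 𝔤) : (symb t j c).snd = t • c.fst j := rfl

/-- The zeroth order coefficients of `D` (`t = -1`) and `D^*` (`t = 1`). -/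
noncomputable def symb0 (t : ℝ) : Fib 𝔤 →L[ℝ] Fib 𝔤 :=
  LinearMap.toContinuousLinearMap
    { toFun := fun c => mkFib (fun i => -t • c.fst i) (t • c.snd)
      map_add' := fun _ _ => Fib.ext (fun _ => smul_add _ _ _) (smul_add _ _ _)
      map_smul' := fun _ _ => Fib.ext (fun _ => smul_comm _ _ _) (smul_comm _ _ _) }

theorem symb0_fst (t : ℝ) (c : Fib 𝔤) (i : Fin 3) : (symb0 t c).fst i = -t • c.fst i := rfl

theorem symb0_snd (t : ℝ) (c : Fib 𝔤) : (symb0 t c).snd = t • c.snd := rfl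

/-- The coefficients of `D` (`t = -1`) and `D^*` (`t = 1`). -/
noncomputable def diracOp (t : ℝ) (ht : t * t = 1) : DiracOp 𝔤 where
  γ := symb t
  β := symb0 t
  -- The sign that separates the two operators: `-1` for `D^*`, `+1` for `D`.
  s := -t
  γ_ad := by
    intro j X v
    apply Fib.ext
    · intro i
      simp only [symb_fst, adFib_fst, adFib_snd]
      split_ifs
      · exact (lie_smul _ _ _).symm
      · rfl
      · exact (lie_neg _ _).symm
    · exact (lie_smul _ _ _).symm
  β_ad := by
    intro X v
    exact Fib.ext (fun i => (lie_smul _ _ _).symm) (lie_smul _ _ _).symm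
  norm_γ := by
    intro j v
    rw [← sq_eq_sq₀ (norm_nonneg _) (norm_nonneg _), norm_sq_fib, norm_sq_fib v]
    rcases mul_self_eq_one_iff.mp ht with rfl | rfl <;> fin_cases j <;>
    simp [symb_fst, symb_snd, Fin.sum_univ_three] <;> ring
  norm_β := by
    intro v
    rw [← sq_eq_sq₀ (norm_nonneg _) (norm_nonneg _), norm_sq_fib, norm_sq_fib v]
    rcases mul_self_eq_one_iff.mp ht with rfl | rfl <;>
    simp [symb0_fst, symb0_snd]
  γ_anti := by
    intro j k v w hjk
    rw [inner_fib, inner_fib]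
    rcases mul_self_eq_one_iff.mp ht with rfl | rfl <;> fin_cases j <;> fin_cases k <;>
      first | exact absurd rfl hjk | skip
    all_goals
      simp [symb_fst, symb_snd, Fin.sum_univ_three]
      try ring
  γ_β := by
    intro j v w
    rw [real_inner_comm (symb0 t v), inner_fib, inner_fib]
    rcases mul_self_eq_one_iff.mp ht with rfl | rfl <;> fin_cases j
    all_goals
      simp [symb_fst, symb_snd, symb0_fst, symb0_snd, Fin.sum_univ_three]
      try ring
  γ_γ := by
    intro j v w
    rw [inner_fib, inner_fib]
    rcases mul_self_eq_one_iff.mp ht with rfl | rfl <;> fin_cases j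
    all_goals
      simp [symb_fst, symb_snd, symb0_fst, symb0_snd, Fin.sum_univ_three]
      try ring

end

variable {𝔤 : Type*} [NormedAddCommGroup 𝔤] [InnerProductSpace ℝ 𝔤] [InvariantLieAlgebra 𝔤]

/-! ### Consequences of the asymptotic expansion -/

/-- Homogeneity of degree zero moves every point to the unit sphere, which is compact. -/
theorem exists_bound_of_homogeneous {f : E3 → ℝ} (hf : ContinuousOn f {0}ᶜ)
    (hs : ∀ (t : ℝ) (x : E3), 0 < t → x ≠ 0 → f (t • x) = f x) :
    ∃ C : ℝ, 0 ≤ C ∧ ∀ x, x ≠ 0 → f x ≤ C := by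
  have hsub : Metric.sphere (0 : E3) 1 ⊆ {0}ᶜ := by
    intro x hx h0
    simp only [Set.mem_singleton_iff] at h0
    simp [h0] at hx
  obtain ⟨C, hC⟩ := (isCompact_sphere (0 : E3) 1).bddAbove_image (hf.mono hsub)
  refine ⟨max C 0, le_max_right _ _, fun x hx => ?_⟩
  have hn : 0 < ‖x‖ := norm_pos_iff.mpr hx
  rw [← hs ‖x‖⁻¹ x (inv_pos.mpr hn) hx]
  refine le_trans (hC ⟨_, ?_, rfl⟩) (le_max_left _ _)
  simp [norm_smul, hn.ne']

theorem ext_of_e {F : Type*} [NormedAddCommGroup F] [NormedSpace ℝ F] {L : E3 →L[ℝ] F}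
    (h : ∀ i, L (e i) = 0) : L = 0 := by
  ext x
  have hx : x = ∑ i, x i • e i := by
    ext j
    simp [e, Finset.sum_apply, Pi.single_apply]
  rw [hx, map_sum]
  simp [h]

/-! ### Parallel fields of endomorphisms away from the origin -/

section Lax

variable [FiniteDimensional ℝ 𝔤] {a : Fin 3 → E3 → 𝔤}

/-- `X` is an endomorphism valued function which is parallel for the connection `d + [a, ·]`
away from the origin. -/
def IsParallelEnd (a : Fin 3 → E3 → 𝔤) (X : E3 → 𝔤 →L[ℝ] 𝔤) : Prop :=
  ∀ x, x ≠ 0 → DifferentiableAt ℝ X x ∧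
    ∀ i, fderiv ℝ X x (e i) = X x * adg (a i x) - adg (a i x) * X x

/-- The equation is `∂_i X = [X, ad a_i]`, and a commutator with a fixed operator is a derivation.
With sums and constants this makes every polynomial in a parallel field parallel. -/
theorem IsParallelEnd.mul {X Y : E3 → 𝔤 →L[ℝ] 𝔤} (hX : IsParallelEnd a X)
    (hY : IsParallelEnd a Y) : IsParallelEnd a (fun x => X x * Y x) := by
  intro x hx
  have h := (hX x hx).1.hasFDerivAt.mul' (hY x hx).1.hasFDerivAt
  refine ⟨h.differentiableAt, fun i => ?_⟩
  have := (hX x hx).2 i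
  have h2 := (hY x hx).2 i
  rw [HasFDerivAt.fderiv (f := fun x => X x * Y x) h]
  simp only [add_apply, smul_apply, smul_eq_mul,
    MulOpposite.smul_eq_mul_unop, MulOpposite.unop_op, this, h2]
  noncomm_ring

theorem IsParallelEnd.add {X Y : E3 → 𝔤 →L[ℝ] 𝔤} (hX : IsParallelEnd a X)
    (hY : IsParallelEnd a Y) : IsParallelEnd a (fun x => X x + Y x) := by
  intro x hx
  have h := (hX x hx).1.hasFDerivAt.add (hY x hx).1.hasFDerivAt
  refine ⟨h.differentiableAt, fun i => ?_⟩
  have := (hX x hx).2 i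
  have h2 := (hY x hx).2 i
  rw [HasFDerivAt.fderiv (f := fun x => X x + Y x) h]
  simp only [add_apply, this, h2]
  noncomm_ring

theorem isParallelEnd_const (r : ℝ) :
    IsParallelEnd a (fun _ => algebraMap ℝ (𝔤 →L[ℝ] 𝔤) r) := by
  intro x hx
  refine ⟨differentiableAt_const _, fun i => ?_⟩
  rw [fderiv_fun_const, Algebra.commutes]
  simp

theorem IsParallelEnd.aeval {X : E3 → 𝔤 →L[ℝ] 𝔤} (hX : IsParallelEnd a X)
    (p : Polynomial ℝ) : IsParallelEnd a (fun x => Polynomial.aeval (X x) p) := by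
  induction p using Polynomial.induction_on with
  | C r => simpa using isParallelEnd_const r
  | add p q hp hq => simpa using hp.add hq
  | monomial n r h =>
    have h2 := h.mul hX
    convert h2 using 2
    simp [pow_succ, mul_assoc]

/-- Since `∂_i Φ = -[a_i, Φ]`, this is the Jacobi identity `ad [a_i, Φ] = [ad a_i, ad Φ]`. -/
theorem isParallelEnd_adg {Φ : E3 → 𝔤} (hΦ : ∀ x, x ≠ 0 → DifferentiableAt ℝ Φ x)
    (h : ∀ x, x ≠ 0 → ∀ i, cov a i Φ x = 0) : IsParallelEnd a (fun x => adg (Φ x)) := by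
  intro x hx
  have h1 := (adg (𝔤 := 𝔤)).hasFDerivAt.comp x (hΦ x hx).hasFDerivAt
  refine ⟨h1.differentiableAt, fun i => ?_⟩
  rw [HasFDerivAt.fderiv (f := fun x => adg (Φ x)) h1]
  have h2 : fderiv ℝ Φ x (e i) = -⁅a i x, Φ x⁆ := eq_neg_of_add_eq_zero_left (h x hx i)
  ext v
  simp only [ContinuousLinearMap.comp_apply, h2, adg_apply, sub_apply,
    mul_apply_eq_comp]
  rw [neg_lie, leibniz_lie (a i x) (Φ x) v]
  abel

/-- The sum is the trace of `T^* T A`, a symmetric operator times a skew one. -/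
theorem sum_inner_skew_eq_zero (T A : 𝔤 →L[ℝ] 𝔤)
    (hA : ∀ v w, inner ℝ (A v) w = -inner ℝ v (A w)) :
    ∑ b, inner ℝ (T (stdOrthonormalBasis ℝ 𝔤 b)) (T (A (stdOrthonormalBasis ℝ 𝔤 b))) = 0 := by
  set B := stdOrthonormalBasis ℝ 𝔤
  have h1 : ∀ b, T (A (B b)) = ∑ k, inner ℝ (B k) (A (B b)) • T (B k) := by
    intro b
    conv_lhs => rw [← B.sum_repr (A (B b))]
    simp [B.repr_apply_apply]
  have h2 : ∑ b, inner ℝ (T (B b)) (T (A (B b)))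
      = ∑ b, ∑ k, inner ℝ (B k) (A (B b)) * inner ℝ (T (B b)) (T (B k)) := by
    refine Finset.sum_congr rfl fun b _ => ?_
    rw [h1, inner_sum]
    simp [inner_smul_right]
  have h3 : ∑ b, ∑ k, inner ℝ (B k) (A (B b)) * inner ℝ (T (B b)) (T (B k))
      = -∑ b, ∑ k, inner ℝ (B k) (A (B b)) * inner ℝ (T (B b)) (T (B k)) := by
    conv_lhs => rw [Finset.sum_comm]
    simp only [← Finset.sum_neg_distrib]
    refine Finset.sum_congr rfl fun b _ => Finset.sum_congr rfl fun k _ => ?_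
    rw [← real_inner_comm (T (B k)), ← real_inner_comm (B b), hA (B k), neg_mul]
  rw [h2]
  linarith

/-- The Hilbert–Schmidt norm of a parallel field has zero derivative, because `ad a_i` is skew, and
`ℝ³ ∖ {0}` is connected. -/
theorem IsParallelEnd.eq_zero {X : E3 → 𝔤 →L[ℝ] 𝔤} (hX : IsParallelEnd a X) {x₀ : E3}
    (h₀ : x₀ ≠ 0) (hX₀ : X x₀ = 0) {x : E3} (hx : x ≠ 0) : X x = 0 := by
  set B := stdOrthonormalBasis ℝ 𝔤
  let f : E3 → ℝ := fun y => ∑ b, inner ℝ (X y (B b)) (X y (B b))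
  have hd : ∀ y, y ≠ 0 → HasFDerivAt f (0 : E3 →L[ℝ] ℝ) y := by
    intro y hy
    have h1 : ∀ b, HasFDerivAt (fun z => X z (B b))
        ((ContinuousLinearMap.apply ℝ 𝔤 (B b)).comp (fderiv ℝ X y)) y := fun b =>
      (ContinuousLinearMap.apply ℝ 𝔤 (B b)).hasFDerivAt.comp y (hX y hy).1.hasFDerivAt
    have h2 := HasFDerivAt.fun_sum (u := Finset.univ) fun b _ => (h1 b).inner ℝ (h1 b)
    convert! h2 using 1
    symm
    apply ext_of_e
    intro i
    have h3 : ∀ b, inner ℝ (X y (B b)) (fderiv ℝ X y (e i) (B b))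
        = inner ℝ (X y (B b)) (X y (adg (a i y) (B b))) := by
      intro b
      rw [(hX y hy).2 i]
      simp only [sub_apply, mul_apply_eq_comp, inner_sub_right]
      have h4 : inner ℝ (X y (B b)) (adg (a i y) (X y (B b))) = 0 := by
        have h5 := inner_lie_swap (a i y) (X y (B b)) (X y (B b))
        rw [real_inner_comm] at h5
        simp only [adg_apply]
        linarith
      rw [h4, sub_zero]
    have h6 := sum_inner_skew_eq_zero (X y) (adg (a i y)) (inner_lie_swap (a i y))
    simp only [sum_apply, ContinuousLinearMap.comp_apply,
      ContinuousLinearMap.prod_apply, fderivInnerCLM_apply, ContinuousLinearMap.apply_apply]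
    simp only [real_inner_comm (X y _) (fderiv ℝ X y (e i) _), h3, Finset.sum_add_distrib]
    rw [h6, add_zero]
  have hconst : f x = f x₀ := by
    have hpre : IsPreconnected ({0}ᶜ : Set E3) :=
      (isConnected_compl_singleton_of_one_lt_rank (by
        rw [← Module.finrank_eq_rank, finrank_euclideanSpace_fin]; norm_num) 0).isPreconnected
    refine (isOpen_compl_singleton).is_const_of_fderiv_eq_zero (𝕜 := ℝ) hpre
      (fun y hy => (hd y hy).differentiableAt.differentiableWithinAt)
      (fun y hy => (hd y hy).fderiv) hx h₀
  have hz : f x = 0 := by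
    rw [hconst]
    simp [f, hX₀]
  have hall : ∀ b, X x (B b) = 0 := by
    intro b
    have := (Finset.sum_eq_zero_iff_of_nonneg (fun b _ => real_inner_self_nonneg)).mp hz b
      (Finset.mem_univ b)
    exact inner_self_eq_zero.mp this
  ext v
  rw [← B.sum_repr v]
  simp [hall]

/-- A skew operator has no nilpotent part: `|(ad Y)^(n+1) w|² = -⟨(ad Y)^n w, (ad Y)^(n+2) w⟩`. -/
theorem lie_eq_zero_of_pow {Y w : 𝔤} (n : ℕ) (h : (adg Y ^ (n + 1)) w = 0) : ⁅Y, w⁆ = 0 := by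
  induction n with
  | zero => simpa using h
  | succ n ih =>
    apply ih
    rw [← inner_self_eq_zero (𝕜 := ℝ)]
    have h1 : (adg Y ^ (n + 1)) w = ⁅Y, (adg Y ^ n) w⁆ := by rw [pow_succ']; rfl
    have h2 : (adg Y ^ (n + 1 + 1)) w = ⁅Y, (adg Y ^ (n + 1)) w⁆ := by
      rw [pow_succ' _ (n + 1)]; rfl
    nth_rewrite 1 [h1]
    rw [inner_lie_swap, ← h2, h, inner_zero_right, neg_zero]

/-- Modulo the image of `ad Φ_∞`, every `v` can be moved into `ker (ad Φ_∞)` by a polynomial in `ad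
Φ_∞`. That kernel is abelian and contains `κ`, so `[κ, v]` only sees `[Φ_∞, v]`. Using one
polynomial for the whole sphere keeps the constant uniform. -/
theorem AsymptoticExpansion.norm_lie_charge_le {m : Monopole 𝔤} (d : AsymptoticExpansion m)
    (hd : d.MaximalSymmetryBreaking) :
    ∃ C : ℝ, 0 ≤ C ∧ ∀ x, x ≠ 0 → ∀ v : 𝔤, ‖⁅d.κ x, v⁆‖ ≤ C * ‖⁅d.Φinf x, v⁆‖ := by
  obtain ⟨x₀, h₀, -⟩ := d.Φinf_ne_zero
  have hΦ : ∀ x, x ≠ 0 → DifferentiableAt ℝ d.Φinf x := fun x hx =>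
    ((d.smooth_Φinf.contDiffAt (isOpen_compl_singleton.mem_nhds hx)).differentiableAt (by simp))
  have hpar := isParallelEnd_adg hΦ d.parallel
  have hint : IsIntegral ℝ (adg (d.Φinf x₀)) := Algebra.IsIntegral.isIntegral _
  -- The minimal polynomial at the single point `x₀` is `X ^ n * u` with `u(0) ≠ 0`. By parallelism
  -- it annihilates `ad Φ_∞` at every point, so `u(ad Φ_∞)` maps into the kernel of `(ad Φ_∞)^n`.
  obtain ⟨u, hu, hnd⟩ := Polynomial.exists_eq_pow_rootMultiplicity_mul_and_not_dvd
    (minpoly ℝ (adg (d.Φinf x₀))) (minpoly.ne_zero hint) 0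
  set n := Polynomial.rootMultiplicity 0 (minpoly ℝ (adg (d.Φinf x₀)))
  rw [Polynomial.C_0, sub_zero] at hu hnd
  rw [Polynomial.X_dvd_iff] at hnd
  have hzero : ∀ x, x ≠ 0 → Polynomial.aeval (adg (d.Φinf x)) (Polynomial.X ^ n * u) = 0 :=
    fun x hx => (hpar.aeval _).eq_zero h₀ (by rw [← hu]; exact minpoly.aeval _ _) hx
  have hker : ∀ x, x ≠ 0 → ∀ v, ⁅d.κ x, Polynomial.aeval (adg (d.Φinf x)) u v⁆ = 0 := by
    intro x hx v
    have h1 := DFunLike.congr_fun (hzero x hx) v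
    rw [map_mul, map_pow, Polynomial.aeval_X, mul_apply_eq_comp] at h1
    rcases n with _ | n
    · have h2 : Polynomial.aeval (adg (d.Φinf x)) u v = 0 := h1
      rw [h2, lie_zero]
    · exact hd x hx _ _ (d.commute x hx) (lie_eq_zero_of_pow n h1)
  -- From `u = divX u * X + u(0)` and `[κ, u(ad Φ_∞) v] = 0` follows `u(0) [κ, v] = -[κ, (divX u)(ad
  -- Φ_∞) [Φ_∞, v]]`. The function bounded here is the resulting constant at `x`.
  obtain ⟨C, hC0, hC⟩ := exists_bound_of_homogeneous
    (f := fun x => |u.coeff 0|⁻¹ * ‖adg (d.κ x)‖ * ‖Polynomial.aeval (adg (d.Φinf x)) u.divX‖)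
    (by
      have h1 : ContinuousOn (fun x => adg (d.κ x)) {0}ᶜ :=
        (adg (𝔤 := 𝔤)).continuous.comp_continuousOn d.smooth_κ.continuousOn
      have h2 : ContinuousOn (fun x => Polynomial.aeval (adg (d.Φinf x)) u.divX) {0}ᶜ :=
        (Polynomial.continuous_aeval _).comp_continuousOn
          ((adg (𝔤 := 𝔤)).continuous.comp_continuousOn d.smooth_Φinf.continuousOn)
      exact (continuousOn_const.mul h1.norm).mul h2.norm)
    (by
      intro t x ht hx
      simp only [d.κ_smul t x ht hx, d.Φinf_smul t x ht hx])
  refine ⟨C, hC0, fun x hx v => ?_⟩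
  have h1 : Polynomial.aeval (adg (d.Φinf x)) u v
      = Polynomial.aeval (adg (d.Φinf x)) u.divX ⁅d.Φinf x, v⁆ + u.coeff 0 • v := by
    conv_lhs => rw [← Polynomial.divX_mul_X_add u]
    simp [Algebra.algebraMap_eq_smul_one]
  have h2 := hker x hx v
  rw [h1, lie_add, lie_smul] at h2
  have h3 : ⁅d.κ x, v⁆ = -((u.coeff 0)⁻¹ •
      ⁅d.κ x, Polynomial.aeval (adg (d.Φinf x)) u.divX ⁅d.Φinf x, v⁆⁆) := by
    rw [eq_neg_of_add_eq_zero_left h2, smul_neg, neg_neg, smul_smul, inv_mul_cancel₀ hnd, one_smul]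
  rw [h3, norm_neg, norm_smul, norm_inv, Real.norm_eq_abs]
  calc |u.coeff 0|⁻¹ * ‖⁅d.κ x, Polynomial.aeval (adg (d.Φinf x)) u.divX ⁅d.Φinf x, v⁆⁆‖
      ≤ |u.coeff 0|⁻¹ * (‖adg (d.κ x)‖ * (‖Polynomial.aeval (adg (d.Φinf x)) u.divX‖ *
          ‖⁅d.Φinf x, v⁆‖)) := by
        gcongr
        exact ((adg (d.κ x)).le_opNorm _).trans
          (mul_le_mul_of_nonneg_left (ContinuousLinearMap.le_opNorm _ _) (norm_nonneg _))
    _ = |u.coeff 0|⁻¹ * ‖adg (d.κ x)‖ * ‖Polynomial.aeval (adg (d.Φinf x)) u.divX‖ *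
          ‖⁅d.Φinf x, v⁆‖ := by ring
    _ ≤ C * ‖⁅d.Φinf x, v⁆‖ := by gcongr; exact hC x hx

end Lax

variable {𝔤 : Type*} [NormedAddCommGroup 𝔤] [InnerProductSpace ℝ 𝔤] [InvariantLieAlgebra 𝔤]

/-! ### The weight `ρ` and the decay of `∇Φ` -/

theorem rho_sq (x : E3) : rho x ^ 2 = 1 + ‖x‖ ^ 2 := Real.sq_sqrt (by positivity)

theorem one_le_rho (x : E3) : 1 ≤ rho x := by
  rw [rho]
  exact Real.one_le_sqrt.mpr (by nlinarith [sq_nonneg ‖x‖])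

theorem rho_pos (x : E3) : 0 < rho x := lt_of_lt_of_le one_pos (one_le_rho x)

theorem norm_le_rho (x : E3) : ‖x‖ ≤ rho x :=
  Real.le_sqrt_of_sq_le (by linarith)

theorem rho_le (x : E3) : rho x ≤ 1 + ‖x‖ := by
  apply Real.sqrt_le_iff.mpr
  constructor
  · positivity
  · nlinarith [norm_nonneg x]

theorem contDiff_rho : ContDiff ℝ ∞ rho := by
  unfold rho
  refine ContDiff.sqrt (contDiff_const.add (contDiff_norm_sq ℝ)) fun x => ?_
  positivity

theorem continuous_rho : Continuous rho := contDiff_rho.continuous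

theorem exists_bound_of_bilinear {E F G : Type*} [NormedAddCommGroup E] [NormedSpace ℝ E]
    [NormedAddCommGroup F] [NormedSpace ℝ F] [NormedAddCommGroup G] [NormedSpace ℝ G]
    [FiniteDimensional ℝ E] [FiniteDimensional ℝ F] (f : E →ₗ[ℝ] F →ₗ[ℝ] G) :
    ∃ B : ℝ, 0 ≤ B ∧ ∀ x y, ‖f x y‖ ≤ B * ‖x‖ * ‖y‖ := by
  let g : E →L[ℝ] F →L[ℝ] G := LinearMap.toContinuousLinearMap
    ((LinearMap.toContinuousLinearMap : (F →ₗ[ℝ] G) ≃ₗ[ℝ] (F →L[ℝ] G)).toLinearMap ∘ₗ f)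
  exact ⟨‖g‖, g.opNorm_nonneg, fun x y => g.le_opNorm₂ x y⟩

section

variable [FiniteDimensional ℝ 𝔤]

theorem exists_norm_lie_le :
    ∃ B : ℝ, 0 ≤ B ∧ ∀ X v : 𝔤, ‖⁅X, v⁆‖ ≤ B * ‖X‖ * ‖v‖ := by
  obtain ⟨B, hB0, hB⟩ := exists_bound_of_bilinear (LinearMap.mk₂ ℝ (fun X v : 𝔤 => ⁅X, v⁆) add_lie
    (fun t X v => smul_lie t X v) lie_add (fun t X v => lie_smul t X v))
  exact ⟨B, hB0, hB⟩

theorem Monopole.contDiff_cov_Φ (m : Monopole 𝔤) (i : Fin 3) : ContDiff ℝ ∞ (cov m.A i m.Φ) := by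
  unfold cov
  have h1 : ContDiff ℝ ∞ fun x => fderiv ℝ m.Φ x (e i) :=
    (m.smooth_Φ.fderiv_right (m := ∞) (by simp)).clm_apply contDiff_const
  have h2 : ContDiff ℝ ∞ fun x => adg (m.A i x) (m.Φ x) :=
    ((adg (𝔤 := 𝔤)).contDiff.comp (m.smooth_A i)).clm_apply m.smooth_Φ
  exact h1.add h2

/-- Up to `O(r⁻³)`, `∇_i Φ` is a multiple of `κ` with factor at most `r⁻²`, and `[κ, v]` is
controlled by `[Φ_∞, v]`. Replacing `Φ_∞` by `Φ` changes the bracket by `O(r⁻¹) |v|`, which after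
multiplication by `r⁻²` joins the error of order `r⁻³`. -/
theorem AsymptoticExpansion.exists_bounds_outside {m : Monopole 𝔤} (d : AsymptoticExpansion m)
    (hd : d.MaximalSymmetryBreaking) :
    ∃ K : ℝ, 0 ≤ K ∧ ∀ x, d.R < ‖x‖ → ‖m.Φ x‖ ≤ K ∧ (∀ i, ‖cov m.A i m.Φ x‖ ≤ K * ‖x‖⁻¹ ^ 2) ∧
      ∀ i, ∀ v : 𝔤, ‖⁅cov m.A i m.Φ x, v⁆‖
        ≤ K * (‖x‖⁻¹ ^ 2 * ‖⁅m.Φ x, v⁆‖ + ‖x‖⁻¹ ^ 3 * ‖v‖) := by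
  obtain ⟨C, hC0, hC⟩ := d.norm_lie_charge_le hd
  obtain ⟨Cκ, hκ0, hκ⟩ := exists_bound_of_homogeneous (f := fun x => ‖d.κ x‖)
    d.smooth_κ.continuousOn.norm (fun t x ht hx => by rw [d.κ_smul t x ht hx])
  obtain ⟨CΦ, hΦ0, hΦ⟩ := exists_bound_of_homogeneous (f := fun x => ‖d.Φinf x‖)
    d.smooth_Φinf.continuousOn.norm (fun t x ht hx => by rw [d.Φinf_smul t x ht hx])
  obtain ⟨B, hB, hlie⟩ := exists_norm_lie_le (𝔤 := 𝔤)
  set q := d.R⁻¹ with hq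
  have hq0 : 0 < q := inv_pos.mpr d.R_pos
  set L := |d.K| * q + Cκ with hL
  have hL0 : 0 ≤ L := by positivity
  -- A sum serving all three bounds; the nonnegative summands that a given bound does not need are
  -- dropped at its end.
  refine ⟨L * q + CΦ + L + C + B * |d.K| + C * B * L, by positivity, fun x hx => ?_⟩
  have hr : 0 < ‖x‖ := d.R_pos.trans hx
  have hx0 : x ≠ 0 := norm_pos_iff.mp hr
  set s := ‖x‖⁻¹ with hs
  have hs0 : 0 < s := inv_pos.mpr hr
  have hsq : s ≤ q := inv_anti₀ d.R_pos hx.le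
  have e1 : d.K / ‖x‖ ^ 2 = d.K * s ^ 2 := by rw [hs, inv_pow]; rfl
  have e2 : d.K / ‖x‖ ^ 3 = d.K * s ^ 3 := by rw [hs, inv_pow]; rfl
  have hKle : d.K ≤ |d.K| := le_abs_self _
  have k1 : d.K * s ^ 2 ≤ |d.K| * q * s := by
    have : d.K * s ^ 2 ≤ |d.K| * s ^ 2 := by gcongr
    have h2 : |d.K| * s ^ 2 ≤ |d.K| * q * s := by
      rw [sq, ← mul_assoc]; gcongr
    linarith
  have k2 : d.K * s ^ 3 ≤ |d.K| * q * s ^ 2 := by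
    calc d.K * s ^ 3 = d.K * s ^ 2 * s := by ring
      _ ≤ |d.K| * q * s * s := by gcongr
      _ = _ := by ring
  have hΦd : ‖m.Φ x - d.u x (d.Φinf x)‖ ≤ L * s := by
    have h1 := d.expansion x hx
    rw [e1, map_sub, map_smul] at h1
    have h2 : m.Φ x - d.u x (d.Φinf x)
        = (m.Φ x - (d.u x (d.Φinf x) - (1 / (2 * ‖x‖)) • d.u x (d.κ x)))
          - (1 / (2 * ‖x‖)) • d.u x (d.κ x) := by abel
    rw [h2]
    refine (norm_sub_le _ _).trans ?_
    rw [norm_smul, d.u_norm x hx, Real.norm_of_nonneg (by positivity)]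
    have h3 : 1 / (2 * ‖x‖) = s / 2 := by rw [hs]; field_simp
    have h4 := hκ x hx0
    rw [h3] at h1 ⊢
    rw [hL]
    have h5 : s / 2 * ‖d.κ x‖ ≤ s * Cκ := by
      apply mul_le_mul (by linarith) h4 (norm_nonneg _) hs0.le
    linarith
  have hcoef : ∀ i, |1 / (2 * ‖x‖ ^ 2) * (x i / ‖x‖)| ≤ s ^ 2 := by
    intro i
    have h1 : |x i| ≤ ‖x‖ := PiLp.norm_apply_le x i
    have h2 : |x i / ‖x‖| ≤ 1 := by
      rw [abs_div, abs_norm]; exact div_le_one_of_le₀ h1 hr.le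
    rw [abs_mul, abs_of_nonneg (by positivity)]
    have h3 : 1 / (2 * ‖x‖ ^ 2) ≤ s ^ 2 := by
      rw [hs, inv_pow, one_div]
      apply inv_anti₀ (by positivity)
      nlinarith [sq_nonneg ‖x‖]
    calc 1 / (2 * ‖x‖ ^ 2) * |x i / ‖x‖| ≤ s ^ 2 * 1 := by gcongr
      _ = s ^ 2 := mul_one _
  have hgd : ∀ i, ‖cov m.A i m.Φ x
      - (1 / (2 * ‖x‖ ^ 2) * (x i / ‖x‖)) • d.u x (d.κ x)‖ ≤ |d.K| * s ^ 3 := by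
    intro i
    have h1 := d.expansion_deriv x hx i
    rw [e2, map_smul] at h1
    exact h1.trans (by gcongr)
  refine ⟨?_, fun i => ?_, fun i v => ?_⟩
  · have h1 : ‖m.Φ x‖ ≤ ‖m.Φ x - d.u x (d.Φinf x)‖ + ‖d.u x (d.Φinf x)‖ := norm_le_norm_sub_add _ _
    rw [d.u_norm x hx] at h1
    have h2 := hΦ x hx0
    have h3 : L * s ≤ L * q := by gcongr
    have h4 : 0 ≤ L + C + B * |d.K| + C * B * L := by positivity
    linarith
  · have h1 := norm_le_norm_sub_add (cov m.A i m.Φ x)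
      ((1 / (2 * ‖x‖ ^ 2) * (x i / ‖x‖)) • d.u x (d.κ x))
    rw [norm_smul, d.u_norm x hx, Real.norm_eq_abs] at h1
    have h2 := hκ x hx0
    have h3 := mul_le_mul (hcoef i) h2 (norm_nonneg _) (by positivity)
    have h4 : |d.K| * s ^ 3 ≤ |d.K| * q * s ^ 2 := by
      calc |d.K| * s ^ 3 = |d.K| * s * s ^ 2 := by ring
        _ ≤ _ := by gcongr
    have h5 : 0 ≤ (L * q + CΦ + C + B * |d.K| + C * B * L) * s ^ 2 := by positivity
    have h6 := hgd i
    have h7 : L * s ^ 2 = |d.K| * q * s ^ 2 + s ^ 2 * Cκ := by rw [hL]; ring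
    linarith
  -- An isometric endomorphism of a finite-dimensional space is onto, so brackets with `v` can be
  -- transported back to the model at infinity.
  · obtain ⟨w, rfl⟩ : ∃ w, d.u x w = v := by
      have hinj : Function.Injective (d.u x : 𝔤 →ₗ[ℝ] 𝔤) := by
        refine (injective_iff_map_eq_zero _).mpr fun w hw => ?_
        rw [← norm_eq_zero, ← d.u_norm x hx w]
        exact norm_eq_zero.mpr hw
      exact LinearMap.injective_iff_surjective.mp hinj v
    set t := 1 / (2 * ‖x‖ ^ 2) * (x i / ‖x‖) with ht
    have h1 : ⁅cov m.A i m.Φ x, d.u x w⁆ = ⁅cov m.A i m.Φ x - t • d.u x (d.κ x), d.u x w⁆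
        + t • ⁅d.u x (d.κ x), d.u x w⁆ := by
      rw [sub_lie, smul_lie, sub_add_cancel]
    have h2 : ⁅d.u x (d.Φinf x), d.u x w⁆
        = ⁅m.Φ x, d.u x w⁆ - ⁅m.Φ x - d.u x (d.Φinf x), d.u x w⁆ := by
      rw [sub_lie, sub_sub_cancel]
    have h3 : ‖⁅d.u x (d.κ x), d.u x w⁆‖
        ≤ C * (‖⁅m.Φ x, d.u x w⁆‖ + B * (L * s) * ‖d.u x w‖) := by
      rw [← d.u_lie x hx, d.u_norm x hx]
      refine (hC x hx0 w).trans ?_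
      rw [← d.u_norm x hx ⁅d.Φinf x, w⁆, d.u_lie x hx, h2]
      refine mul_le_mul_of_nonneg_left ((norm_sub_le _ _).trans ?_) hC0
      refine add_le_add le_rfl ((hlie _ _).trans ?_)
      gcongr
    rw [h1]
    refine (norm_add_le _ _).trans ?_
    rw [norm_smul, Real.norm_eq_abs]
    have h4 : ‖⁅cov m.A i m.Φ x - t • d.u x (d.κ x), d.u x w⁆‖
        ≤ B * (|d.K| * s ^ 3) * ‖d.u x w‖ :=
      (hlie _ _).trans (by gcongr; exact hgd i)
    have h5 := mul_le_mul (hcoef i) h3 (norm_nonneg _) (by positivity)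
    set P := ‖⁅m.Φ x, d.u x w⁆‖
    have hP : 0 ≤ P := norm_nonneg _
    set N := ‖d.u x w‖
    have hN : 0 ≤ N := norm_nonneg _
    have h6 : 0 ≤ (L * q + CΦ + L + B * |d.K| + C * B * L) * (s ^ 2 * P) := by positivity
    have h7 : 0 ≤ (L * q + CΦ + L + C) * (s ^ 3 * N) := by positivity
    have h8 : s ^ 2 * (C * (P + B * (L * s) * N)) = C * (s ^ 2 * P) + C * B * L * (s ^ 3 * N) := by
      ring
    have h9 : B * (|d.K| * s ^ 3) * N = B * |d.K| * (s ^ 3 * N) := by ring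
    linarith

/-- The decay properties of a monopole with maximal symmetry breaking which are used below. -/
structure Monopole.Decay (m : Monopole 𝔤) (K : ℝ) : Prop where
  pos : 0 < K
  Φ : ∀ x, ‖m.Φ x‖ ≤ K
  dΦ : ∀ i x, ‖cov m.A i m.Φ x‖ ≤ K * (rho x)⁻¹ ^ 2
  lie : ∀ i x, ∀ v : 𝔤, ‖⁅cov m.A i m.Φ x, v⁆‖
    ≤ K * ((rho x)⁻¹ ^ 2 * ‖⁅m.Φ x, v⁆‖ + (rho x)⁻¹ ^ 3 * ‖v‖)

/-- On the ball, continuity on a compact set gives bounds and `p ρ⁻¹ ≥ 1` inserts the weights at no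
cost; outside, `|x|⁻¹ ≤ q ρ⁻¹`. -/
theorem AsymptoticExpansion.exists_decay {m : Monopole 𝔤} (d : AsymptoticExpansion m)
    (hd : d.MaximalSymmetryBreaking) : ∃ K, m.Decay K := by
  obtain ⟨K₁, hK₁, h⟩ := d.exists_bounds_outside hd
  have hin : ∀ f : E3 → 𝔤, Continuous f → ∃ C, 0 ≤ C ∧ ∀ x, ‖x‖ ≤ d.R → ‖f x‖ ≤ C := by
    intro f hf
    obtain ⟨C, hC⟩ := (isCompact_closedBall (0 : E3) d.R).exists_bound_of_continuousOn
      hf.continuousOn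
    refine ⟨max C 0, le_max_right _ _, fun x hx => (hC x ?_).trans (le_max_left _ _)⟩
    simpa using hx
  obtain ⟨C₀, hC₀, h0⟩ := hin m.Φ m.smooth_Φ.continuous
  choose C₁ hC₁ h1 using fun i => hin _ (m.contDiff_cov_Φ i).continuous
  set S := ∑ i, C₁ i with hS
  have hS0 : 0 ≤ S := Finset.sum_nonneg fun i _ => hC₁ i
  have h1' : ∀ i x, ‖x‖ ≤ d.R → ‖cov m.A i m.Φ x‖ ≤ S := fun i x hx =>
    (h1 i x hx).trans (Finset.single_le_sum (fun i _ => hC₁ i) (Finset.mem_univ i))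
  obtain ⟨B, hB, hlie⟩ := exists_norm_lie_le (𝔤 := 𝔤)
  have hR := d.R_pos
  set p := 1 + d.R with hp
  set q := 1 + d.R⁻¹ with hq
  have hq1 : 1 ≤ q := by rw [hq]; linarith [inv_pos.mpr hR]
  have hin : ∀ x : E3, ‖x‖ ≤ d.R → 1 ≤ p * (rho x)⁻¹ := by
    intro x hx
    rw [← div_eq_mul_inv, one_le_div (rho_pos x)]
    linarith [rho_le x]
  have hout : ∀ x : E3, d.R < ‖x‖ → ‖x‖⁻¹ ≤ q * (rho x)⁻¹ := by
    intro x hx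
    have hx0 : 0 < ‖x‖ := hR.trans hx
    rw [← div_eq_mul_inv, le_div_iff₀ (rho_pos x)]
    have h2 : ‖x‖⁻¹ ≤ d.R⁻¹ := inv_anti₀ hR hx.le
    calc ‖x‖⁻¹ * rho x ≤ ‖x‖⁻¹ * (1 + ‖x‖) := by gcongr; exact rho_le x
      _ = ‖x‖⁻¹ + 1 := by field_simp
      _ ≤ q := by linarith
  have hKnn : 0 ≤ K₁ + C₀ + S * p ^ 2 + B * S * p ^ 3 + K₁ * q ^ 2 + K₁ * q ^ 3 := by positivity
  refine ⟨K₁ + C₀ + S * p ^ 2 + B * S * p ^ 3 + K₁ * q ^ 2 + K₁ * q ^ 3 + 1, by linarith,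
    fun x => ?_, fun i x => ?_, fun i x v => ?_⟩
  · have hnn : 0 ≤ S * p ^ 2 + B * S * p ^ 3 + K₁ * q ^ 2 + K₁ * q ^ 3 := by positivity
    rcases le_or_gt ‖x‖ d.R with hx | hx
    · linarith [h0 x hx]
    · linarith [(h x hx).1]
  · have hρ := inv_pos.mpr (rho_pos x)
    rcases le_or_gt ‖x‖ d.R with hx | hx
    · have a1 := h1' i x hx
      have a2 : S ≤ S * (p * (rho x)⁻¹) ^ 2 := le_mul_of_one_le_right hS0 (one_le_pow₀ (hin x hx))
      have a3 : 0 ≤ (K₁ + C₀ + B * S * p ^ 3 + K₁ * q ^ 2 + K₁ * q ^ 3 + 1) * (rho x)⁻¹ ^ 2 := by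
        positivity
      linarith
    · have a1 := (h x hx).2.1 i
      have a2 : K₁ * ‖x‖⁻¹ ^ 2 ≤ K₁ * (q * (rho x)⁻¹) ^ 2 := by gcongr; exact hout x hx
      have a3 : 0 ≤ (K₁ + C₀ + S * p ^ 2 + B * S * p ^ 3 + K₁ * q ^ 3 + 1) * (rho x)⁻¹ ^ 2 := by
        positivity
      linarith
  · have hρ := inv_pos.mpr (rho_pos x)
    rcases le_or_gt ‖x‖ d.R with hx | hx
    · have a1 : ‖⁅cov m.A i m.Φ x, v⁆‖ ≤ B * S * ‖v‖ :=
        (hlie _ _).trans (by gcongr; exact h1' i x hx)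
      have a2 : B * S * ‖v‖ ≤ B * S * ‖v‖ * (p * (rho x)⁻¹) ^ 3 :=
        le_mul_of_one_le_right (by positivity) (one_le_pow₀ (hin x hx))
      have a3 : 0 ≤ (K₁ + C₀ + S * p ^ 2 + B * S * p ^ 3 + K₁ * q ^ 2 + K₁ * q ^ 3 + 1) *
        ((rho x)⁻¹ ^ 2 * ‖⁅m.Φ x, v⁆‖) := by positivity
      have a4 : 0 ≤ (K₁ + C₀ + S * p ^ 2 + K₁ * q ^ 2 + K₁ * q ^ 3 + 1) *
        ((rho x)⁻¹ ^ 3 * ‖v‖) := by positivity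
      linarith
    · have a1 := (h x hx).2.2 i v
      have a2 : K₁ * (‖x‖⁻¹ ^ 2 * ‖⁅m.Φ x, v⁆‖) ≤ K₁ * ((q * (rho x)⁻¹) ^ 2 * ‖⁅m.Φ x, v⁆‖) := by
        gcongr; exact hout x hx
      have a3 : K₁ * (‖x‖⁻¹ ^ 3 * ‖v‖) ≤ K₁ * ((q * (rho x)⁻¹) ^ 3 * ‖v‖) := by
        gcongr; exact hout x hx
      have a4 : 0 ≤ (K₁ + C₀ + S * p ^ 2 + B * S * p ^ 3 + K₁ * q ^ 3 + 1) *
        ((rho x)⁻¹ ^ 2 * ‖⁅m.Φ x, v⁆‖) := by positivity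
      have a5 : 0 ≤ (K₁ + C₀ + S * p ^ 2 + B * S * p ^ 3 + K₁ * q ^ 2 + 1) *
        ((rho x)⁻¹ ^ 3 * ‖v‖) := by positivity
      linarith

theorem Monopole.Decay.adFib_dΦ {m : Monopole 𝔤} {K : ℝ} (h : m.Decay K) (i : Fin 3) (x : E3)
    (c : Fib 𝔤) : ‖adFib (cov m.A i m.Φ x) c‖
      ≤ 2 * K * ((rho x)⁻¹ ^ 2 * ‖adFib (m.Φ x) c‖ + (rho x)⁻¹ ^ 3 * ‖c‖) := by
  have hρ := inv_pos.mpr (rho_pos x)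
  have := h.pos
  have h1 := norm_adFib_le (X := cov m.A i m.Φ x) (Y := m.Φ x) (a := K * (rho x)⁻¹ ^ 2)
    (b := K * (rho x)⁻¹ ^ 3) (by positivity) (by positivity)
    (fun v => (h.lie i x v).trans_eq (by ring)) c
  exact h1.trans_eq (by ring)

theorem exists_norm_adFib_le :
    ∃ B : ℝ, 0 ≤ B ∧ ∀ (X : 𝔤) (c : Fib 𝔤), ‖adFib X c‖ ≤ B * ‖X‖ * ‖c‖ := by
  obtain ⟨B, hB, h⟩ := exists_norm_lie_le (𝔤 := 𝔤)
  refine ⟨2 * B, by positivity, fun X c => ?_⟩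
  have h1 := norm_adFib_le (X := X) (Y := 0) (a := 0) (b := B * ‖X‖) le_rfl (by positivity)
    (fun v => by simpa using h X v) c
  linarith

end

/-! ### Gauge data on a trivial Euclidean vector bundle -/

section Generic

/-- A metric connection `d + a` on the trivial bundle with fibre `F` over `ℝ³`, with a skew
endomorphism `P`, such that the curvature is the dual of the covariant derivative of `P` and
the latter decays. -/
structure GaugeData (F : Type*) [NormedAddCommGroup F] [InnerProductSpace ℝ F] where
  a : Fin 3 → E3 → F →L[ℝ] F
  P : E3 → F →L[ℝ] F
  dP : Fin 3 → E3 → F →L[ℝ] F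
  K : ℝ
  smooth_a : ∀ i, ContDiff ℝ ∞ (a i)
  smooth_P : ContDiff ℝ ∞ P
  smooth_dP : ∀ i, ContDiff ℝ ∞ (dP i)
  skew_a : ∀ i x v w, inner ℝ (a i x v) w = -inner ℝ v (a i x w)
  skew_P : ∀ x v w, inner ℝ (P x v) w = -inner ℝ v (P x w)
  fderiv_P : ∀ i x v, fderiv ℝ P x (e i) v = dP i x v - (a i x (P x v) - P x (a i x v))
  curvature : ∀ i x v, fderiv ℝ (a (i + 2)) x (e (i + 1)) v - fderiv ℝ (a (i + 1)) x (e (i + 2)) v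
    + (a (i + 1) x (a (i + 2) x v) - a (i + 2) x (a (i + 1) x v)) = dP i x v
  K_pos : 0 < K
  norm_P : ∀ x v, ‖P x v‖ ≤ K * ‖v‖
  norm_dP : ∀ i x v, ‖dP i x v‖ ≤ K * ((rho x)⁻¹ ^ 2 * ‖v‖)
  -- The trace left by maximal symmetry breaking: the critical weight `ρ⁻²` multiplies only `P v`,
  -- and the rest of `v` carries `ρ⁻³`.
  dP_le : ∀ i x v, ‖dP i x v‖ ≤ K * ((rho x)⁻¹ ^ 2 * ‖P x v‖ + (rho x)⁻¹ ^ 3 * ‖v‖)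

/-- Coefficients of a first order operator `∑ γ_j ∇_j + β P` of Dirac type. -/
structure DiracCoeff {F : Type*} [NormedAddCommGroup F] [InnerProductSpace ℝ F]
    (G : GaugeData F) where
  γ : Fin 3 → F →L[ℝ] F
  β : F →L[ℝ] F
  s : ℝ
  γ_a : ∀ j i x v, γ j (G.a i x v) = G.a i x (γ j v)
  γ_P : ∀ j x v, γ j (G.P x v) = G.P x (γ j v)
  β_a : ∀ i x v, β (G.a i x v) = G.a i x (β v)
  β_P : ∀ x v, β (G.P x v) = G.P x (β v)
  norm_γ : ∀ j v, ‖γ j v‖ = ‖v‖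
  norm_β : ∀ v, ‖β v‖ = ‖v‖
  γ_anti : ∀ j k v w, j ≠ k → inner ℝ (γ j v) (γ k w) = -inner ℝ (γ k v) (γ j w)
  γ_β : ∀ j v w, inner ℝ (γ j v) (β w) = -inner ℝ (γ j w) (β v)
  γ_γ : ∀ j v w, inner ℝ (γ (j + 1) v) (γ (j + 2) w) = s * inner ℝ (γ j v) (β w)

variable {F : Type*} [NormedAddCommGroup F] [InnerProductSpace ℝ F]

/-- Smooth compactly supported functions. -/
def Test (φ : E3 → F) : Prop := ContDiff ℝ ∞ φ ∧ HasCompactSupport φ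

/-- The covariant derivative of a smooth function. -/
noncomputable def GaugeData.cov (G : GaugeData F) (i : Fin 3) (c : E3 → F) (x : E3) : F :=
  fderiv ℝ c x (e i) + G.a i x (c x)

variable {G : GaugeData F} {φ ψ : E3 → F}

theorem Test.continuous (h : Test φ) : Continuous φ := h.1.continuous

theorem Test.of_zero (h : Test φ) (hψ : ContDiff ℝ ∞ ψ) (h0 : ∀ x, φ x = 0 → ψ x = 0) : Test ψ :=
  ⟨hψ, h.2.mono' (fun x hx => subset_closure (fun hx' => hx (h0 x hx')))⟩

theorem Test.add (h : Test φ) (h' : Test ψ) : Test (fun x => φ x + ψ x) :=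
  ⟨h.1.add h'.1, h.2.add h'.2⟩

theorem Test.sub (h : Test φ) (h' : Test ψ) : Test (fun x => φ x - ψ x) :=
  ⟨h.1.sub h'.1, h.2.sub h'.2⟩

theorem Test.clm {B : E3 → F →L[ℝ] F} (h : Test φ) (hB : ContDiff ℝ ∞ B) :
    Test (fun x => B x (φ x)) :=
  h.of_zero (hB.clm_apply h.1) fun x hx => by rw [hx, map_zero]

theorem Test.map (h : Test φ) (L : F →L[ℝ] F) : Test (fun x => L (φ x)) :=
  h.clm contDiff_const

theorem Test.smul {χ : E3 → ℝ} (h : Test φ) (hχ : ContDiff ℝ ∞ χ) :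
    Test (fun x => χ x • φ x) :=
  h.of_zero (hχ.smul h.1) fun x hx => by rw [hx, smul_zero]

theorem contDiff_pderiv {H : Type*} [NormedAddCommGroup H] [NormedSpace ℝ H] {f : E3 → H}
    (hf : ContDiff ℝ ∞ f) (v : E3) : ContDiff ℝ ∞ (fun x => fderiv ℝ f x v) :=
  (hf.fderiv_right (m := ∞) (by simp)).clm_apply contDiff_const

theorem Test.fderiv (h : Test φ) (v : E3) : Test (fun x => fderiv ℝ φ x v) :=
  ⟨contDiff_pderiv h.1 v, h.2.fderiv_apply ℝ v⟩

theorem Test.cov (h : Test φ) (i : Fin 3) : Test (G.cov i φ) :=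
  (h.fderiv (e i)).add (h.clm (G.smooth_a i))

theorem contDiff_cov (h : ContDiff ℝ ∞ φ) (i : Fin 3) : ContDiff ℝ ∞ (G.cov i φ) :=
  (contDiff_pderiv h _).add ((G.smooth_a i).clm_apply h)

theorem Test.integrable_inner_left (h : Test φ) (hψ : Continuous ψ) :
    Integrable (fun x => inner ℝ (φ x) (ψ x)) :=
  (h.continuous.inner hψ).integrable_of_hasCompactSupport
    (h.2.mono' (fun x hx => subset_closure (fun hx' => hx (by simp [hx']))))

theorem Test.integrable_of_zero (h : Test φ) {f : E3 → ℝ} (hf : Continuous f)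
    (h0 : ∀ x, φ x = 0 → f x = 0) : Integrable f :=
  hf.integrable_of_hasCompactSupport
    (h.2.mono' (fun x hx => subset_closure (fun hx' => hx (h0 x hx'))))

theorem Test.integrable_mul_norm_sq (h : Test φ) {w : E3 → ℝ} (hw : Continuous w) :
    Integrable (fun x => w x * ‖φ x‖ ^ 2) :=
  h.integrable_of_zero (hw.mul (h.continuous.norm.pow 2)) fun x hx => by simp [hx]

theorem Test.integrable_norm_sq (h : Test φ) : Integrable (fun x => ‖φ x‖ ^ 2) := by
  simpa using h.integrable_mul_norm_sq (w := fun _ => 1) continuous_const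

theorem cov_map {L : F →L[ℝ] F} (hL : ∀ i x v, L (G.a i x v) = G.a i x (L v))
    (h : ContDiff ℝ ∞ φ) (i : Fin 3) (x : E3) :
    G.cov i (fun y => L (φ y)) x = L (G.cov i φ x) := by
  have h1 : HasFDerivAt (fun y => L (φ y)) (L.comp (fderiv ℝ φ x)) x :=
    L.hasFDerivAt.comp x (h.differentiable (by simp) x).hasFDerivAt
  simp [GaugeData.cov, h1.fderiv, hL]

theorem cov_add (h : ContDiff ℝ ∞ φ) (h' : ContDiff ℝ ∞ ψ) (i : Fin 3) (x : E3) :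
    G.cov i (fun y => φ y + ψ y) x = G.cov i φ x + G.cov i ψ x := by
  have h1 := (h.differentiable (by simp) x).hasFDerivAt.add
    (h'.differentiable (by simp) x).hasFDerivAt
  simp only [GaugeData.cov, HasFDerivAt.fderiv (f := fun y => φ y + ψ y) h1, add_apply, map_add]
  abel

theorem cov_sub (h : ContDiff ℝ ∞ φ) (h' : ContDiff ℝ ∞ ψ) (i : Fin 3) (x : E3) :
    G.cov i (fun y => φ y - ψ y) x = G.cov i φ x - G.cov i ψ x := by
  have h1 := (h.differentiable (by simp) x).hasFDerivAt.sub
    (h'.differentiable (by simp) x).hasFDerivAt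
  simp only [GaugeData.cov, HasFDerivAt.fderiv (f := fun y => φ y - ψ y) h1, sub_apply, map_sub]
  abel

theorem cov_smul {χ : E3 → ℝ} (hχ : ContDiff ℝ ∞ χ) (h : ContDiff ℝ ∞ φ) (i : Fin 3) (x : E3) :
    G.cov i (fun y => χ y • φ y) x = fderiv ℝ χ x (e i) • φ x + χ x • G.cov i φ x := by
  have h1 := (hχ.differentiable (by simp) x).hasFDerivAt.smul
    (h.differentiable (by simp) x).hasFDerivAt
  simp only [GaugeData.cov, HasFDerivAt.fderiv (f := fun y => χ y • φ y) h1, add_apply,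
    smul_apply, ContinuousLinearMap.smulRight_apply, map_smul, smul_add]
  abel

theorem cov_P (h : ContDiff ℝ ∞ φ) (i : Fin 3) (x : E3) :
    G.cov i (fun y => G.P y (φ y)) x = G.dP i x (φ x) + G.P x (G.cov i φ x) := by
  have h1 := (G.smooth_P.differentiable (by simp) x).hasFDerivAt.clm_apply
    (h.differentiable (by simp) x).hasFDerivAt
  simp only [GaugeData.cov, h1.fderiv, add_apply, ContinuousLinearMap.comp_apply,
    ContinuousLinearMap.flip_apply, G.fderiv_P, map_add]
  abel

/-- The second derivatives of `φ` cancel by symmetry; what is left is the curvature, which the data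
identify with `dP`. -/
theorem cov_comm (h : ContDiff ℝ ∞ φ) (i : Fin 3) (x : E3) :
    G.cov (i + 1) (G.cov (i + 2) φ) x - G.cov (i + 2) (G.cov (i + 1) φ) x = G.dP i x (φ x) := by
  have hd : ∀ y, DifferentiableAt ℝ φ y := fun y => h.differentiable (by simp) y
  have h2 : DifferentiableAt ℝ (fderiv ℝ φ) x :=
    (h.fderiv_right (m := ∞) (by simp)).differentiable (by simp) x
  have key : ∀ j k, G.cov j (G.cov k φ) x = fderiv ℝ (fderiv ℝ φ) x (e j) (e k)
      + fderiv ℝ (G.a k) x (e j) (φ x) + G.a k x (fderiv ℝ φ x (e j))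
      + G.a j x (fderiv ℝ φ x (e k)) + G.a j x (G.a k x (φ x)) := by
    intro j k
    have h3 := (h2.hasFDerivAt.clm_apply (hasFDerivAt_const (e k) x)).add
      (((G.smooth_a k).differentiable (by simp) x).hasFDerivAt.clm_apply (hd x).hasFDerivAt)
    have h4 : _root_.fderiv ℝ (G.cov k φ) x = _ := HasFDerivAt.fderiv h3
    simp only [GaugeData.cov] at h4 ⊢
    rw [h4]
    simp
    abel
  have hsymm : fderiv ℝ (fderiv ℝ φ) x (e (i + 1)) (e (i + 2))
      = fderiv ℝ (fderiv ℝ φ) x (e (i + 2)) (e (i + 1)) :=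
    ((contDiff_infty.mp h 2).contDiffAt.isSymmSndFDerivAt (by simp)) _ _
  rw [key, key, hsymm, ← G.curvature]
  abel

/-! ### Integration by parts -/

theorem integral_cov_left (hφ : Test φ) (hψ : ContDiff ℝ ∞ ψ) (i : Fin 3) :
    ∫ x, inner ℝ (G.cov i φ x) (ψ x) = -∫ x, inner ℝ (φ x) (G.cov i ψ x) := by
  have h1 := hφ.integrable_inner_left (contDiff_pderiv hψ (e i)).continuous
  have h2 := (hφ.fderiv (e i)).integrable_inner_left hψ.continuous
  have h3 := hφ.integrable_inner_left hψ.continuous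
  have h4 := hφ.integrable_inner_left ((G.smooth_a i).clm_apply hψ).continuous
  have h5 : ∫ x, inner ℝ (φ x) (fderiv ℝ ψ x (e i))
      = -∫ x, inner ℝ (fderiv ℝ φ x (e i)) (ψ x) := integral_bilinear_fderiv_right_eq_neg_left_of_integrable (μ := volume)
    (B := innerSL ℝ (E := F)) (f := φ) (g := ψ) (v := e i) h2 h1 h3
    (fun x _ => hφ.1.differentiable (by simp) x) (fun x _ => hψ.differentiable (by simp) x)
  simp only [GaugeData.cov, inner_add_left, inner_add_right, G.skew_a]
  rw [integral_add h2 (by exact h4.neg), integral_add h1 h4, integral_neg, h5]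
  ring

theorem integral_fderiv_mul_norm_sq (hφ : Test φ) {w : E3 → ℝ} (hw : ContDiff ℝ ∞ w) (i : Fin 3) :
    ∫ x, fderiv ℝ w x (e i) * ‖φ x‖ ^ 2 = -2 * ∫ x, w x * inner ℝ (G.cov i φ x) (φ x) := by
  have h := integral_cov_left (G := G) (ψ := fun x => w x • φ x) hφ (hw.smul hφ.1) i
  have h1 : Integrable (fun x => w x * inner ℝ (G.cov i φ x) (φ x)) := by
    have := (hφ.cov (G := G) i).integrable_inner_left (hw.smul hφ.1).continuous
    simpa [inner_smul_right] using this
  have h2 := hφ.integrable_mul_norm_sq (contDiff_pderiv hw (e i)).continuous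
  have h3 : ∀ x, inner ℝ (φ x) (G.cov i (fun y => w y • φ y) x)
      = fderiv ℝ w x (e i) * ‖φ x‖ ^ 2 + w x * inner ℝ (G.cov i φ x) (φ x) := by
    intro x
    rw [cov_smul hw hφ.1, inner_add_right, inner_smul_right, inner_smul_right,
      real_inner_self_eq_norm_sq, real_inner_comm]
  simp only [inner_smul_right] at h
  simp only [h3] at h
  rw [integral_add h2 h1] at h
  linarith

/-! ### Hardy inequalities -/

theorem hasFDerivAt_weight (k : ℕ) (i : Fin 3) (x : E3) :
    fderiv ℝ (fun y : E3 => y i * (rho y ^ 2)⁻¹ ^ k) x (e i)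
      = (rho x ^ 2)⁻¹ ^ k - 2 * k * x i ^ 2 * (rho x ^ 2)⁻¹ ^ (k + 1) := by
  have hr : ∀ y : E3, (rho y ^ 2)⁻¹ = (1 + ‖y‖ ^ 2)⁻¹ := fun y => by rw [rho_sq]
  simp only [hr]
  have hpos : (1 + ‖x‖ ^ 2) ≠ 0 := by positivity
  have h1 : HasFDerivAt (fun y : E3 => 1 + ‖y‖ ^ 2) (2 • innerSL ℝ x) x :=
    (hasStrictFDerivAt_norm_sq x).hasFDerivAt.const_add 1
  have h2 := ((hasDerivAt_inv hpos).comp_hasFDerivAt x h1).pow k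
  have h3 : HasFDerivAt (fun y : E3 => y i) (EuclideanSpace.proj i : E3 →L[ℝ] ℝ) x :=
    (EuclideanSpace.proj i : E3 →L[ℝ] ℝ).hasFDerivAt
  have h4 := h3.mul h2
  rw [HasFDerivAt.fderiv (f := fun y : E3 => y i * (1 + ‖y‖ ^ 2)⁻¹ ^ k) h4]
  have h5 : inner ℝ x (e i) = x i := by simp [e, EuclideanSpace.inner_single_right]
  have h6 : (EuclideanSpace.proj i : E3 →L[ℝ] ℝ) (e i) = 1 := by simp [e]
  simp only [Function.comp_apply, add_apply, smul_apply, innerSL_apply_apply, h5, h6, smul_eq_mul, nsmul_eq_mul]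
  rcases k with _ | k
  · simp
  · simp only [Nat.add_sub_cancel, inv_pow]
    field_simp
    push_cast
    ring

theorem contDiff_weight (k : ℕ) (i : Fin 3) :
    ContDiff ℝ ∞ (fun y : E3 => y i * (rho y ^ 2)⁻¹ ^ k) := by
  refine ContDiff.mul (EuclideanSpace.proj i : E3 →L[ℝ] ℝ).contDiff (ContDiff.pow ?_ k)
  exact (contDiff_rho.pow 2).inv fun x => (pow_pos (rho_pos x) 2).ne'

theorem sum_coord_sq (x : E3) : ∑ i, x i ^ 2 = rho x ^ 2 - 1 := by
  rw [rho_sq, EuclideanSpace.norm_sq_eq]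
  simp

/-- Integration of `|φ|²` against the divergence of the vector field `ρ^(-2k) x`, which is `(3 - 2k)
ρ^(-2k) + 2k ρ^(-2k-2)` because `|x|² = ρ² - 1`. The connection is metric, so `∂_i |φ|² = 2 ⟨∇_i φ,
φ⟩`. -/
theorem hardy_identity (G : GaugeData F) (hφ : Test φ) (k : ℕ) :
    ∫ x, ((3 - 2 * k) * (rho x)⁻¹ ^ (2 * k) + 2 * k * (rho x)⁻¹ ^ (2 * k + 2)) * ‖φ x‖ ^ 2
      = ∫ x, ∑ i, -2 * ((x i * (rho x)⁻¹ ^ (2 * k)) * inner ℝ (G.cov i φ x) (φ x)) := by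
  have h := fun i => integral_fderiv_mul_norm_sq (G := G) hφ (contDiff_weight k i) i
  rw [integral_finsetSum _ (fun i _ => ?_)]
  · simp only [integral_const_mul]
    have h2 : ∀ i, ∫ x, x i * (rho x)⁻¹ ^ (2 * k) * inner ℝ (G.cov i φ x) (φ x)
        = ∫ x, x i * (rho x ^ 2)⁻¹ ^ k * inner ℝ (G.cov i φ x) (φ x) := by
      intro i
      simp only [pow_mul, inv_pow]
    simp only [h2, ← h]
    rw [← integral_finsetSum _ (fun i _ => hφ.integrable_mul_norm_sq
      (contDiff_pderiv (contDiff_weight k i) (e i)).continuous)]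
    congr 1
    funext x
    rw [← Finset.sum_mul]
    congr 1
    simp only [hasFDerivAt_weight]
    have h3 : rho x ≠ 0 := (rho_pos x).ne'
    have h4 : ∑ i : Fin 3, ((rho x ^ 2)⁻¹ ^ k - 2 * k * x i ^ 2 * (rho x ^ 2)⁻¹ ^ (k + 1))
        = 3 * (rho x ^ 2)⁻¹ ^ k - 2 * k * (∑ i, x i ^ 2) * (rho x ^ 2)⁻¹ ^ (k + 1) := by
      simp only [Fin.sum_univ_three]; ring
    rw [h4, sum_coord_sq]
    have h5 : (rho x)⁻¹ ^ (2 * k) = (rho x ^ 2)⁻¹ ^ k := by rw [pow_mul, inv_pow]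
    have h6 : (rho x)⁻¹ ^ (2 * k + 2) = (rho x ^ 2)⁻¹ ^ k * (rho x ^ 2)⁻¹ := by
      rw [pow_add, h5, inv_pow (rho x) 2]
    have h7 : rho x ^ 2 * (rho x ^ 2)⁻¹ = 1 := mul_inv_cancel₀ (pow_ne_zero 2 h3)
    rw [h5, h6, pow_succ]
    linear_combination (2 * (k : ℝ) * (rho x ^ 2)⁻¹ ^ k) * h7
  · refine Integrable.const_mul ?_ _
    have := (hφ.cov (G := G) i).integrable_inner_left
      ((contDiff_weight k i).smul hφ.1).continuous
    simpa [inner_smul_right, pow_mul] using this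

/-- Young's inequality together with `|x| ≤ ρ`. The sign `ε` is needed because the leading
coefficient `3 - 2k` of `hardy_identity` is positive for `k = 1` and negative for `k = 2`; `A`
carries the additional weight. -/
theorem sum_inner_le {g : Fin 3 → F} {v : F} {x : E3} {A : ℝ} (hA : 0 ≤ A) {ε : ℝ}
    (hε : ε = 1 ∨ ε = -1) :
    ∑ i, ε * (2 * ((x i * (rho x)⁻¹) * A * inner ℝ (g i) v))
      ≤ 1 / 2 * ‖v‖ ^ 2 + 2 * (A ^ 2 * ∑ i, ‖g i‖ ^ 2) := by
  have h1 : ∀ i, ε * (2 * ((x i * (rho x)⁻¹) * A * inner ℝ (g i) v))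
      ≤ 1 / 2 * ((x i * (rho x)⁻¹) ^ 2 * ‖v‖ ^ 2) + 2 * (A ^ 2 * ‖g i‖ ^ 2) := by
    intro i
    have h2 : ε * inner ℝ (g i) v * (x i * (rho x)⁻¹) ≤ ‖g i‖ * ‖v‖ * |x i * (rho x)⁻¹| := by
      refine (le_abs_self _).trans ?_
      rw [abs_mul]
      have h5 : |ε * inner ℝ (g i) v| ≤ ‖g i‖ * ‖v‖ := by
        rcases hε with rfl | rfl
        · simpa using abs_real_inner_le_norm (g i) v
        · simpa using abs_real_inner_le_norm (g i) v
      exact mul_le_mul_of_nonneg_right h5 (abs_nonneg _)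
    have h3 := mul_le_mul_of_nonneg_left h2 hA
    have h4 : (x i * (rho x)⁻¹) ^ 2 = |x i * (rho x)⁻¹| ^ 2 := (sq_abs _).symm
    rw [h4]
    nlinarith [sq_nonneg (|x i * (rho x)⁻¹| * ‖v‖ - 2 * (A * ‖g i‖))]
  refine (Finset.sum_le_sum fun i _ => h1 i).trans ?_
  rw [Finset.sum_add_distrib, ← Finset.mul_sum, ← Finset.mul_sum, ← Finset.mul_sum,
    ← Finset.sum_mul]
  have h2 : ∑ i, (x i * (rho x)⁻¹) ^ 2 ≤ 1 := by
    simp only [mul_pow, ← Finset.sum_mul, sum_coord_sq]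
    have h7 : rho x ^ 2 * (rho x)⁻¹ ^ 2 = 1 := by
      rw [← mul_pow, mul_inv_cancel₀ (rho_pos x).ne', one_pow]
    have h8 : 0 ≤ (rho x)⁻¹ ^ 2 := by positivity
    linarith
  have h3 : (∑ i, (x i * (rho x)⁻¹) ^ 2) * ‖v‖ ^ 2 ≤ 1 * ‖v‖ ^ 2 := by gcongr
  linarith

theorem continuous_rho_inv : Continuous fun x => (rho x)⁻¹ :=
  continuous_rho.inv₀ fun x => (rho_pos x).ne'

/-- Hardy's inequality. -/
theorem hardy (G : GaugeData F) (hφ : Test φ) :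
    ∫ x, (rho x)⁻¹ ^ 2 * ‖φ x‖ ^ 2 ≤ 4 * ∫ x, ∑ i, ‖G.cov i φ x‖ ^ 2 := by
  have hid := hardy_identity G hφ 1
  have i1 : Integrable fun x => (rho x)⁻¹ ^ 2 * ‖φ x‖ ^ 2 :=
    hφ.integrable_mul_norm_sq (continuous_rho_inv.pow 2)
  have i2 : Integrable fun x => ∑ i, ‖G.cov i φ x‖ ^ 2 :=
    integrable_finsetSum _ fun i _ => (hφ.cov i).integrable_norm_sq
  have i3 : Integrable fun x => (rho x)⁻¹ ^ 4 * ‖φ x‖ ^ 2 :=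
    hφ.integrable_mul_norm_sq (continuous_rho_inv.pow 4)
  -- For `k = 1` the leading coefficient is `1`, and the `ρ⁻⁴` term has a favourable sign and is
  -- dropped.
  have h1 : ∫ x, (rho x)⁻¹ ^ 2 * ‖φ x‖ ^ 2
      ≤ ∫ x, ((3 - 2 * (1 : ℕ)) * (rho x)⁻¹ ^ (2 * 1) + 2 * (1 : ℕ) * (rho x)⁻¹ ^ (2 * 1 + 2))
        * ‖φ x‖ ^ 2 := by
    refine integral_mono i1 ?_ fun x => ?_
    · refine (i1.add (i3.const_mul 2)).congr (ae_of_all _ fun x => ?_)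
      simp only [Pi.add_apply]; push_cast; ring
    · have : 0 ≤ (rho x)⁻¹ ^ 4 * ‖φ x‖ ^ 2 := by positivity
      push_cast
      ring_nf at this ⊢
      linarith
  have h2 : ∫ x, ∑ i, -2 * ((x i * (rho x)⁻¹ ^ (2 * 1)) * inner ℝ (G.cov i φ x) (φ x))
      ≤ ∫ x, (1 / 2 * ((rho x)⁻¹ ^ 2 * ‖φ x‖ ^ 2) + 2 * ∑ i, ‖G.cov i φ x‖ ^ 2) := by
    refine integral_mono ?_ ((i1.const_mul _).add (i2.const_mul _)) fun x => ?_
    · refine integrable_finsetSum _ fun i _ => Integrable.const_mul ?_ _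
      have := (hφ.cov (G := G) i).integrable_inner_left
        ((contDiff_weight 1 i).smul hφ.1).continuous
      simpa [inner_smul_right] using this
    · have h3 := sum_inner_le (g := fun i => G.cov i φ x) (v := (rho x)⁻¹ • φ x) (x := x)
        (A := 1) zero_le_one (Or.inr rfl)
      rw [norm_smul, mul_pow, norm_inv, Real.norm_of_nonneg (rho_pos x).le] at h3
      simp only [inner_smul_right, one_pow, one_mul] at h3
      refine le_trans (le_of_eq ?_) h3
      refine Finset.sum_congr rfl fun i _ => ?_
      ring
  rw [integral_add (i1.const_mul _) (i2.const_mul _), integral_const_mul, integral_const_mul] at h2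
  linarith

/-- A weighted Hardy inequality with a lower order term. -/
theorem hardy_weighted (G : GaugeData F) (hφ : Test φ) :
    ∫ x, (rho x)⁻¹ ^ 4 * ‖φ x‖ ^ 2 ≤ 8 * (∫ x, (rho x)⁻¹ ^ 6 * ‖φ x‖ ^ 2)
      + 4 * ∫ x, (rho x)⁻¹ ^ 2 * ∑ i, ‖G.cov i φ x‖ ^ 2 := by
  have hid := hardy_identity G hφ 2
  have i1 : Integrable fun x => (rho x)⁻¹ ^ 4 * ‖φ x‖ ^ 2 :=
    hφ.integrable_mul_norm_sq (continuous_rho_inv.pow 4)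
  have i2 : Integrable fun x => (rho x)⁻¹ ^ 2 * ∑ i, ‖G.cov i φ x‖ ^ 2 := by
    simp only [Finset.mul_sum]
    exact integrable_finsetSum _ fun i _ =>
      (hφ.cov i).integrable_mul_norm_sq (continuous_rho_inv.pow 2)
  have i3 : Integrable fun x => (rho x)⁻¹ ^ 6 * ‖φ x‖ ^ 2 :=
    hφ.integrable_mul_norm_sq (continuous_rho_inv.pow 6)
  -- For `k = 2` the leading coefficient is `-1`, so the identity is read with the opposite sign and
  -- the `ρ⁻⁶` term becomes an error term.
  have h1 : ∫ x, ((3 - 2 * (2 : ℕ)) * (rho x)⁻¹ ^ (2 * 2) + 2 * (2 : ℕ) * (rho x)⁻¹ ^ (2 * 2 + 2))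
        * ‖φ x‖ ^ 2 = -(∫ x, (rho x)⁻¹ ^ 4 * ‖φ x‖ ^ 2) + 4 * ∫ x, (rho x)⁻¹ ^ 6 * ‖φ x‖ ^ 2 := by
    rw [← integral_const_mul, ← integral_neg, ← integral_add (by exact i1.neg) (i3.const_mul _)]
    congr 1
    funext x
    push_cast
    ring
  have h2 : ∫ x, -∑ i, -2 * ((x i * (rho x)⁻¹ ^ (2 * 2)) * inner ℝ (G.cov i φ x) (φ x))
      ≤ ∫ x, (1 / 2 * ((rho x)⁻¹ ^ 4 * ‖φ x‖ ^ 2)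
        + 2 * ((rho x)⁻¹ ^ 2 * ∑ i, ‖G.cov i φ x‖ ^ 2)) := by
    refine integral_mono ?_ ((i1.const_mul _).add (i2.const_mul _)) fun x => ?_
    · refine Integrable.neg (integrable_finsetSum _ fun i _ => Integrable.const_mul ?_ _)
      have := (hφ.cov (G := G) i).integrable_inner_left
        ((contDiff_weight 2 i).smul hφ.1).continuous
      simpa [inner_smul_right, ← pow_mul] using this
    · have h3 := sum_inner_le (g := fun i => G.cov i φ x) (v := (rho x)⁻¹ ^ 2 • φ x) (x := x)
        (A := (rho x)⁻¹) (inv_pos.mpr (rho_pos x)).le (Or.inl rfl)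
      rw [norm_smul, mul_pow, norm_pow, norm_inv, Real.norm_of_nonneg (rho_pos x).le] at h3
      simp only [inner_smul_right] at h3
      rw [show ((rho x)⁻¹ ^ 2) ^ 2 = (rho x)⁻¹ ^ 4 by ring] at h3
      refine le_trans (le_of_eq ?_) h3
      rw [← Finset.sum_neg_distrib]
      refine Finset.sum_congr rfl fun i _ => ?_
      ring
  rw [integral_add (i1.const_mul _) (i2.const_mul _), integral_const_mul, integral_const_mul,
    integral_neg, ← hid, h1] at h2
  linarith

end Generic

/-! ### A priori estimates for test functions -/

section Generic

variable {F : Type*} [NormedAddCommGroup F] [InnerProductSpace ℝ F] {G : GaugeData F}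
  {φ ψ : E3 → F}

/-- The operator `∑ γ_j ∇_j + β P` on smooth functions. -/
noncomputable def DiracCoeff.cl (T : DiracCoeff G) (φ : E3 → F) (x : E3) : F :=
  ∑ j, T.γ j (G.cov j φ x) + T.β (G.P x (φ x))

theorem DiracCoeff.contDiff_cl (T : DiracCoeff G) (h : ContDiff ℝ ∞ φ) :
    ContDiff ℝ ∞ (T.cl φ) :=
  (ContDiff.sum fun j _ => (T.γ j).contDiff.comp (contDiff_cov h j)).add
    (T.β.contDiff.comp (G.smooth_P.clm_apply h))

theorem Test.cl (h : Test φ) (T : DiracCoeff G) : Test (T.cl φ) := by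
  have h1 := (((h.cov (G := G) 0).map (T.γ 0)).add (((h.cov (G := G) 1).map (T.γ 1)).add
    (((h.cov (G := G) 2).map (T.γ 2)).add ((h.clm G.smooth_P).map T.β))))
  convert h1 using 1
  funext x
  simp only [DiracCoeff.cl, Fin.sum_univ_three]
  abel

namespace DiracCoeff

variable (T : DiracCoeff G)

/-- The symbols are isometries, so only cross terms need attention. They are listed cyclically, so
that the pair `(l+1, l+2)` matches both `γ_γ` and the curvature component dual to `l`. -/
theorem norm_sq_expand (v : Fin 3 → F) (p : F) :
    ‖∑ j, T.γ j (v j) + T.β p‖ ^ 2 = ∑ j, ‖v j‖ ^ 2 + ‖p‖ ^ 2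
      + ∑ l, 2 * inner ℝ (T.γ (l + 1) (v (l + 1))) (T.γ (l + 2) (v (l + 2)))
      + ∑ l, 2 * inner ℝ (T.γ l (v l)) (T.β p) := by
  have h : ∀ j, inner ℝ (T.γ j (v j)) (T.γ j (v j)) = ‖v j‖ ^ 2 := fun j => by
    rw [real_inner_self_eq_norm_sq, T.norm_γ]
  have h' : inner ℝ (T.β p) (T.β p) = ‖p‖ ^ 2 := by rw [real_inner_self_eq_norm_sq, T.norm_β]
  rw [← real_inner_self_eq_norm_sq]
  simp only [Fin.sum_univ_three, inner_add_left, inner_add_right, h, h']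
  have e1 : (0 : Fin 3) + 1 = 1 := rfl
  have e2 : (0 : Fin 3) + 2 = 2 := rfl
  have e3 : (1 : Fin 3) + 1 = 2 := rfl
  have e4 : (1 : Fin 3) + 2 = 0 := rfl
  have e5 : (2 : Fin 3) + 1 = 0 := rfl
  have e6 : (2 : Fin 3) + 2 = 1 := rfl
  rw [e1, e2, e3, e4, e5, e6, real_inner_comm (T.γ 1 (v 1)) (T.γ 0 (v 0)),
    real_inner_comm (T.γ 2 (v 2)) (T.γ 0 (v 0)), real_inner_comm (T.γ 2 (v 2)) (T.γ 1 (v 1)),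
    real_inner_comm (T.γ 0 (v 0)) (T.β p), real_inner_comm (T.γ 1 (v 1)) (T.β p),
    real_inner_comm (T.γ 2 (v 2)) (T.β p)]
  ring

/-- The integral is integrated by parts in two ways, moving either `∇_{l+1}` or `∇_{l+2}`; in the
second case `γ_anti` exchanges the symbols and flips the sign. Adding the two results leaves the
commutator of `∇_{l+1}` and `∇_{l+2}`, that is `dP_l`, and `γ_γ` rewrites the product of symbols. -/
theorem integral_cross_γ (hφ : Test φ) (l : Fin 3) :
    2 * ∫ x, inner ℝ (T.γ (l + 1) (G.cov (l + 1) φ x)) (T.γ (l + 2) (G.cov (l + 2) φ x))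
      = -(T.s * ∫ x, inner ℝ (T.γ l (φ x)) (T.β (G.dP l x (φ x)))) := by
  have hγ := fun j => (T.γ j).contDiff (n := ∞)
  have hne : l + 1 ≠ l + 2 := by
    intro h; simpa using add_left_cancel h
  have h1 : ∫ x, inner ℝ (T.γ (l + 1) (G.cov (l + 1) φ x)) (T.γ (l + 2) (G.cov (l + 2) φ x))
      = -∫ x, inner ℝ (T.γ (l + 1) (φ x)) (T.γ (l + 2) (G.cov (l + 1) (G.cov (l + 2) φ) x)) := by
    have := integral_cov_left (G := G) (hφ.map (T.γ (l + 1)))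
      ((hγ (l + 2)).comp (contDiff_cov (G := G) hφ.1 (l + 2))) (l + 1)
    simpa only [cov_map (T.γ_a _) hφ.1, Function.comp_def,
      cov_map (T.γ_a _) (contDiff_cov hφ.1 _)] using this
  have h2 : ∫ x, inner ℝ (T.γ (l + 1) (G.cov (l + 1) φ x)) (T.γ (l + 2) (G.cov (l + 2) φ x))
      = ∫ x, inner ℝ (T.γ (l + 1) (φ x)) (T.γ (l + 2) (G.cov (l + 2) (G.cov (l + 1) φ) x)) := by
    have := integral_cov_left (G := G) (hφ.map (T.γ (l + 2)))
      ((hγ (l + 1)).comp (contDiff_cov (G := G) hφ.1 (l + 1))) (l + 2)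
    simp only [cov_map (T.γ_a _) hφ.1, Function.comp_def,
      cov_map (T.γ_a _) (contDiff_cov hφ.1 _)] at this
    rw [← integral_neg] at this
    refine Eq.trans ?_ (this.trans ?_)
    · simp only [real_inner_comm]
    · congr 1
      funext x
      rw [T.γ_anti _ _ _ _ hne]
  have i1 : Integrable fun x => inner ℝ (T.γ (l + 1) (φ x))
      (T.γ (l + 2) (G.cov (l + 1) (G.cov (l + 2) φ) x)) :=
    (hφ.map _).integrable_inner_left
      ((hγ _).comp (contDiff_cov (contDiff_cov hφ.1 _) _)).continuous
  have i2 : Integrable fun x => inner ℝ (T.γ (l + 1) (φ x))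
      (T.γ (l + 2) (G.cov (l + 2) (G.cov (l + 1) φ) x)) :=
    (hφ.map _).integrable_inner_left
      ((hγ _).comp (contDiff_cov (contDiff_cov hφ.1 _) _)).continuous
  have h4 : T.s * ∫ x, inner ℝ (T.γ l (φ x)) (T.β (G.dP l x (φ x)))
      = (∫ x, inner ℝ (T.γ (l + 1) (φ x)) (T.γ (l + 2) (G.cov (l + 1) (G.cov (l + 2) φ) x)))
      - ∫ x, inner ℝ (T.γ (l + 1) (φ x)) (T.γ (l + 2) (G.cov (l + 2) (G.cov (l + 1) φ) x)) := by
    rw [← integral_sub i1 i2, ← integral_const_mul]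
    congr 1
    funext x
    rw [← inner_sub_right, ← map_sub, cov_comm hφ.1, T.γ_γ]
  rw [h4]
  linarith

/-- Moving `∇_l` onto `β P φ` gives the `dP` term and `⟨γ_l φ, β P ∇_l φ⟩`. Since `P` is skew and
`γ_β` holds, the latter equals the original integrand, so the integral reappears with a minus sign.
-/
theorem integral_cross_β (hφ : Test φ) (l : Fin 3) :
    2 * ∫ x, inner ℝ (T.γ l (G.cov l φ x)) (T.β (G.P x (φ x)))
      = -∫ x, inner ℝ (T.γ l (φ x)) (T.β (G.dP l x (φ x))) := by
  have hPφ : ContDiff ℝ ∞ fun x => G.P x (φ x) := G.smooth_P.clm_apply hφ.1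
  have h1 := integral_cov_left (G := G) (hφ.map (T.γ l)) (T.β.contDiff.comp hPφ) l
  simp only [cov_map (T.γ_a _) hφ.1, Function.comp_def, cov_map T.β_a hPφ,
    cov_P hφ.1, map_add, inner_add_right] at h1
  have h2 : ∀ x, inner ℝ (T.γ l (φ x)) (T.β (G.P x (G.cov l φ x)))
      = inner ℝ (T.γ l (G.cov l φ x)) (T.β (G.P x (φ x))) := by
    intro x
    rw [T.β_P, ← neg_eq_iff_eq_neg.mpr (G.skew_P x _ _), ← T.γ_P, T.γ_β, neg_neg]
  simp only [h2] at h1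
  have i1 : Integrable fun x => inner ℝ (T.γ l (φ x)) (T.β (G.dP l x (φ x))) :=
    (hφ.map _).integrable_inner_left
      (T.β.contDiff.comp ((G.smooth_dP l).clm_apply hφ.1)).continuous
  have i2 : Integrable fun x => inner ℝ (T.γ l (G.cov l φ x)) (T.β (G.P x (φ x))) :=
    ((hφ.cov l).map _).integrable_inner_left (T.β.contDiff.comp hPφ).continuous
  rw [integral_add i1 i2] at h1
  linarith

/-- The Weitzenböck formula. -/
theorem weitzenbock (hφ : Test φ) :
    ∫ x, ‖T.cl φ x‖ ^ 2 = (∫ x, (∑ i, ‖G.cov i φ x‖ ^ 2 + ‖G.P x (φ x)‖ ^ 2))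
      - (1 + T.s) * ∑ l, ∫ x, inner ℝ (T.γ l (φ x)) (T.β (G.dP l x (φ x))) := by
  have i1 : Integrable fun x => ∑ i, ‖G.cov i φ x‖ ^ 2 + ‖G.P x (φ x)‖ ^ 2 :=
    (integrable_finsetSum _ fun i _ => (hφ.cov i).integrable_norm_sq).add
      (hφ.clm G.smooth_P).integrable_norm_sq
  have i2 : ∀ l : Fin 3, Integrable fun x => 2 *
      inner ℝ (T.γ (l + 1) (G.cov (l + 1) φ x)) (T.γ (l + 2) (G.cov (l + 2) φ x)) := fun l =>
    (((hφ.cov _).map _).integrable_inner_left ((hφ.cov _).map _).continuous).const_mul _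
  have i3 : ∀ l : Fin 3, Integrable fun x => 2 *
      inner ℝ (T.γ l (G.cov l φ x)) (T.β (G.P x (φ x))) := fun l =>
    (((hφ.cov _).map _).integrable_inner_left ((hφ.clm G.smooth_P).map _).continuous).const_mul _
  simp only [cl, T.norm_sq_expand]
  rw [integral_add (by exact i1.add (integrable_finsetSum _ fun l _ => i2 l))
    (integrable_finsetSum _ fun l _ => i3 l),
    integral_add i1 (integrable_finsetSum _ fun l _ => i2 l),
    integral_finsetSum _ fun l _ => i2 l, integral_finsetSum _ fun l _ => i3 l]
  -- The two families of cross terms contribute `-s` and `-1` times the same integrals.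
  simp only [integral_const_mul, T.integral_cross_γ hφ, T.integral_cross_β hφ,
    Finset.sum_neg_distrib, ← Finset.mul_sum]
  ring

end DiracCoeff

/-- The density of the squared `𝓗₁`-norm. -/
noncomputable def GaugeData.dens1 (G : GaugeData F) (φ : E3 → F) (x : E3) : ℝ :=
  ∑ i, ‖G.cov i φ x‖ ^ 2 + (rho x)⁻¹ ^ 2 * ‖φ x‖ ^ 2 + ‖G.P x (φ x)‖ ^ 2

/-- The squared `𝓗₁`-norm of a test function. -/
noncomputable def GaugeData.N1 (G : GaugeData F) (φ : E3 → F) : ℝ := ∫ x, G.dens1 φ x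

/-- The squared `L²`-norm on a ball. -/
noncomputable def locN (R : ℝ) (φ : E3 → F) : ℝ :=
  ∫ x, (Metric.ball (0 : E3) R).indicator (fun x => ‖φ x‖ ^ 2) x

theorem Test.integrable_loc (h : Test φ) (R : ℝ) :
    Integrable ((Metric.ball (0 : E3) R).indicator (fun x => ‖φ x‖ ^ 2)) :=
  h.integrable_norm_sq.indicator Metric.isOpen_ball.measurableSet

theorem Test.integrable_dens1 (h : Test φ) : Integrable (G.dens1 φ) :=
  ((integrable_finsetSum _ fun i _ => (h.cov i).integrable_norm_sq).add
    (h.integrable_mul_norm_sq (continuous_rho_inv.pow 2))).add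
      (h.clm G.smooth_P).integrable_norm_sq

theorem indicator_norm_sq_nonneg (R : ℝ) (φ : E3 → F) (x : E3) :
    0 ≤ (Metric.ball (0 : E3) R).indicator (fun x => ‖φ x‖ ^ 2) x :=
  Set.indicator_nonneg (fun _ _ => by positivity) x

theorem locN_nonneg (R : ℝ) (φ : E3 → F) : 0 ≤ locN R φ :=
  integral_nonneg fun x => indicator_norm_sq_nonneg R φ x

theorem locN_mono (h : Test φ) {R R' : ℝ} (hR : R ≤ R') : locN R φ ≤ locN R' φ :=
  integral_mono (h.integrable_loc R) (h.integrable_loc R') fun x =>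
    Set.indicator_le_indicator_of_subset (Metric.ball_subset_ball hR) (fun _ => by positivity) x

theorem dens1_nonneg (φ : E3 → F) (x : E3) : 0 ≤ G.dens1 φ x := by
  have := rho_pos x
  unfold GaugeData.dens1
  positivity

theorem N1_nonneg (φ : E3 → F) : 0 ≤ G.N1 φ := integral_nonneg fun x => dens1_nonneg φ x

/-- Either `x` lies in a large ball, or `ρ⁻¹` is small. -/
theorem rho_inv_le_or {δ : ℝ} (hδ : 0 < δ) (x : E3) :
    x ∈ Metric.ball (0 : E3) δ⁻¹ ∨ (rho x)⁻¹ ≤ δ := by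
  rcases lt_or_ge ‖x‖ δ⁻¹ with h | h
  · left; simpa using h
  · right
    rw [inv_le_comm₀ (rho_pos x) hδ]
    exact h.trans (norm_le_rho x)

theorem rho_inv_pos (x : E3) : 0 < (rho x)⁻¹ := inv_pos.mpr (rho_pos x)

theorem rho_inv_le_one (x : E3) : (rho x)⁻¹ ≤ 1 := inv_le_one_of_one_le₀ (one_le_rho x)

theorem le_indicator {R : ℝ} {x : E3} (hx : x ∈ Metric.ball (0 : E3) R) {C : ℝ} (φ : E3 → F) :
    C * ‖φ x‖ ^ 2 = C * (Metric.ball (0 : E3) R).indicator (fun x => ‖φ x‖ ^ 2) x := by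
  rw [Set.indicator_of_mem hx]

/-- Where `ρ⁻¹ ≤ δ`, the bound `dP_le` has one factor `ρ⁻¹` to spare, which becomes the small
constant. On the ball of radius `δ⁻¹` a crude bound by `|φ|²` suffices. -/
theorem curvature_term_le {δ : ℝ} (hδ : 0 < δ) (l : Fin 3) (φ : E3 → F) (x : E3) :
    ‖φ x‖ * ‖G.dP l x (φ x)‖ ≤ 2 * G.K * δ * ((rho x)⁻¹ ^ 2 * ‖φ x‖ ^ 2 + ‖G.P x (φ x)‖ ^ 2)
      + G.K * (G.K + 1) * (Metric.ball (0 : E3) δ⁻¹).indicator (fun x => ‖φ x‖ ^ 2) x := by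
  have h := G.dP_le l x (φ x)
  have hK := G.K_pos
  have hr := rho_inv_pos x
  have hr1 := rho_inv_le_one x
  have hP := G.norm_P x (φ x)
  have hP0 := norm_nonneg (G.P x (φ x))
  have h0 := norm_nonneg (φ x)
  set r := (rho x)⁻¹
  set p := ‖G.P x (φ x)‖
  set n := ‖φ x‖ with hn
  have h1 : n * ‖G.dP l x (φ x)‖ ≤ n * (G.K * (r ^ 2 * p + r ^ 3 * n)) := by gcongr
  rcases rho_inv_le_or hδ x with hx | hx
  · rw [← le_indicator hx, ← hn]
    have h2 : 0 ≤ 2 * G.K * δ * (r ^ 2 * n ^ 2 + p ^ 2) := by positivity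
    have h3 : r ^ 2 * p + r ^ 3 * n ≤ 1 * (G.K * n) + 1 * n := by
      gcongr
      · exact pow_le_one₀ hr.le hr1
      · exact pow_le_one₀ hr.le hr1
    have h4 : n * (G.K * (r ^ 2 * p + r ^ 3 * n)) ≤ n * (G.K * (1 * (G.K * n) + 1 * n)) := by gcongr
    nlinarith
  · have h2 := indicator_norm_sq_nonneg δ⁻¹ φ x
    have h3 : r ^ 2 * p + r ^ 3 * n ≤ δ * (r * p + r ^ 2 * n) := by
      have a1 : r ^ 2 * p ≤ δ * r * p := by rw [sq]; gcongr
      have a2 : r ^ 3 * n ≤ δ * r ^ 2 * n := by rw [pow_succ' r 2]; gcongr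
      linarith
    have h4 : n * (G.K * (r ^ 2 * p + r ^ 3 * n)) ≤ n * (G.K * (δ * (r * p + r ^ 2 * n))) := by
      gcongr
    have h5 : r * n * p ≤ r ^ 2 * n ^ 2 + p ^ 2 := by nlinarith [sq_nonneg (r * n - p), sq_nonneg (r * n), sq_nonneg p]
    have h6 : n * (r * p + r ^ 2 * n) ≤ 2 * (r ^ 2 * n ^ 2 + p ^ 2) := by nlinarith [sq_nonneg p]
    have h7 : n * (G.K * (δ * (r * p + r ^ 2 * n))) ≤ G.K * δ * (2 * (r ^ 2 * n ^ 2 + p ^ 2)) := by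
      calc n * (G.K * (δ * (r * p + r ^ 2 * n))) = G.K * δ * (n * (r * p + r ^ 2 * n)) := by ring
        _ ≤ _ := by gcongr
    have h8 : 0 ≤ G.K * (G.K + 1) := by positivity
    have h9 := mul_nonneg h8 h2
    linarith

namespace DiracCoeff

variable (T : DiracCoeff G)

/-- Hardy's inequality pays for the weighted term: `5 = 1 + 4`. -/
theorem N1_le (hφ : Test φ) :
    G.N1 φ ≤ 5 * ∫ x, (∑ i, ‖G.cov i φ x‖ ^ 2 + ‖G.P x (φ x)‖ ^ 2) := by
  have i1 : Integrable fun x => ∑ i, ‖G.cov i φ x‖ ^ 2 :=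
    integrable_finsetSum _ fun i _ => (hφ.cov i).integrable_norm_sq
  have i2 : Integrable fun x => (rho x)⁻¹ ^ 2 * ‖φ x‖ ^ 2 :=
    hφ.integrable_mul_norm_sq (continuous_rho_inv.pow 2)
  have i3 : Integrable fun x => ‖G.P x (φ x)‖ ^ 2 := (hφ.clm G.smooth_P).integrable_norm_sq
  have h := hardy G hφ
  have h3 : 0 ≤ ∫ x, ‖G.P x (φ x)‖ ^ 2 := integral_nonneg fun x => by positivity
  unfold GaugeData.N1 GaugeData.dens1
  rw [integral_add (by exact i1.add i2) i3, integral_add i1 i2, integral_add i1 i3]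
  linarith

theorem N1_le_of_s (hs : T.s = -1) (hφ : Test φ) : G.N1 φ ≤ 5 * ∫ x, ‖T.cl φ x‖ ^ 2 := by
  rw [T.weitzenbock hφ, hs]
  simpa using N1_le hφ

/-- In the Weitzenböck formula the curvature term is split by `curvature_term_le`; its small part is
absorbed into `N1`. -/
theorem coercive : ∃ R, 0 < R ∧ ∃ C, 0 < C ∧ ∀ φ : E3 → F, Test φ →
    G.N1 φ ≤ C * ((∫ x, ‖T.cl φ x‖ ^ 2) + locN R φ) := by
  have hK := G.K_pos
  set S := |1 + T.s| with hS
  have hS0 : 0 ≤ S := abs_nonneg _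
  -- The three curvature integrals cost `6 K S δ N1`, at most `N1 / 10` for this `δ`. After
  -- multiplication by the `5` of `N1_le`, half of `N1` is absorbed.
  set δ := (60 * G.K * S + 1)⁻¹ with hδdef
  have hδ : 0 < δ := by positivity
  have hδ1 : δ ≤ 1 := inv_le_one_of_one_le₀ (by nlinarith [mul_nonneg hK.le hS0])
  have hδS : 60 * G.K * S * δ ≤ 1 := by
    have : (60 * G.K * S + 1) * δ = 1 := mul_inv_cancel₀ (by positivity)
    linarith
  refine ⟨δ⁻¹, inv_pos.mpr hδ, 10 + 30 * S * (G.K * (G.K + 1)), by positivity, fun φ hφ => ?_⟩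
  have hN := N1_le (G := G) hφ
  have hw := T.weitzenbock hφ
  set Q := ∫ x, (∑ i, ‖G.cov i φ x‖ ^ 2 + ‖G.P x (φ x)‖ ^ 2)
  have i0 : Integrable fun x => (rho x)⁻¹ ^ 2 * ‖φ x‖ ^ 2 + ‖G.P x (φ x)‖ ^ 2 :=
    (hφ.integrable_mul_norm_sq (continuous_rho_inv.pow 2)).add
      (hφ.clm G.smooth_P).integrable_norm_sq
  have hl : ∀ l, |∫ x, inner ℝ (T.γ l (φ x)) (T.β (G.dP l x (φ x)))|
      ≤ 2 * G.K * δ * G.N1 φ + G.K * (G.K + 1) * locN δ⁻¹ φ := by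
    intro l
    have i1 : Integrable fun x => inner ℝ (T.γ l (φ x)) (T.β (G.dP l x (φ x))) :=
      (hφ.map _).integrable_inner_left
        (T.β.contDiff.comp ((G.smooth_dP l).clm_apply hφ.1)).continuous
    have h1 : ∀ x, ‖inner ℝ (T.γ l (φ x)) (T.β (G.dP l x (φ x)))‖
        ≤ 2 * G.K * δ * G.dens1 φ x + G.K * (G.K + 1) *
          (Metric.ball (0 : E3) δ⁻¹).indicator (fun x => ‖φ x‖ ^ 2) x := by
      intro x
      have h2 := norm_inner_le_norm (𝕜 := ℝ) (T.γ l (φ x)) (T.β (G.dP l x (φ x)))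
      rw [T.norm_γ, T.norm_β] at h2
      refine (h2.trans (curvature_term_le hδ l φ x)).trans ?_
      have h3 : (rho x)⁻¹ ^ 2 * ‖φ x‖ ^ 2 + ‖G.P x (φ x)‖ ^ 2 ≤ G.dens1 φ x := by
        unfold GaugeData.dens1
        have : 0 ≤ ∑ i, ‖G.cov i φ x‖ ^ 2 := by positivity
        linarith
      gcongr
    have h2 := (norm_integral_le_integral_norm _).trans
      (integral_mono i1.norm ((hφ.integrable_dens1.const_mul _).add
        ((hφ.integrable_loc δ⁻¹).const_mul _)) h1)
    rwa [integral_add' (hφ.integrable_dens1.const_mul _)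
        ((hφ.integrable_loc δ⁻¹).const_mul _), integral_const_mul, integral_const_mul] at h2
  have hsum : |∑ l, ∫ x, inner ℝ (T.γ l (φ x)) (T.β (G.dP l x (φ x)))|
      ≤ 3 * (2 * G.K * δ * G.N1 φ + G.K * (G.K + 1) * locN δ⁻¹ φ) := by
    refine (Finset.abs_sum_le_sum_abs _ _).trans ?_
    refine (Finset.sum_le_sum fun l _ => hl l).trans (le_of_eq ?_)
    rw [Finset.sum_const, Finset.card_univ, Fintype.card_fin, nsmul_eq_mul]
    norm_num
  have hprod : (1 + T.s) * ∑ l, ∫ x, inner ℝ (T.γ l (φ x)) (T.β (G.dP l x (φ x)))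
      ≤ S * (3 * (2 * G.K * δ * G.N1 φ + G.K * (G.K + 1) * locN δ⁻¹ φ)) := by
    refine (le_abs_self _).trans ?_
    rw [abs_mul]
    gcongr
  have hN0 := N1_nonneg (G := G) φ
  have hsmall : S * (3 * (2 * G.K * δ * G.N1 φ)) ≤ 1 / 10 * G.N1 φ := by
    have : S * (3 * (2 * G.K * δ * G.N1 φ)) = (60 * G.K * S * δ) * (1 / 10 * G.N1 φ) := by ring
    rw [this]
    exact mul_le_of_le_one_left (by positivity) hδS
  have hL := locN_nonneg δ⁻¹ φ
  have hD : 0 ≤ ∫ x, ‖T.cl φ x‖ ^ 2 := integral_nonneg fun x => by positivity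
  have hQ : Q ≤ (∫ x, ‖T.cl φ x‖ ^ 2) + 1 / 10 * G.N1 φ + S * (3 * (G.K * (G.K + 1) * locN δ⁻¹ φ)) := by
    linarith
  have hk : 0 ≤ S * (G.K * (G.K + 1)) := by positivity
  have h8 := mul_nonneg hk hD
  linarith

end DiracCoeff

end Generic

/-! ### The `𝓗₂` estimate for test functions: commutators and zeroth order terms -/

section Generic

variable {F : Type*} [NormedAddCommGroup F] [InnerProductSpace ℝ F] {G : GaugeData F}
  {φ ψ : E3 → F}

/-- The density of the zeroth order part of the squared `𝓗₂`-norm. -/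
noncomputable def GaugeData.dens0 (G : GaugeData F) (φ : E3 → F) (x : E3) : ℝ :=
  ‖G.P x (G.P x (φ x))‖ ^ 2 + (rho x)⁻¹ ^ 2 * ‖G.P x (φ x)‖ ^ 2 + (rho x)⁻¹ ^ 4 * ‖φ x‖ ^ 2

/-- The squared `𝓗₂`-norm of a test function. -/
noncomputable def GaugeData.N2 (G : GaugeData F) (φ : E3 → F) : ℝ :=
  ∑ i, G.N1 (G.cov i φ) + ∫ x, G.dens0 φ x

theorem Test.integrable_dens0 (h : Test φ) : Integrable (G.dens0 φ) :=
  (((h.clm G.smooth_P).clm G.smooth_P).integrable_norm_sq.add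
    ((h.clm G.smooth_P).integrable_mul_norm_sq (continuous_rho_inv.pow 2))).add
      (h.integrable_mul_norm_sq (continuous_rho_inv.pow 4))

theorem norm_cov_comm_le (h : ContDiff ℝ ∞ φ) (i j : Fin 3) (x : E3) :
    ‖G.cov j (G.cov i φ) x - G.cov i (G.cov j φ) x‖ ≤ ∑ l, ‖G.dP l x (φ x)‖ := by
  have hcases : ∀ i j : Fin 3, i = j ∨ (∃ l, j = l + 1 ∧ i = l + 2) ∨
      (∃ l, i = l + 1 ∧ j = l + 2) := by decide
  have hsingle : ∀ l, ‖G.dP l x (φ x)‖ ≤ ∑ l, ‖G.dP l x (φ x)‖ := fun l =>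
    Finset.single_le_sum (f := fun l => ‖G.dP l x (φ x)‖) (fun _ _ => norm_nonneg _)
      (Finset.mem_univ l)
  rcases hcases i j with rfl | ⟨l, rfl, rfl⟩ | ⟨l, rfl, rfl⟩
  · rw [sub_self, norm_zero]; positivity
  · rw [cov_comm h]; exact hsingle l
  · rw [norm_sub_rev, cov_comm h]; exact hsingle l

theorem sum_norm_dP_sq_le (G : GaugeData F) (x : E3) (v : F) :
    (∑ l, ‖G.dP l x v‖) ^ 2
      ≤ 18 * G.K ^ 2 * ((rho x)⁻¹ ^ 4 * ‖G.P x v‖ ^ 2 + (rho x)⁻¹ ^ 6 * ‖v‖ ^ 2) := by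
  have hK := G.K_pos
  have hr := rho_inv_pos x
  have h1 : ∑ l, ‖G.dP l x v‖ ≤ 3 * (G.K * ((rho x)⁻¹ ^ 2 * ‖G.P x v‖ + (rho x)⁻¹ ^ 3 * ‖v‖)) := by
    refine (Finset.sum_le_sum fun l _ => G.dP_le l x v).trans (le_of_eq ?_)
    rw [Finset.sum_const, Finset.card_univ, Fintype.card_fin, nsmul_eq_mul]
    norm_num
  have h0 : 0 ≤ ∑ l, ‖G.dP l x v‖ := by positivity
  calc (∑ l, ‖G.dP l x v‖) ^ 2
      ≤ (3 * (G.K * ((rho x)⁻¹ ^ 2 * ‖G.P x v‖ + (rho x)⁻¹ ^ 3 * ‖v‖))) ^ 2 := by gcongr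
    _ = 9 * G.K ^ 2 * ((rho x)⁻¹ ^ 2 * ‖G.P x v‖ + (rho x)⁻¹ ^ 3 * ‖v‖) ^ 2 := by ring
    _ ≤ 9 * G.K ^ 2 * (2 * (((rho x)⁻¹ ^ 2 * ‖G.P x v‖) ^ 2 + ((rho x)⁻¹ ^ 3 * ‖v‖) ^ 2)) := by
        gcongr; exact add_sq_le
    _ = _ := by ring

/-- The weights on the left are those of the last two terms of `dens0` times `ρ⁻²`, hence small far
out; on the ball `P` and the weights are bounded. -/
theorem absorb_le {δ : ℝ} (hδ : 0 < δ) (φ : E3 → F) (x : E3) :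
    (rho x)⁻¹ ^ 4 * ‖G.P x (φ x)‖ ^ 2 + (rho x)⁻¹ ^ 6 * ‖φ x‖ ^ 2
      ≤ δ * G.dens0 φ x
        + (G.K ^ 2 + 1) * (Metric.ball (0 : E3) δ⁻¹).indicator (fun x => ‖φ x‖ ^ 2) x := by
  have hK := G.K_pos
  have hr := rho_inv_pos x
  have hr1 := rho_inv_le_one x
  have hP := G.norm_P x (φ x)
  unfold GaugeData.dens0
  set r := (rho x)⁻¹
  set p := ‖G.P x (φ x)‖ with hp
  have hp0 : 0 ≤ p := norm_nonneg _
  rcases rho_inv_le_or hδ x with hx | hx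
  · rw [← le_indicator hx]
    have h1 : r ^ 4 * p ^ 2 ≤ 1 * (G.K * ‖φ x‖) ^ 2 := by
      gcongr; exact pow_le_one₀ hr.le hr1
    have h2 : r ^ 6 * ‖φ x‖ ^ 2 ≤ 1 * ‖φ x‖ ^ 2 := by
      gcongr; exact pow_le_one₀ hr.le hr1
    have h3 : 0 ≤ δ * (‖G.P x (G.P x (φ x))‖ ^ 2 + r ^ 2 * p ^ 2 + r ^ 4 * ‖φ x‖ ^ 2) := by
      positivity
    linarith
  · have h0 := mul_nonneg (by positivity : 0 ≤ G.K ^ 2 + 1) (indicator_norm_sq_nonneg δ⁻¹ φ x)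
    have hr2 : r ^ 2 ≤ δ := by
      calc r ^ 2 = r * r := sq r
        _ ≤ 1 * δ := by gcongr
        _ = δ := one_mul δ
    have h1 : r ^ 4 * p ^ 2 ≤ δ * (r ^ 2 * p ^ 2) := by
      calc r ^ 4 * p ^ 2 = r ^ 2 * (r ^ 2 * p ^ 2) := by ring
        _ ≤ _ := by gcongr
    have h2 : r ^ 6 * ‖φ x‖ ^ 2 ≤ δ * (r ^ 4 * ‖φ x‖ ^ 2) := by
      calc r ^ 6 * ‖φ x‖ ^ 2 = r ^ 2 * (r ^ 4 * ‖φ x‖ ^ 2) := by ring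
        _ ≤ _ := by gcongr
    have h3 : 0 ≤ δ * ‖G.P x (G.P x (φ x))‖ ^ 2 := by positivity
    linarith

theorem exists_cutoff (R : ℝ) (hR : 0 < R) : ∃ (χ : E3 → ℝ) (R' M : ℝ), ContDiff ℝ ∞ χ ∧ R ≤ R' ∧
    0 ≤ M ∧ (∀ x, |χ x| ≤ 1) ∧ (∀ x, ‖x‖ ≤ R → χ x = 1) ∧ (∀ x, R' ≤ ‖x‖ → χ x = 0) ∧
    (∀ v x, |fderiv ℝ χ x v| ≤ M * ‖v‖) ∧ (∀ x, R' ≤ ‖x‖ → fderiv ℝ χ x = 0) ∧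
    (∀ x, ‖x‖ < R → fderiv ℝ χ x = 0) := by
  let b : ContDiffBump (0 : E3) := ⟨R, R + 1, hR, by linarith⟩
  have hb : ContDiff ℝ ∞ b := b.contDiff
  obtain ⟨M, hM⟩ := (b.hasCompactSupport.fderiv (𝕜 := ℝ)).exists_bound_of_continuous
    (hb.continuous_fderiv (by simp))
  have hM0 : 0 ≤ M := (norm_nonneg _).trans (hM 0)
  refine ⟨b, R + 2, M, hb, by linarith, hM0, fun x => ?_, fun x hx => ?_, fun x hx => ?_,
    fun v x => ?_, fun x hx => ?_, fun x hx => ?_⟩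
  · rw [abs_of_nonneg b.nonneg]; exact b.le_one
  · exact b.one_of_mem_closedBall (by simpa [b] using hx)
  · exact b.zero_of_le_dist (by simp only [b, dist_zero_right]; linarith)
  · exact (ContinuousLinearMap.le_opNorm _ v).trans
      (mul_le_mul_of_nonneg_right (hM x) (norm_nonneg v))
  · have h1 : x ∉ tsupport b := by
      rw [b.tsupport_eq]
      simp only [b, Metric.mem_closedBall, dist_zero_right]
      linarith
    have h2 := tsupport_fderiv_subset (𝕜 := ℝ) (f := b)
    exact image_eq_zero_of_notMem_tsupport fun h => h1 (h2 h)
  · have h1 : b =ᶠ[𝓝 x] fun _ => (1 : ℝ) := by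
      have : Metric.ball (0 : E3) R ∈ 𝓝 x := Metric.isOpen_ball.mem_nhds (by simpa using hx)
      filter_upwards [this] with y hy
      exact b.one_of_mem_closedBall (Metric.ball_subset_closedBall hy)
    rw [h1.fderiv_eq]
    simp

namespace DiracCoeff

variable (T : DiracCoeff G)

theorem cov_cl (h : ContDiff ℝ ∞ φ) (i : Fin 3) (x : E3) :
    G.cov i (T.cl φ) x = ∑ j, T.γ j (G.cov i (G.cov j φ) x)
      + T.β (G.dP i x (φ x) + G.P x (G.cov i φ x)) := by
  have hc := fun j => contDiff_cov (G := G) h j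
  have hγ : ∀ j, ContDiff ℝ ∞ fun x => T.γ j (G.cov j φ x) := fun j =>
    (T.γ j).contDiff.comp (hc j)
  have hPφ : ContDiff ℝ ∞ fun x => G.P x (φ x) := G.smooth_P.clm_apply h
  have hβ : ContDiff ℝ ∞ fun x => T.β (G.P x (φ x)) := T.β.contDiff.comp hPφ
  have h1 : T.cl φ = fun x => T.γ 0 (G.cov 0 φ x) + (T.γ 1 (G.cov 1 φ x) +
      (T.γ 2 (G.cov 2 φ x) + T.β (G.P x (φ x)))) := by
    funext x
    simp only [cl, Fin.sum_univ_three]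
    abel
  rw [h1, cov_add (hγ 0) ((hγ 1).add ((hγ 2).add hβ)), cov_add (hγ 1) ((hγ 2).add hβ),
    cov_add (hγ 2) hβ, cov_map (T.γ_a 0) (hc 0), cov_map (T.γ_a 1) (hc 1),
    cov_map (T.γ_a 2) (hc 2), cov_map T.β_a hPφ, cov_P h, Fin.sum_univ_three]
  abel

theorem cl_sub (h : ContDiff ℝ ∞ φ) (h' : ContDiff ℝ ∞ ψ) (x : E3) :
    T.cl (fun y => φ y - ψ y) x = T.cl φ x - T.cl ψ x := by
  simp only [cl, cov_sub h h', map_sub, Finset.sum_sub_distrib]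
  abel

theorem cl_smul {χ : E3 → ℝ} (hχ : ContDiff ℝ ∞ χ) (h : ContDiff ℝ ∞ φ) (x : E3) :
    T.cl (fun y => χ y • φ y) x
      = ∑ j, fderiv ℝ χ x (e j) • T.γ j (φ x) + χ x • T.cl φ x := by
  simp only [cl, cov_smul hχ h, map_add, map_smul, Finset.sum_add_distrib, smul_add,
    Finset.smul_sum]
  abel

/-- The symbols are parallel, so the commutator of `T` with `∇_i` has order zero: three curvature
terms and one `dP_i`, whence the factor `4`. -/
theorem norm_cl_cov_sub_le (h : ContDiff ℝ ∞ φ) (i : Fin 3) (x : E3) :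
    ‖T.cl (G.cov i φ) x - G.cov i (T.cl φ) x‖ ≤ 4 * ∑ l, ‖G.dP l x (φ x)‖ := by
  have h1 : T.cl (G.cov i φ) x - G.cov i (T.cl φ) x
      = ∑ j, T.γ j (G.cov j (G.cov i φ) x - G.cov i (G.cov j φ) x) - T.β (G.dP i x (φ x)) := by
    rw [T.cov_cl h, cl]
    simp only [map_sub, map_add, Finset.sum_sub_distrib]
    abel
  rw [h1]
  refine (norm_sub_le _ _).trans ?_
  have h2 : ‖∑ j, T.γ j (G.cov j (G.cov i φ) x - G.cov i (G.cov j φ) x)‖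
      ≤ 3 * ∑ l, ‖G.dP l x (φ x)‖ := by
    refine (norm_sum_le _ _).trans ?_
    refine (Finset.sum_le_sum fun j _ => (T.norm_γ j _).le.trans (norm_cov_comm_le h i j x)).trans
      (le_of_eq ?_)
    rw [Finset.sum_const, Finset.card_univ, Fintype.card_fin, nsmul_eq_mul]
    norm_num
  have h3 : ‖T.β (G.dP i x (φ x))‖ ≤ ∑ l, ‖G.dP l x (φ x)‖ := by
    rw [T.norm_β]
    exact Finset.single_le_sum (f := fun l => ‖G.dP l x (φ x)‖) (fun _ _ => norm_nonneg _)
      (Finset.mem_univ i)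
  linarith

/-- The zeroth order part of the `𝓗₂`-norm is controlled by `∇φ` and `𝒟φ`. -/
theorem integral_dens0_le (hφ : Test φ) :
    ∫ x, G.dens0 φ x ≤ 32 * locN 4 φ + 24 * ∑ i, G.N1 (G.cov i φ) + 8 * G.N1 (T.cl φ) := by
  have hw := hardy_weighted G hφ
  have i1 : Integrable fun x => (rho x)⁻¹ ^ 4 * ‖φ x‖ ^ 2 :=
    hφ.integrable_mul_norm_sq (continuous_rho_inv.pow 4)
  have i2 : ∀ i, Integrable fun x => (rho x)⁻¹ ^ 2 * ‖G.cov i φ x‖ ^ 2 := fun i =>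
    (hφ.cov i).integrable_mul_norm_sq (continuous_rho_inv.pow 2)
  have i3 : Integrable fun x => (rho x)⁻¹ ^ 6 * ‖φ x‖ ^ 2 :=
    hφ.integrable_mul_norm_sq (continuous_rho_inv.pow 6)
  have i4 : Integrable fun x => ‖G.P x (G.P x (φ x))‖ ^ 2 :=
    ((hφ.clm G.smooth_P).clm G.smooth_P).integrable_norm_sq
  have i5 : ∀ i, Integrable fun x => ‖G.P x (G.cov i φ x)‖ ^ 2 := fun i =>
    ((hφ.cov i).clm G.smooth_P).integrable_norm_sq
  have i6 : Integrable fun x => ‖G.P x (T.cl φ x)‖ ^ 2 :=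
    ((hφ.cl T).clm G.smooth_P).integrable_norm_sq
  -- Outside radius `4` one has `ρ⁻⁶ ≤ ρ⁻⁴ / 16`; against the factor `8` in `hardy_weighted` this is
  -- one half and is absorbed.
  have h6 : ∫ x, (rho x)⁻¹ ^ 6 * ‖φ x‖ ^ 2
      ≤ 1 / 16 * (∫ x, (rho x)⁻¹ ^ 4 * ‖φ x‖ ^ 2) + locN 4 φ := by
    rw [← integral_const_mul, locN, ← integral_add (i1.const_mul _) (hφ.integrable_loc 4)]
    refine integral_mono i3 ((i1.const_mul _).add (hφ.integrable_loc 4)) fun x => ?_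
    have hr := rho_inv_pos x
    simp only
    rcases rho_inv_le_or (δ := 1 / 4) (by norm_num) x with hx | hx
    · rw [show ((1 : ℝ) / 4)⁻¹ = 4 by norm_num] at hx
      rw [Set.indicator_of_mem hx]
      have h1 : (rho x)⁻¹ ^ 6 * ‖φ x‖ ^ 2 ≤ 1 * ‖φ x‖ ^ 2 := by
        gcongr; exact pow_le_one₀ hr.le (rho_inv_le_one x)
      have h2 : 0 ≤ (rho x)⁻¹ ^ 4 * ‖φ x‖ ^ 2 := by positivity
      linarith
    · have h0 := indicator_norm_sq_nonneg 4 φ x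
      have h1 : (rho x)⁻¹ ^ 2 ≤ (1 / 4) ^ 2 := by gcongr
      have h2 : (rho x)⁻¹ ^ 6 * ‖φ x‖ ^ 2 ≤ (1 / 4) ^ 2 * ((rho x)⁻¹ ^ 4 * ‖φ x‖ ^ 2) := by
        calc (rho x)⁻¹ ^ 6 * ‖φ x‖ ^ 2 = (rho x)⁻¹ ^ 2 * ((rho x)⁻¹ ^ 4 * ‖φ x‖ ^ 2) := by ring
          _ ≤ _ := by gcongr
      linarith
  have hX1 : ∫ x, (rho x)⁻¹ ^ 2 * ∑ i, ‖G.cov i φ x‖ ^ 2 ≤ ∑ i, G.N1 (G.cov i φ) := by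
    simp only [Finset.mul_sum]
    rw [integral_finsetSum _ fun i _ => i2 i]
    refine Finset.sum_le_sum fun i _ => integral_mono (i2 i) (hφ.cov i).integrable_dens1 fun x => ?_
    have h1 : 0 ≤ ∑ j, ‖G.cov j (G.cov i φ) x‖ ^ 2 + ‖G.P x (G.cov i φ x)‖ ^ 2 := by positivity
    simp only [GaugeData.dens1]
    linarith
  have hX2 : ∫ x, ∑ i, ‖G.P x (G.cov i φ x)‖ ^ 2 ≤ ∑ i, G.N1 (G.cov i φ) := by
    rw [integral_finsetSum _ fun i _ => i5 i]
    refine Finset.sum_le_sum fun i _ => integral_mono (i5 i) (hφ.cov i).integrable_dens1 fun x => ?_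
    have hr := rho_inv_pos x
    have h1 : 0 ≤ ∑ j, ‖G.cov j (G.cov i φ) x‖ ^ 2 + (rho x)⁻¹ ^ 2 * ‖G.cov i φ x‖ ^ 2 := by
      positivity
    simp only [GaugeData.dens1]
    linarith
  have hcl : ∫ x, ‖G.P x (T.cl φ x)‖ ^ 2 ≤ G.N1 (T.cl φ) := by
    refine integral_mono i6 (hφ.cl T).integrable_dens1 fun x => ?_
    have hr := rho_inv_pos x
    have h1 : 0 ≤ ∑ j, ‖G.cov j (T.cl φ) x‖ ^ 2 + (rho x)⁻¹ ^ 2 * ‖T.cl φ x‖ ^ 2 := by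
      positivity
    simp only [GaugeData.dens1]
    linarith
  have hPP : ∫ x, ‖G.P x (G.P x (φ x))‖ ^ 2
      ≤ 4 * (G.N1 (T.cl φ) + ∑ i, G.N1 (G.cov i φ)) := by
    have h1 : ∫ x, ‖G.P x (G.P x (φ x))‖ ^ 2 ≤ ∫ x, (4 * (‖G.P x (T.cl φ x)‖ ^ 2
        + ∑ i, ‖G.P x (G.cov i φ x)‖ ^ 2)) := by
      refine integral_mono i4 ((i6.add (integrable_finsetSum _ fun i _ => i5 i)).const_mul _)
        fun x => ?_
      -- `P` commutes with the symbols, so `P P φ` can be solved for from `P T φ` and the `P ∇_j φ`.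
      have h2 : T.β (G.P x (G.P x (φ x))) = G.P x (T.cl φ x) - T.γ 0 (G.P x (G.cov 0 φ x))
          - T.γ 1 (G.P x (G.cov 1 φ x)) - T.γ 2 (G.P x (G.cov 2 φ x)) := by
        simp only [cl, Fin.sum_univ_three, map_add, T.γ_P, T.β_P]
        abel
      have h3 : ‖G.P x (G.P x (φ x))‖ ≤ ‖G.P x (T.cl φ x)‖ + ‖G.P x (G.cov 0 φ x)‖
          + ‖G.P x (G.cov 1 φ x)‖ + ‖G.P x (G.cov 2 φ x)‖ := by
        rw [← T.norm_β, h2, ← T.norm_γ 0 (G.P x (G.cov 0 φ x)),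
          ← T.norm_γ 1 (G.P x (G.cov 1 φ x)), ← T.norm_γ 2 (G.P x (G.cov 2 φ x))]
        refine (norm_sub_le _ _).trans (add_le_add_left ?_ _)
        refine (norm_sub_le _ _).trans (add_le_add_left ?_ _)
        exact norm_sub_le _ _
      have h4 : ∀ n a b c d : ℝ, 0 ≤ n → n ≤ a + b + c + d →
          n ^ 2 ≤ 4 * (a ^ 2 + (b ^ 2 + c ^ 2 + d ^ 2)) := by
        intro n a b c d hn h
        have : n ^ 2 ≤ (a + b + c + d) ^ 2 := by gcongr
        nlinarith [sq_nonneg (a - b), sq_nonneg (a - c), sq_nonneg (a - d), sq_nonneg (b - c),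
          sq_nonneg (b - d), sq_nonneg (c - d)]
      simp only [Fin.sum_univ_three]
      exact h4 _ _ _ _ _ (norm_nonneg _) h3
    rw [integral_const_mul, integral_add i6 (integrable_finsetSum _ fun i _ => i5 i)] at h1
    linarith
  have hmid : ∫ x, G.dens0 φ x
      ≤ ∫ x, 3 / 2 * (‖G.P x (G.P x (φ x))‖ ^ 2 + (rho x)⁻¹ ^ 4 * ‖φ x‖ ^ 2) := by
    refine integral_mono hφ.integrable_dens0 ((i4.add i1).const_mul _) fun x => ?_
    have hr := rho_inv_pos x
    -- Skewness of `P` interpolates the mixed term between `P P φ` and `ρ⁻² φ`.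
    have h1 : ‖G.P x (φ x)‖ ^ 2 = -inner ℝ (φ x) (G.P x (G.P x (φ x))) := by
      rw [← real_inner_self_eq_norm_sq, G.skew_P]
    have h2 : ‖G.P x (φ x)‖ ^ 2 ≤ ‖φ x‖ * ‖G.P x (G.P x (φ x))‖ := by
      rw [h1]
      exact (neg_le_abs _).trans (abs_real_inner_le_norm _ _)
    have h3 : (rho x)⁻¹ ^ 2 * ‖G.P x (φ x)‖ ^ 2
        ≤ (rho x)⁻¹ ^ 2 * (‖φ x‖ * ‖G.P x (G.P x (φ x))‖) := by gcongr
    simp only [GaugeData.dens0]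
    nlinarith [sq_nonneg ((rho x)⁻¹ ^ 2 * ‖φ x‖ - ‖G.P x (G.P x (φ x))‖)]
  rw [integral_const_mul, integral_add i4 i1] at hmid
  have hX : 0 ≤ ∑ i, G.N1 (G.cov i φ) := Finset.sum_nonneg fun i _ => N1_nonneg _
  have := N1_nonneg (G := G) (T.cl φ)
  have := locN_nonneg 4 φ
  linarith

end DiracCoeff

end Generic

/-! ### The `𝓗₂` estimate for test functions: localization and absorption -/

section Generic

variable {F : Type*} [NormedAddCommGroup F] [InnerProductSpace ℝ F] {G : GaugeData F}
  {φ ψ : E3 → F}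

namespace DiracCoeff

variable (T : DiracCoeff G)

/-- First derivatives on a ball are controlled by `𝒟φ` and by `φ` on a larger ball. -/
theorem locN_cov_le (R : ℝ) (hR : 0 < R) : ∃ R' C, 0 ≤ C ∧ R ≤ R' ∧
    ∀ φ : E3 → F, Test φ → ∀ i, locN R (G.cov i φ) ≤ C * (G.N1 (T.cl φ) + locN R' φ) := by
  obtain ⟨R₁, hR₁, C₁, hC₁, hest⟩ := T.coercive
  obtain ⟨χ, R₂, M, hχ, hRR₂, hM, hχ1, hχR, hχ0, hdχ, hdχ0, -⟩ := exists_cutoff R hR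
  have hR₂ : 0 < R₂ := hR.trans_le hRR₂
  set R' := max R₁ R₂ with hR'
  refine ⟨R', C₁ * (4 * (1 + R₂) ^ 2 + 12 * M ^ 2 + 1), by positivity,
    hRR₂.trans (le_max_right _ _), fun φ hφ i => ?_⟩
  -- The `𝓗₁` estimate is applied to `χ φ`. Its error `∑ (∂_j χ) γ_j φ` contains no derivative of
  -- `φ` and lives on the larger ball.
  have hχφ : Test fun x => χ x • φ x := hφ.smul hχ
  have he : ∀ j, ‖e j‖ = 1 := fun j => by simp [e]
  have h1 : locN R (G.cov i φ) ≤ G.N1 (fun x => χ x • φ x) := by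
    refine integral_mono ((hφ.cov i).integrable_loc R) hχφ.integrable_dens1 fun x => ?_
    by_cases hx : x ∈ Metric.ball (0 : E3) R
    · rw [Set.indicator_of_mem hx]
      have hnear : (fun y => χ y • φ y) =ᶠ[𝓝 x] φ := by
        filter_upwards [Metric.isOpen_ball.mem_nhds hx] with y hy
        rw [hχR y (by simpa using (Metric.mem_ball.mp hy).le), one_smul]
      have h2 : ∀ j, G.cov j (fun y => χ y • φ y) x = G.cov j φ x := fun j => by
        simp only [GaugeData.cov, hnear.fderiv_eq, hnear.eq_of_nhds]
      simp only [GaugeData.dens1, h2]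
      have h3 : ‖G.cov i φ x‖ ^ 2 ≤ ∑ j, ‖G.cov j φ x‖ ^ 2 :=
        Finset.single_le_sum (f := fun j => ‖G.cov j φ x‖ ^ 2) (fun _ _ => by positivity)
          (Finset.mem_univ i)
      have h4 := rho_inv_pos x
      have h5 : 0 ≤ (rho x)⁻¹ ^ 2 * ‖χ x • φ x‖ ^ 2 := by positivity
      have h6 : 0 ≤ ‖G.P x (χ x • φ x)‖ ^ 2 := by positivity
      linarith
    · rw [Set.indicator_of_notMem hx]
      exact dens1_nonneg _ x
  have h2 : ∫ x, ‖T.cl (fun x => χ x • φ x) x‖ ^ 2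
      ≤ 4 * (1 + R₂) ^ 2 * G.N1 (T.cl φ) + 12 * M ^ 2 * locN R' φ := by
    unfold GaugeData.N1 locN
    rw [← integral_const_mul, ← integral_const_mul,
      ← integral_add ((hφ.cl T).integrable_dens1.const_mul _) ((hφ.integrable_loc R').const_mul _)]
    refine integral_mono (hχφ.cl T).integrable_norm_sq
      (((hφ.cl T).integrable_dens1.const_mul _).add ((hφ.integrable_loc R').const_mul _))
      fun x => ?_
    simp only
    rcases lt_or_ge ‖x‖ R₂ with hx | hx
    · have hxb : x ∈ Metric.ball (0 : E3) R' := by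
        rw [mem_ball_zero_iff]; exact hx.trans_le (le_max_right R₁ R₂)
      rw [Set.indicator_of_mem hxb, T.cl_smul hχ hφ.1, Fin.sum_univ_three]
      have h3 : ∀ j, ‖fderiv ℝ χ x (e j) • T.γ j (φ x)‖ ≤ M * ‖φ x‖ := fun j => by
        rw [norm_smul, T.norm_γ]
        have := hdχ (e j) x
        rw [he, mul_one] at this
        exact mul_le_mul_of_nonneg_right this (norm_nonneg _)
      have h4 : ‖χ x • T.cl φ x‖ ≤ ‖T.cl φ x‖ := by
        rw [norm_smul]
        exact mul_le_of_le_one_left (norm_nonneg _) (hχ1 x)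
      have h5 : ‖T.cl φ x‖ ^ 2 ≤ (1 + R₂) ^ 2 * G.dens1 (T.cl φ) x := by
        have h6 : 1 ≤ (1 + R₂) * (rho x)⁻¹ := by
          rw [← div_eq_mul_inv, one_le_div (rho_pos x)]
          linarith [rho_le x]
        have h7 : 1 ≤ ((1 + R₂) * (rho x)⁻¹) ^ 2 := one_le_pow₀ h6
        have h8 : ‖T.cl φ x‖ ^ 2 ≤ ((1 + R₂) * (rho x)⁻¹) ^ 2 * ‖T.cl φ x‖ ^ 2 :=
          le_mul_of_one_le_left (by positivity) h7
        have h9 : 0 ≤ (1 + R₂) ^ 2 * (∑ j, ‖G.cov j (T.cl φ) x‖ ^ 2 + ‖G.P x (T.cl φ x)‖ ^ 2) := by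
          positivity
        simp only [GaugeData.dens1]
        linarith
      have h6 : ‖fderiv ℝ χ x (e 0) • T.γ 0 (φ x) + fderiv ℝ χ x (e 1) • T.γ 1 (φ x)
          + fderiv ℝ χ x (e 2) • T.γ 2 (φ x) + χ x • T.cl φ x‖
          ≤ M * ‖φ x‖ + M * ‖φ x‖ + M * ‖φ x‖ + ‖T.cl φ x‖ :=
        norm_add₄_le.trans (by gcongr <;> exact h3 _)
      have h7 : ∀ n a b : ℝ, 0 ≤ n → n ≤ a + a + a + b → n ^ 2 ≤ 12 * a ^ 2 + 4 * b ^ 2 := by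
        intro n a b hn h
        have : n ^ 2 ≤ (a + a + a + b) ^ 2 := by gcongr
        nlinarith [sq_nonneg (a - b)]
      have h8 := h7 _ _ _ (norm_nonneg _) h6
      rw [mul_pow] at h8
      linarith
    · have h3 : χ x = 0 := hχ0 x hx
      rw [T.cl_smul hχ hφ.1, hdχ0 x hx, h3]
      have h4 := indicator_norm_sq_nonneg R' φ x
      have h5 := dens1_nonneg (G := G) (T.cl φ) x
      simp only [zero_apply, zero_smul, Finset.sum_const_zero, add_zero, norm_zero]
      rw [zero_pow two_ne_zero]
      positivity
  have h3 : locN R₁ (fun x => χ x • φ x) ≤ locN R' φ := by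
    refine integral_mono (hχφ.integrable_loc R₁) (hφ.integrable_loc R') fun x => ?_
    refine (Set.indicator_le_indicator_of_subset
      (Metric.ball_subset_ball (le_max_left R₁ R₂)) (fun _ => by positivity) x).trans ?_
    refine Set.indicator_le_indicator ?_
    rw [norm_smul]
    gcongr
    exact mul_le_of_le_one_left (norm_nonneg _) (hχ1 x)
  have h4 := hest _ hχφ
  have h5 : C₁ * ((∫ x, ‖T.cl (fun x => χ x • φ x) x‖ ^ 2) + locN R₁ (fun x => χ x • φ x))
      ≤ C₁ * ((4 * (1 + R₂) ^ 2 * G.N1 (T.cl φ) + 12 * M ^ 2 * locN R' φ) + locN R' φ) := by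
    gcongr
  have h6 := N1_nonneg (G := G) (T.cl φ)
  have h7 := locN_nonneg R' φ
  have h8 : 0 ≤ C₁ * ((4 * (1 + R₂) ^ 2) * locN R' φ + 12 * M ^ 2 * G.N1 (T.cl φ)
    + G.N1 (T.cl φ)) := by positivity
  linarith

/-- In the application `X` is the derivative part of the `𝓗₂`-norm, `Y` the zeroth order part, `D`
the norm of `Tφ` and `L` the local term. Each of `X`, `Y` bounds the other, and `24 q ≤ 1/2` breaks
the circle. -/
theorem absorb_arith {X Y D L A B q : ℝ} (hX0 : 0 ≤ X) (hD0 : 0 ≤ D) (hL0 : 0 ≤ L) (hA0 : 0 ≤ A)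
    (hB0 : 0 ≤ B) (hq0 : 0 ≤ q) (hq : q ≤ 1 / 48) (hY : Y ≤ 32 * L + 24 * X + 8 * D)
    (hX : X ≤ A * D + q * Y + B * L) : X + Y ≤ (50 * A + 50 * B + 100) * (D + L) := by
  have hsmall : q * Y ≤ 1 / 48 * (32 * L + 24 * X + 8 * D) :=
    (mul_le_mul_of_nonneg_left hY hq0).trans (mul_le_mul_of_nonneg_right hq (by positivity))
  have hAD := mul_nonneg hA0 hD0
  have hBL := mul_nonneg hB0 hL0
  have hAL := mul_nonneg hA0 hL0
  have hBD := mul_nonneg hB0 hD0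
  have hX2 : X ≤ 2 * (A * D) + 2 * (B * L) + 2 * L + D := by linarith
  linarith

/-- The a priori estimate in `𝓗₂` for test functions. -/
theorem elliptic : ∃ R, 0 < R ∧ ∃ C, 0 < C ∧ ∀ φ : E3 → F, Test φ →
    G.N2 φ ≤ C * (G.N1 (T.cl φ) + locN R φ) := by
  obtain ⟨R₁, hR₁, C₁, hC₁, hest⟩ := T.coercive
  obtain ⟨R₂, C₂, hC₂, hR₁₂, hloc⟩ := T.locN_cov_le R₁ hR₁
  have hK := G.K_pos
  -- `1728 = 3 * 32 * 18`: three indices `i`, the squared commutator bound `2 * 4²`, and the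
  -- constant of `sum_norm_dP_sq_le`. The choice of `δ` below makes `k δ ≤ 1/48`.
  set k := 1728 * C₁ * G.K ^ 2 with hk
  have hk0 : 0 < k := by positivity
  set δ := (48 * k + 1)⁻¹ with hδdef
  have hδ : 0 < δ := by positivity
  have hδ1 : δ ≤ 1 := inv_le_one_of_one_le₀ (by linarith)
  have hδk : 48 * k * δ ≤ 1 := by
    have : (48 * k + 1) * δ = 1 := mul_inv_cancel₀ (by positivity)
    linarith
  -- The ball must contain those used for first derivatives (`R₂`), for absorption (`δ⁻¹`) and in
  -- `integral_dens0_le` (`4`).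
  set R := max (max R₂ δ⁻¹) 4 with hRdef
  have hR : 0 < R := lt_of_lt_of_le (by norm_num) (le_max_right _ _)
  set A := 6 * C₁ + 3 * C₁ * C₂ with hA
  set B := k * (G.K ^ 2 + 1) + 3 * C₁ * C₂ with hB
  have hA0 : 0 ≤ A := by positivity
  have hB0 : 0 ≤ B := by positivity
  refine ⟨R, hR, 50 * A + 50 * B + 100, by positivity, fun φ hφ => ?_⟩
  set X := ∑ i, G.N1 (G.cov i φ) with hX
  set Y := ∫ x, G.dens0 φ x with hY
  set D := G.N1 (T.cl φ) with hD
  set L := locN R φ with hL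
  have hX0 : 0 ≤ X := Finset.sum_nonneg fun i _ => N1_nonneg _
  have hD0 : 0 ≤ D := N1_nonneg _
  have hL0 : 0 ≤ L := locN_nonneg _ _
  have hYle : Y ≤ 32 * L + 24 * X + 8 * D := by
    have h1 := T.integral_dens0_le hφ
    have h2 := locN_mono hφ (le_max_right (max R₂ δ⁻¹) 4)
    linarith
  have hsingle : ∀ i, ∫ x, ‖T.cl (G.cov i φ) x‖ ^ 2
      ≤ 2 * (∫ x, ‖G.cov i (T.cl φ) x‖ ^ 2) + 576 * G.K ^ 2 * (δ * Y + (G.K ^ 2 + 1) * L) := by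
    intro i
    have i1 : Integrable fun x => ‖G.cov i (T.cl φ) x‖ ^ 2 := ((hφ.cl T).cov i).integrable_norm_sq
    have i2 : Integrable fun x => δ * G.dens0 φ x + (G.K ^ 2 + 1) *
        (Metric.ball (0 : E3) δ⁻¹).indicator (fun x => ‖φ x‖ ^ 2) x :=
      (hφ.integrable_dens0.const_mul _).add ((hφ.integrable_loc _).const_mul _)
    have h1 : ∫ x, ‖T.cl (G.cov i φ) x‖ ^ 2 ≤ ∫ x, (2 * ‖G.cov i (T.cl φ) x‖ ^ 2
        + 576 * G.K ^ 2 * (δ * G.dens0 φ x + (G.K ^ 2 + 1) *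
          (Metric.ball (0 : E3) δ⁻¹).indicator (fun x => ‖φ x‖ ^ 2) x)) := by
      refine integral_mono ((hφ.cov i).cl T).integrable_norm_sq
        ((i1.const_mul _).add (i2.const_mul _)) fun x => ?_
      have a1 := T.norm_cl_cov_sub_le hφ.1 i x
      have a2 := sum_norm_dP_sq_le G x (φ x)
      have a3 := absorb_le (G := G) hδ φ x
      have a4 : ‖T.cl (G.cov i φ) x‖ ≤ 4 * ∑ l, ‖G.dP l x (φ x)‖ + ‖G.cov i (T.cl φ) x‖ :=
        (norm_le_norm_sub_add _ (G.cov i (T.cl φ) x)).trans (by gcongr)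
      have a5 : ‖T.cl (G.cov i φ) x‖ ^ 2
          ≤ 32 * (∑ l, ‖G.dP l x (φ x)‖) ^ 2 + 2 * ‖G.cov i (T.cl φ) x‖ ^ 2 := by
        have : ‖T.cl (G.cov i φ) x‖ ^ 2
          ≤ (4 * ∑ l, ‖G.dP l x (φ x)‖ + ‖G.cov i (T.cl φ) x‖) ^ 2 := by gcongr
        nlinarith [sq_nonneg (4 * ∑ l, ‖G.dP l x (φ x)‖ - ‖G.cov i (T.cl φ) x‖)]
      have a6 : 576 * G.K ^ 2 * ((rho x)⁻¹ ^ 4 * ‖G.P x (φ x)‖ ^ 2 + (rho x)⁻¹ ^ 6 * ‖φ x‖ ^ 2)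
        ≤ 576 * G.K ^ 2 * (δ * G.dens0 φ x + (G.K ^ 2 + 1) *
          (Metric.ball (0 : E3) δ⁻¹).indicator (fun x => ‖φ x‖ ^ 2) x) := by gcongr
      simp only
      linarith
    rw [integral_add (i1.const_mul _) (i2.const_mul _), integral_const_mul, integral_const_mul,
      integral_add (hφ.integrable_dens0.const_mul _) ((hφ.integrable_loc _).const_mul _),
      integral_const_mul, integral_const_mul] at h1
    refine h1.trans ?_
    have h2 : locN δ⁻¹ φ ≤ L := locN_mono hφ ((le_max_right R₂ δ⁻¹).trans (le_max_left _ _))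
    have h3 : (∫ x, (Metric.ball (0 : E3) δ⁻¹).indicator (fun x => ‖φ x‖ ^ 2) x) ≤ L := h2
    gcongr
  have hcovcl : ∑ i, ∫ x, ‖G.cov i (T.cl φ) x‖ ^ 2 ≤ D := by
    rw [← integral_finsetSum _ fun i _ => ((hφ.cl T).cov i).integrable_norm_sq]
    refine integral_mono (integrable_finsetSum _ fun i _ => ((hφ.cl T).cov i).integrable_norm_sq)
      (hφ.cl T).integrable_dens1 fun x => ?_
    have hr := rho_inv_pos x
    have : 0 ≤ (rho x)⁻¹ ^ 2 * ‖T.cl φ x‖ ^ 2 + ‖G.P x (T.cl φ x)‖ ^ 2 := by positivity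
    simp only [GaugeData.dens1]
    linarith
  have hlocL : ∀ i, locN R₁ (G.cov i φ) ≤ C₂ * (D + L) := fun i => by
    have h1 := hloc φ hφ i
    have h2 : locN R₂ φ ≤ L := locN_mono hφ ((le_max_left R₂ δ⁻¹).trans (le_max_left _ _))
    exact h1.trans (by gcongr)
  have hXle : X ≤ C₁ * (2 * D + 1728 * G.K ^ 2 * (δ * Y + (G.K ^ 2 + 1) * L) + 3 * (C₂ * (D + L))) := by
    have h1 : X ≤ ∑ i, C₁ * ((2 * (∫ x, ‖G.cov i (T.cl φ) x‖ ^ 2)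
        + 576 * G.K ^ 2 * (δ * Y + (G.K ^ 2 + 1) * L)) + C₂ * (D + L)) := by
      refine Finset.sum_le_sum fun i _ => (hest _ (hφ.cov i)).trans ?_
      gcongr
      · exact hsingle i
      · exact hlocL i
    rw [← Finset.mul_sum, Finset.sum_add_distrib, Finset.sum_add_distrib, ← Finset.mul_sum] at h1
    simp only [Finset.sum_const, Finset.card_univ, Fintype.card_fin, nsmul_eq_mul] at h1
    refine h1.trans ?_
    refine mul_le_mul_of_nonneg_left ?_ hC₁.le
    push_cast
    linarith
  have hXle2 : X ≤ A * D + k * δ * Y + B * L := by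
    have : C₁ * (2 * D + 1728 * G.K ^ 2 * (δ * Y + (G.K ^ 2 + 1) * L) + 3 * (C₂ * (D + L)))
        = (2 * C₁ + 3 * C₁ * C₂) * D + k * δ * Y + B * L := by rw [hk, hB]; ring
    rw [this] at hXle
    have h2 : 0 ≤ 4 * C₁ * D := by positivity
    rw [hA]
    linarith
  exact absorb_arith hX0 hD0 hL0 hA0 hB0 (mul_nonneg hk0.le hδ.le) (by linarith) hYle hXle2

end DiracCoeff

end Generic

/-! ### Weak covariant derivatives -/

section Generic

variable {F : Type*} [NormedAddCommGroup F] [InnerProductSpace ℝ F] [FiniteDimensional ℝ F]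
  {G : GaugeData F} {φ ψ c c' g g' : E3 → F} {i : Fin 3}

/-- `g` is the covariant derivative `∇_i c` in the weak sense. -/
def GaugeData.IsWeak (G : GaugeData F) (i : Fin 3) (c g : E3 → F) : Prop :=
  LocallyIntegrable c volume ∧ LocallyIntegrable g volume ∧
    ∀ φ : E3 → F, Test φ → ∫ x, inner ℝ (c x) (G.cov i φ x) = -∫ x, inner ℝ (g x) (φ x)

theorem integrable_inner_of_locallyIntegrable (hc : LocallyIntegrable c volume) (hψ : Continuous ψ)
    (hs : HasCompactSupport ψ) : Integrable fun x => inner ℝ (c x) (ψ x) := by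
  obtain ⟨C, hC⟩ := hs.exists_bound_of_continuous hψ
  have h1 : IntegrableOn c (tsupport ψ) := hc.integrableOn_isCompact hs
  rw [← integrableOn_iff_integrable_of_support_subset (s := tsupport ψ)]
  · refine Integrable.mono' (h1.norm.const_mul C)
      (h1.aestronglyMeasurable.inner hψ.aestronglyMeasurable) (ae_of_all _ fun x => ?_)
    refine (norm_inner_le_norm _ _).trans ?_
    rw [mul_comm]
    gcongr
    exact hC x
  · intro x hx
    refine subset_closure fun h => hx ?_
    simp [h]

theorem aestronglyMeasurable_clm {B : E3 → F →L[ℝ] F} (hB : Continuous B)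
    (hc : AEStronglyMeasurable c volume) : AEStronglyMeasurable (fun x => B x (c x)) volume :=
  (ContinuousLinearMap.id ℝ (F →L[ℝ] F)).aestronglyMeasurable_comp₂ hB.aestronglyMeasurable hc

theorem locallyIntegrable_clm {B : E3 → F →L[ℝ] F} (hB : Continuous B)
    (hc : LocallyIntegrable c volume) : LocallyIntegrable (fun x => B x (c x)) volume := by
  rw [locallyIntegrable_iff] at hc ⊢
  intro k hk
  obtain ⟨C, hC⟩ := hk.exists_bound_of_continuousOn hB.continuousOn
  have h1 := hc k hk
  refine Integrable.mono' (h1.norm.const_mul C)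
    ((ContinuousLinearMap.id ℝ (F →L[ℝ] F)).aestronglyMeasurable_comp₂ hB.aestronglyMeasurable
      h1.aestronglyMeasurable) ?_
  filter_upwards [ae_restrict_mem hk.measurableSet] with x hx
  refine ((B x).le_opNorm _).trans ?_
  gcongr
  exact hC x hx

/-- Skewness is a linear condition with constant coefficients, so it passes to derivatives. -/
theorem skew_fderiv {B : E3 → F →L[ℝ] F} (hB : ContDiff ℝ ∞ B)
    (hs : ∀ x v w, inner ℝ (B x v) w = -inner ℝ v (B x w)) (y x : E3) (v w : F) :
    inner ℝ (fderiv ℝ B x y v) w = -inner ℝ v (fderiv ℝ B x y w) := by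
  have hd : HasFDerivAt B (fderiv ℝ B x) x := (hB.differentiable (by simp) x).hasFDerivAt
  have h1 : ∀ v w, HasFDerivAt (fun z => inner ℝ w (B z v))
      ((innerSL ℝ w).comp ((fderiv ℝ B x).flip v)) x := by
    intro v w
    refine (innerSL ℝ w).hasFDerivAt.comp x ?_
    convert hd.clm_apply (hasFDerivAt_const v x) using 1
    ext; simp
  have h3 : (fun z => inner ℝ w (B z v)) = fun z => -inner ℝ v (B z w) := by
    funext z; rw [real_inner_comm, hs]
  have h2 := h1 v w
  rw [h3] at h2
  have h4 := DFunLike.congr_fun (h2.unique (h1 w v).neg) y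
  simp only [ContinuousLinearMap.comp_apply, ContinuousLinearMap.flip_apply, innerSL_apply_apply,
    neg_apply] at h4
  rw [real_inner_comm, h4]

namespace GaugeData

theorem isWeak_cov (hc : ContDiff ℝ ∞ c) (i : Fin 3) : G.IsWeak i c (G.cov i c) := by
  refine ⟨hc.continuous.locallyIntegrable, (contDiff_cov hc i).continuous.locallyIntegrable,
    fun φ hφ => ?_⟩
  have h := integral_cov_left (G := G) hφ hc i
  simp only [real_inner_comm] at h ⊢
  linarith

namespace IsWeak

theorem add (h : G.IsWeak i c g) (h' : G.IsWeak i c' g') :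
    G.IsWeak i (fun x => c x + c' x) (fun x => g x + g' x) := by
  refine ⟨h.1.add h'.1, h.2.1.add h'.2.1, fun φ hφ => ?_⟩
  have h1 := (hφ.cov (G := G) i)
  simp only [inner_add_left]
  rw [integral_add (integrable_inner_of_locallyIntegrable h.1 h1.continuous h1.2)
    (integrable_inner_of_locallyIntegrable h'.1 h1.continuous h1.2),
    integral_add (integrable_inner_of_locallyIntegrable h.2.1 hφ.continuous hφ.2)
    (integrable_inner_of_locallyIntegrable h'.2.1 hφ.continuous hφ.2), h.2.2 φ hφ, h'.2.2 φ hφ]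
  ring

theorem neg (h : G.IsWeak i c g) : G.IsWeak i (fun x => -c x) (fun x => -g x) := by
  refine ⟨h.1.neg, h.2.1.neg, fun φ hφ => ?_⟩
  simp only [inner_neg_left, integral_neg, h.2.2 φ hφ]

theorem sub (h : G.IsWeak i c g) (h' : G.IsWeak i c' g') :
    G.IsWeak i (fun x => c x - c' x) (fun x => g x - g' x) := by
  simpa only [sub_eq_add_neg] using h.add h'.neg

theorem congr (h : G.IsWeak i c g) (hc : c =ᵐ[volume] c') (hg : g =ᵐ[volume] g') :
    G.IsWeak i c' g' := by
  refine ⟨h.1.congr hc, h.2.1.congr hg, fun φ hφ => ?_⟩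
  have := h.2.2 φ hφ
  rw [integral_congr_ae (g := fun x => inner ℝ (c' x) (G.cov i φ x)),
    integral_congr_ae (f := fun x => inner ℝ (g x) (φ x))
      (g := fun x => inner ℝ (g' x) (φ x))] at this
  · exact this
  · filter_upwards [hg] with x hx; rw [hx]
  · filter_upwards [hc] with x hx; rw [hx]

/-- Testing with `η • v` reduces this to the fundamental lemma of the calculus of variations. -/
theorem unique (h : G.IsWeak i c g) (h' : G.IsWeak i c g') : g =ᵐ[volume] g' := by
  refine ae_eq_of_integral_contDiff_smul_eq h.2.1 h'.2.1 fun η hη hs => ?_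
  refine ext_inner_right ℝ fun v => ?_
  have ht : Test (fun x => η x • v) := by
    refine ⟨hη.smul contDiff_const, hs.mono' fun x hx => subset_closure fun h0 => hx ?_⟩
    simp [h0]
  have h1 := (h.2.2 _ ht).symm.trans (h'.2.2 _ ht)
  simp only [inner_smul_right, neg_inj] at h1
  have key : ∀ u : E3 → F, LocallyIntegrable u volume →
      inner ℝ (∫ x, η x • u x) v = ∫ x, η x * inner ℝ (u x) v := by
    intro u hu
    rw [real_inner_comm, ← integral_inner
      (hu.integrable_smul_left_of_hasCompactSupport hη.continuous hs)]
    simp only [inner_smul_right, real_inner_comm]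
  rw [key g h.2.1, key g' h'.2.1, h1]

/-- The Leibniz rule for a field of endomorphisms. -/
theorem clm (h : G.IsWeak i c g) {B Bt B' Bt' : E3 → F →L[ℝ] F} (hB : Continuous B)
    (hB' : Continuous B') (hBt : ContDiff ℝ ∞ Bt) (hBt' : Continuous Bt')
    (adj : ∀ x v w, inner ℝ (B x v) w = inner ℝ v (Bt x w))
    (adj' : ∀ x v w, inner ℝ (B' x v) w = inner ℝ v (Bt' x w))
    (hcov : ∀ φ, Test φ → ∀ x,
      G.cov i (fun y => Bt y (φ y)) x = Bt' x (φ x) + Bt x (G.cov i φ x)) :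
    G.IsWeak i (fun x => B x (c x)) (fun x => B' x (c x) + B x (g x)) := by
  refine ⟨locallyIntegrable_clm hB h.1,
    (locallyIntegrable_clm hB' h.1).add (locallyIntegrable_clm hB h.2.1), fun φ hφ => ?_⟩
  have h1 := h.2.2 _ (hφ.clm hBt)
  have h2 : Continuous fun x => Bt' x (φ x) := hBt'.clm_apply hφ.continuous
  have h3 : HasCompactSupport fun x => Bt' x (φ x) :=
    hφ.2.mono' fun x hx => subset_closure fun h0 => hx (by simp [h0])
  have h4 : Test fun x => Bt x (G.cov i φ x) := (hφ.cov i).clm hBt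
  have h5 : Test fun x => Bt x (φ x) := hφ.clm hBt
  simp only [hcov φ hφ, inner_add_right] at h1
  rw [integral_add (integrable_inner_of_locallyIntegrable h.1 h2 h3)
    (integrable_inner_of_locallyIntegrable h.1 h4.continuous h4.2)] at h1
  simp only [inner_add_left, adj, adj']
  rw [integral_add (integrable_inner_of_locallyIntegrable h.1 h2 h3)
    (integrable_inner_of_locallyIntegrable h.2.1 h5.continuous h5.2)]
  linarith

theorem smul (h : G.IsWeak i c g) {χ : E3 → ℝ} (hχ : ContDiff ℝ ∞ χ) :
    G.IsWeak i (fun x => χ x • c x) (fun x => fderiv ℝ χ x (e i) • c x + χ x • g x) := by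
  have h1 : ContDiff ℝ ∞ fun x => χ x • ContinuousLinearMap.id ℝ F := hχ.smul contDiff_const
  have h2 : Continuous fun x => fderiv ℝ χ x (e i) • ContinuousLinearMap.id ℝ F :=
    (contDiff_pderiv hχ (e i)).continuous.smul continuous_const
  refine h.clm (B := fun x => χ x • ContinuousLinearMap.id ℝ F) h1.continuous h2 h1 h2 ?_ ?_ ?_
  · simp [inner_smul_left, inner_smul_right]
  · simp [inner_smul_left, inner_smul_right]
  · intro φ hφ x
    exact cov_smul hχ hφ.1 i x

/-- The Leibniz rule with a parallel endomorphism. The adjoint of `L` also commutes with the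
connection form, because the latter is skew. -/
theorem map (h : G.IsWeak i c g) {L : F →L[ℝ] F} (hL : ∀ x v, L (G.a i x v) = G.a i x (L v)) :
    G.IsWeak i (fun x => L (c x)) (fun x => L (g x)) := by
  have hadj : ∀ v w, inner ℝ (L v) w = inner ℝ v (L.adjoint w) := fun v w => by
    rw [ContinuousLinearMap.adjoint_inner_right]
  have h1 : ∀ x v, L.adjoint (G.a i x v) = G.a i x (L.adjoint v) := fun x v => by
    refine ext_inner_left ℝ fun w => ?_
    have h2 := G.skew_a i x w (L.adjoint v)
    rw [← hadj, ← neg_neg (inner ℝ (L w) _), ← G.skew_a, ← hL, hadj, h2, neg_neg]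
  have h2 := h.clm (B := fun _ => L) (Bt := fun _ => L.adjoint) (B' := 0) (Bt' := 0)
    continuous_const continuous_const contDiff_const continuous_const (fun _ => hadj) (by simp) ?_
  · simpa using h2
  · intro φ hφ x
    have h3 : HasFDerivAt (fun y => L.adjoint (φ y)) (L.adjoint.comp (fderiv ℝ φ x)) x :=
      L.adjoint.hasFDerivAt.comp x (hφ.1.differentiable (by simp) x).hasFDerivAt
    simp [GaugeData.cov, h3.fderiv, h1]

end IsWeak

theorem skew_dP (G : GaugeData F) (i : Fin 3) (x : E3) (v w : F) :
    inner ℝ (G.dP i x v) w = -inner ℝ v (G.dP i x w) := by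
  have key := skew_fderiv G.smooth_P G.skew_P (e i) x v w
  have h := G.fderiv_P i x
  have e1 : ∀ v, G.dP i x v
      = fderiv ℝ G.P x (e i) v + (G.a i x (G.P x v) - G.P x (G.a i x v)) := fun v => by
    rw [h]; abel
  rw [e1, e1, inner_add_left, inner_add_right, inner_sub_left, inner_sub_right, key, G.skew_a,
    G.skew_P, G.skew_P, G.skew_a]
  ring

theorem IsWeak.P (h : G.IsWeak i c g) :
    G.IsWeak i (fun x => G.P x (c x)) (fun x => G.dP i x (c x) + G.P x (g x)) := by
  refine h.clm (Bt := fun x => -G.P x) (Bt' := fun x => -G.dP i x) G.smooth_P.continuous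
    (G.smooth_dP i).continuous G.smooth_P.neg (G.smooth_dP i).continuous.neg ?_ ?_ ?_
  · intro x v w; simp [G.skew_P]
  · intro x v w; simp [G.skew_dP]
  · intro φ hφ x
    have h1 := cov_P (G := G) hφ.1.neg i x
    have h2 : G.cov i (fun x => -φ x) x = -G.cov i φ x := by
      simp only [GaugeData.cov, fderiv_fun_neg, map_neg, neg_apply]
      abel
    rw [h2] at h1
    simp only [map_neg] at h1
    simpa using h1

variable (F) in
/-- The trivial connection. -/
def flat : GaugeData F where
  a _ _ := 0
  P _ := 0
  dP _ _ := 0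
  K := 1
  smooth_a _ := contDiff_const
  smooth_P := contDiff_const
  smooth_dP _ := contDiff_const
  skew_a := by simp
  skew_P := by simp
  fderiv_P := by simp
  curvature := by simp
  K_pos := one_pos
  norm_P := by simp
  norm_dP i x v := by
    have := (rho_pos x).le
    simp only [zero_apply, norm_zero]; positivity
  dP_le i x v := by
    have := (rho_pos x).le
    simp only [zero_apply, norm_zero]; positivity

theorem flat_cov (c : E3 → F) (i : Fin 3) (x : E3) : (flat F).cov i c x = fderiv ℝ c x (e i) := by
  simp [cov, flat]

/-- The connection form has order zero and is skew, so it can be shifted off the test function. This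
gives access to ordinary weak derivatives, which commute with convolution. -/
theorem isWeak_flat_iff : (flat F).IsWeak i c (fun x => g x - G.a i x (c x)) ↔ G.IsWeak i c g := by
  have hl : LocallyIntegrable c volume →
      (LocallyIntegrable (fun x => g x - G.a i x (c x)) volume ↔ LocallyIntegrable g volume) := by
    intro hc
    have h1 := locallyIntegrable_clm (G.smooth_a i).continuous hc
    refine ⟨fun h => ?_, fun h => h.sub h1⟩
    refine (h.add h1).congr (ae_of_all _ fun x => ?_)
    simp
  refine and_congr_right fun hc => ?_
  rw [hl hc]
  refine and_congr_right fun hg => forall₂_congr fun φ hφ => ?_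
  have hd := hφ.fderiv (e i)
  have ha : Test fun x => G.a i x (φ x) := hφ.clm (G.smooth_a i)
  simp only [flat_cov]
  simp only [GaugeData.cov, inner_add_right, inner_sub_left, G.skew_a]
  rw [integral_add (integrable_inner_of_locallyIntegrable hc hd.continuous hd.2)
    (integrable_inner_of_locallyIntegrable hc ha.continuous ha.2)]
  simp only [sub_neg_eq_add]
  rw [integral_add (integrable_inner_of_locallyIntegrable hg hφ.continuous hφ.2)
    (integrable_inner_of_locallyIntegrable hc ha.continuous ha.2)]
  constructor <;> intro h <;> linarith

end GaugeData

end Generic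

/-! ### Square integrals with values in `[0, ∞]` -/

theorem null_const_mul {δ : ℕ → ℝ≥0∞} (h : Tendsto δ atTop (𝓝 0)) {C : ℝ≥0∞} (hC : C ≠ ⊤) :
    Tendsto (fun n => C * δ n) atTop (𝓝 0) := by
  simpa using ENNReal.Tendsto.const_mul h (Or.inr hC)

theorem null_add {δ ε : ℕ → ℝ≥0∞} (h : Tendsto δ atTop (𝓝 0)) (h' : Tendsto ε atTop (𝓝 0)) :
    Tendsto (fun n => δ n + ε n) atTop (𝓝 0) := by
  simpa using h.add h'

theorem null_of_le {δ ε : ℕ → ℝ≥0∞} (h : Tendsto δ atTop (𝓝 0)) (hle : ∀ n, ε n ≤ δ n) :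
    Tendsto ε atTop (𝓝 0) :=
  tendsto_of_tendsto_of_tendsto_of_le_of_le tendsto_const_nhds h (fun _ => zero_le) hle

theorem le_of_le_add_null {X A : ℝ≥0∞} {δ : ℕ → ℝ≥0∞} (h : ∀ n, X ≤ A + δ n)
    (hδ : Tendsto δ atTop (𝓝 0)) : X ≤ A := by
  have h1 : Tendsto (fun n => A + δ n) atTop (𝓝 A) := by simpa using tendsto_const_nhds.add hδ
  exact ge_of_tendsto' h1 h

theorem contDiff_rho_inv : ContDiff ℝ ∞ fun x => (rho x)⁻¹ :=
  contDiff_rho.inv fun x => (rho_pos x).ne'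

section Generic

variable {F : Type*} [NormedAddCommGroup F] [InnerProductSpace ℝ F] [FiniteDimensional ℝ F]
  {G : GaugeData F} {φ ψ u v : E3 → F}

/-- The squared `L²`-norm. -/
noncomputable def nsq (c : E3 → F) : ℝ≥0∞ := ∫⁻ x, ‖c x‖ₑ ^ 2

/-- The squared `L²`-norm on a ball. -/
noncomputable def nsqOn (R : ℝ) (c : E3 → F) : ℝ≥0∞ := nsq ((Metric.ball (0 : E3) R).indicator c)

theorem nsq_eq_eLpNorm (u : E3 → F) : nsq u = eLpNorm u 2 volume ^ 2 := by
  rw [eLpNorm_eq_lintegral_rpow_enorm_toReal (by norm_num) (by norm_num), nsq]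
  simp only [ENNReal.toReal_ofNat, ENNReal.rpow_ofNat, one_div]
  rw [← ENNReal.rpow_ofNat _ 2, ← ENNReal.rpow_mul]
  norm_num

theorem nsq_congr (h : u =ᵐ[volume] v) : nsq u = nsq v := by
  refine lintegral_congr_ae ?_
  filter_upwards [h] with x hx
  rw [hx]

theorem nsq_le_of_norm_le {M : ℝ} (h : ∀ x, ‖u x‖ ≤ M * ‖v x‖) :
    nsq u ≤ ENNReal.ofReal (M ^ 2) * nsq v := by
  rw [nsq, nsq, ← lintegral_const_mul' _ _ ENNReal.ofReal_ne_top]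
  refine lintegral_mono fun x => ?_
  rw [← ofReal_norm, ← ofReal_norm, ← ENNReal.ofReal_pow (norm_nonneg _),
    ← ENNReal.ofReal_pow (norm_nonneg _), ← ENNReal.ofReal_mul (by positivity), ← mul_pow]
  exact ENNReal.ofReal_le_ofReal (pow_le_pow_left₀ (norm_nonneg _) (h x) 2)

theorem nsq_add_le (hu : AEStronglyMeasurable u volume) :
    nsq (fun x => u x + v x) ≤ 2 * nsq u + 2 * nsq v := by
  have h1 : ∀ a b : F, ‖a + b‖ₑ ^ 2 ≤ 2 * ‖a‖ₑ ^ 2 + 2 * ‖b‖ₑ ^ 2 := by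
    intro a b
    simp only [enorm_eq_nnnorm]
    norm_cast
    refine (pow_le_pow_left₀ (zero_le) (nnnorm_add_le a b) 2).trans ?_
    rw [← mul_add]
    exact add_sq_le
  simp only [nsq]
  rw [← lintegral_const_mul' _ _ (by norm_num), ← lintegral_const_mul' _ _ (by norm_num),
    ← lintegral_add_left' ((hu.enorm.pow_const 2).const_mul 2)]
  exact lintegral_mono fun x => h1 _ _

theorem nsq_neg (u : E3 → F) : nsq (fun x => -u x) = nsq u := by simp [nsq]

theorem nsq_sub_le (hu : AEStronglyMeasurable u volume) :
    nsq (fun x => u x - v x) ≤ 2 * nsq u + 2 * nsq v := by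
  simpa only [sub_eq_add_neg, nsq_neg] using nsq_add_le (v := fun x => -v x) hu

theorem nsqOn_sub_le (R : ℝ) (hu : AEStronglyMeasurable u volume) :
    nsqOn R (fun x => u x - v x) ≤ 2 * nsqOn R u + 2 * nsqOn R v := by
  refine le_trans (le_of_eq ?_) (nsq_sub_le (hu.indicator Metric.isOpen_ball.measurableSet))
  simp only [nsqOn]
  congr 1
  funext x
  by_cases hx : x ∈ Metric.ball (0 : E3) R <;> simp [hx]

theorem nsqOn_eq (R : ℝ) (u : E3 → F) : nsqOn R u = ∫⁻ x in Metric.ball (0 : E3) R, ‖u x‖ₑ ^ 2 := by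
  rw [nsqOn, nsq, ← lintegral_indicator Metric.isOpen_ball.measurableSet]
  congr 1
  funext x
  by_cases hx : x ∈ Metric.ball (0 : E3) R <;> simp [hx]

/-- On a ball the weights are bounded below, so convergence in `𝓗₁` (`k = 1`) or `𝓗₂` (`k = 2`)
forces local `L²` convergence. -/
theorem nsqOn_le (R : ℝ) (k : ℕ) (u : E3 → F) :
    nsqOn R u ≤ ENNReal.ofReal (((1 + |R|) ^ k) ^ 2) * nsq (fun x => (rho x)⁻¹ ^ k • u x) := by
  refine nsq_le_of_norm_le fun x => ?_
  have hr := rho_pos x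
  by_cases hx : x ∈ Metric.ball (0 : E3) R
  · rw [Set.indicator_of_mem hx, norm_smul, norm_pow, norm_inv, Real.norm_of_nonneg hr.le,
      ← mul_assoc, ← mul_pow]
    refine le_mul_of_one_le_left (norm_nonneg _) (one_le_pow₀ ?_)
    rw [← div_eq_mul_inv, one_le_div hr]
    have := rho_le x
    have h2 := (mem_ball_zero_iff.mp hx).le.trans (le_abs_self R)
    linarith
  · rw [Set.indicator_of_notMem hx, norm_zero]
    positivity

theorem nsq_eq_ofReal (h : Integrable fun x => ‖u x‖ ^ 2) :
    nsq u = ENNReal.ofReal (∫ x, ‖u x‖ ^ 2) := by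
  rw [ofReal_integral_eq_lintegral_ofReal h (ae_of_all _ fun x => by positivity), nsq]
  refine lintegral_congr fun x => ?_
  rw [← ofReal_norm, ENNReal.ofReal_pow (norm_nonneg _)]

theorem Test.nsq_eq (h : Test φ) : nsq φ = ENNReal.ofReal (∫ x, ‖φ x‖ ^ 2) :=
  nsq_eq_ofReal h.integrable_norm_sq

theorem Test.nsqOn_eq (h : Test φ) (R : ℝ) : nsqOn R φ = ENNReal.ofReal (locN R φ) := by
  have h1 : (fun x => ‖(Metric.ball (0 : E3) R).indicator φ x‖ ^ 2)
      = (Metric.ball (0 : E3) R).indicator (fun x => ‖φ x‖ ^ 2) := by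
    funext x
    by_cases hx : x ∈ Metric.ball (0 : E3) R <;> simp [hx]
  rw [nsqOn, nsq_eq_ofReal, locN, h1]
  rw [h1]
  exact h.integrable_loc R

/-! ### Sequences tending to zero in `L²` -/

/-- A sequence of measurable functions which tends to zero in `L²`. -/
def L2Null (u : ℕ → E3 → F) : Prop :=
  (∀ n, AEStronglyMeasurable (u n) volume) ∧ Tendsto (fun n => nsq (u n)) atTop (𝓝 0)

namespace L2Null

variable {U V : ℕ → E3 → F}

theorem add (h : L2Null U) (h' : L2Null V) : L2Null (fun n x => U n x + V n x) :=
  ⟨fun n => (h.1 n).add (h'.1 n), null_of_le (null_add (null_const_mul h.2 ENNReal.ofNat_ne_top)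
    (null_const_mul h'.2 ENNReal.ofNat_ne_top)) fun n => nsq_add_le (h.1 n)⟩

theorem of_le (h : L2Null U) (hV : ∀ n, AEStronglyMeasurable (V n) volume) {M : ℝ}
    (hle : ∀ n x, ‖V n x‖ ≤ M * ‖U n x‖) : L2Null V :=
  ⟨hV, null_of_le (null_const_mul h.2 ENNReal.ofReal_ne_top)
    fun n => nsq_le_of_norm_le (hle n)⟩

theorem congr (h : L2Null U) (hle : ∀ n, U n =ᵐ[volume] V n) : L2Null V :=
  ⟨fun n => (h.1 n).congr (hle n), by simpa only [nsq_congr (hle _)] using h.2⟩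

theorem map (h : L2Null U) (L : F →L[ℝ] F) : L2Null (fun n x => L (U n x)) :=
  h.of_le (fun n => L.continuous.comp_aestronglyMeasurable (h.1 n))
    fun _ _ => L.le_opNorm _

theorem neg (h : L2Null U) : L2Null (fun n x => -U n x) :=
  h.of_le (fun n => (h.1 n).neg) (M := 1) fun _ _ => by simp

theorem sub (h : L2Null U) (h' : L2Null V) : L2Null (fun n x => U n x - V n x) := by
  simpa only [sub_eq_add_neg] using h.add h'.neg

theorem sum {ι : Type*} (s : Finset ι) {W : ι → ℕ → E3 → F} (h : ∀ i, L2Null (W i)) :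
    L2Null (fun n x => ∑ i ∈ s, W i n x) := by
  classical
  induction s using Finset.induction_on with
  | empty =>
    simp only [Finset.sum_empty]
    exact ⟨fun n => aestronglyMeasurable_const, by simp [nsq]⟩
  | insert i s hi ih =>
    simp only [Finset.sum_insert hi]
    exact (h i).add ih

end L2Null

namespace GaugeData

/-- The squared `𝓗₁`-norm of a section `c` with covariant derivative `g`. -/
noncomputable def n1 (G : GaugeData F) (c : E3 → F) (g : Fin 3 → E3 → F) : ℝ≥0∞ :=
  (∑ i, nsq (g i)) + nsq (fun x => (rho x)⁻¹ • c x) + nsq (fun x => G.P x (c x))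

/-- The squared `𝓗₂`-norm of a section `c` with covariant derivatives `g` and `h`. -/
noncomputable def n2 (G : GaugeData F) (c : E3 → F) (g : Fin 3 → E3 → F)
    (h : Fin 3 → Fin 3 → E3 → F) : ℝ≥0∞ :=
  (∑ j, G.n1 (g j) (fun i => h i j)) + nsq (fun x => G.P x (G.P x (c x)))
    + nsq (fun x => G.P x ((rho x)⁻¹ • c x)) + nsq (fun x => (rho x)⁻¹ ^ 2 • c x)

theorem aestronglyMeasurable_weight {c : E3 → F} (hc : AEStronglyMeasurable c volume) (k : ℕ) :
    AEStronglyMeasurable (fun x => (rho x)⁻¹ ^ k • c x) volume :=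
  (continuous_rho_inv.pow k).aestronglyMeasurable.smul hc

theorem n1_sub_le {c c' : E3 → F} {g g' : Fin 3 → E3 → F} (hc : AEStronglyMeasurable c volume)
    (hg : ∀ i, AEStronglyMeasurable (g i) volume) :
    G.n1 (fun x => c x - c' x) (fun i x => g i x - g' i x) ≤ 2 * G.n1 c g + 2 * G.n1 c' g' := by
  have h1 := fun i => nsq_sub_le (v := g' i) (hg i)
  have h2 := nsq_sub_le (u := fun x => (rho x)⁻¹ • c x) (v := fun x => (rho x)⁻¹ • c' x)
    (continuous_rho_inv.aestronglyMeasurable.smul hc)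
  have h3 := nsq_sub_le (v := fun x => G.P x (c' x))
    (aestronglyMeasurable_clm G.smooth_P.continuous hc)
  simp only [n1, smul_sub, map_sub]
  refine (add_le_add (add_le_add (Finset.sum_le_sum fun i _ => h1 i) h2) h3).trans (le_of_eq ?_)
  rw [Finset.sum_add_distrib, ← Finset.mul_sum, ← Finset.mul_sum]
  ring

theorem n2_sub_le {c c' : E3 → F} {g g' : Fin 3 → E3 → F} {h h' : Fin 3 → Fin 3 → E3 → F}
    (hc : AEStronglyMeasurable c volume) (hg : ∀ i, AEStronglyMeasurable (g i) volume)
    (hh : ∀ i j, AEStronglyMeasurable (h i j) volume) :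
    G.n2 (fun x => c x - c' x) (fun i x => g i x - g' i x) (fun i j x => h i j x - h' i j x)
      ≤ 2 * G.n2 c g h + 2 * G.n2 c' g' h' := by
  have hP := G.smooth_P.continuous
  have h1 := fun j => n1_sub_le (G := G) (c' := g' j) (g' := fun i => h' i j) (hg j)
    (fun i => hh i j)
  have h2 := nsq_sub_le (v := fun x => G.P x (G.P x (c' x)))
    (aestronglyMeasurable_clm hP (aestronglyMeasurable_clm hP hc))
  have h3 := nsq_sub_le (u := fun x => G.P x ((rho x)⁻¹ • c x))
    (v := fun x => G.P x ((rho x)⁻¹ • c' x))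
    (aestronglyMeasurable_clm hP (continuous_rho_inv.aestronglyMeasurable.smul hc))
  have h4 := nsq_sub_le (v := fun x => (rho x)⁻¹ ^ 2 • c' x) (aestronglyMeasurable_weight hc 2)
  simp only [n2, smul_sub, map_sub] at h3 h4 ⊢
  refine (add_le_add (add_le_add (add_le_add (Finset.sum_le_sum fun i _ => h1 i) h2) h3)
    h4).trans (le_of_eq ?_)
  rw [Finset.sum_add_distrib, ← Finset.mul_sum, ← Finset.mul_sum]
  ring

end GaugeData

theorem Test.n1_eq (h : Test φ) : G.n1 φ (fun i => G.cov i φ) = ENNReal.ofReal (G.N1 φ) := by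
  have i1 := fun i => (h.cov (G := G) i).integrable_norm_sq
  have i2 : Integrable fun x => (rho x)⁻¹ ^ 2 * ‖φ x‖ ^ 2 :=
    h.integrable_mul_norm_sq (continuous_rho_inv.pow 2)
  have i4 : Integrable fun x => ∑ i, ‖G.cov i φ x‖ ^ 2 := integrable_finsetSum _ fun i _ => i1 i
  have i5 : Integrable fun x => ∑ i, ‖G.cov i φ x‖ ^ 2 + (rho x)⁻¹ ^ 2 * ‖φ x‖ ^ 2 := i4.add i2
  have i3 := (h.clm G.smooth_P).integrable_norm_sq
  have e1 : ∫ x, ‖(rho x)⁻¹ • φ x‖ ^ 2 = ∫ x, (rho x)⁻¹ ^ 2 * ‖φ x‖ ^ 2 := by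
    congr 1; funext x
    rw [norm_smul, mul_pow, Real.norm_of_nonneg (rho_inv_pos x).le]
  have p2 : 0 ≤ ∫ x, (rho x)⁻¹ ^ 2 * ‖φ x‖ ^ 2 := integral_nonneg fun x => by positivity
  have p1 : ∀ i, 0 ≤ ∫ x, ‖G.cov i φ x‖ ^ 2 := fun i => integral_nonneg fun x => by positivity
  rw [GaugeData.n1, GaugeData.N1]
  unfold GaugeData.dens1
  rw [integral_add i5 i3, integral_add i4 i2,
    integral_finsetSum _ (fun i _ => i1 i), (h.clm G.smooth_P).nsq_eq,
    (h.smul contDiff_rho_inv).nsq_eq, e1, Finset.sum_congr rfl fun i _ => (h.cov i).nsq_eq,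
    ENNReal.ofReal_add (add_nonneg (Finset.sum_nonneg fun i _ => p1 i) p2)
      (integral_nonneg fun x => by positivity),
    ENNReal.ofReal_add (Finset.sum_nonneg fun i _ => p1 i) p2,
    ENNReal.ofReal_sum_of_nonneg fun i _ => p1 i]

theorem Test.n2_eq (h : Test φ) :
    G.n2 φ (fun i => G.cov i φ) (fun i j => G.cov i (G.cov j φ)) = ENNReal.ofReal (G.N2 φ) := by
  have i1 := ((h.clm G.smooth_P).clm G.smooth_P).integrable_norm_sq
  have i2 : Integrable fun x => (rho x)⁻¹ ^ 2 * ‖G.P x (φ x)‖ ^ 2 :=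
    (h.clm G.smooth_P).integrable_mul_norm_sq (continuous_rho_inv.pow 2)
  have i3 : Integrable fun x => (rho x)⁻¹ ^ 4 * ‖φ x‖ ^ 2 :=
    h.integrable_mul_norm_sq (continuous_rho_inv.pow 4)
  have i4 : Integrable fun x => ‖G.P x (G.P x (φ x))‖ ^ 2 + (rho x)⁻¹ ^ 2 * ‖G.P x (φ x)‖ ^ 2 :=
    i1.add i2
  have e1 : ∫ x, ‖G.P x ((rho x)⁻¹ • φ x)‖ ^ 2 = ∫ x, (rho x)⁻¹ ^ 2 * ‖G.P x (φ x)‖ ^ 2 := by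
    congr 1; funext x
    rw [map_smul, norm_smul, mul_pow, Real.norm_of_nonneg (rho_inv_pos x).le]
  have e2 : ∫ x, ‖(rho x)⁻¹ ^ 2 • φ x‖ ^ 2 = ∫ x, (rho x)⁻¹ ^ 4 * ‖φ x‖ ^ 2 := by
    congr 1; funext x
    rw [norm_smul, mul_pow, Real.norm_of_nonneg (pow_nonneg (rho_inv_pos x).le 2), ← pow_mul]
  have p1 : 0 ≤ ∫ x, ‖G.P x (G.P x (φ x))‖ ^ 2 := integral_nonneg fun x => by positivity
  have p2 : 0 ≤ ∫ x, (rho x)⁻¹ ^ 2 * ‖G.P x (φ x)‖ ^ 2 := integral_nonneg fun x => by positivity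
  have p3 : 0 ≤ ∫ x, (rho x)⁻¹ ^ 4 * ‖φ x‖ ^ 2 := integral_nonneg fun x => by positivity
  rw [GaugeData.n2, GaugeData.N2]
  unfold GaugeData.dens0
  rw [integral_add i4 i3, integral_add i1 i2,
    Finset.sum_congr rfl fun j _ => (h.cov j).n1_eq, ((h.clm G.smooth_P).clm G.smooth_P).nsq_eq,
    ((h.smul contDiff_rho_inv).clm G.smooth_P).nsq_eq,
    (h.smul (contDiff_rho_inv.pow 2)).nsq_eq, e1, e2,
    ENNReal.ofReal_add (Finset.sum_nonneg fun i _ => N1_nonneg _) (by positivity),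
    ENNReal.ofReal_add (by positivity) p3, ENNReal.ofReal_add p1 p2,
    ENNReal.ofReal_sum_of_nonneg fun i _ => N1_nonneg _]
  ring

end Generic

/-! ### Extension of the estimates to the completions -/

section Generic

variable {F : Type*} [NormedAddCommGroup F] [InnerProductSpace ℝ F] [FiniteDimensional ℝ F]
  {G : GaugeData F} {φ ψ : E3 → F} {c : E3 → F} {g : Fin 3 → E3 → F}
  {h : Fin 3 → Fin 3 → E3 → F}

namespace GaugeData

/-- Convergence to zero in the `𝓗₁`-norm. -/
structure Null1 (G : GaugeData F) (u : ℕ → E3 → F) (g : ℕ → Fin 3 → E3 → F) : Prop where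
  grad : ∀ i, L2Null (fun n => g n i)
  wt : L2Null (fun n x => (rho x)⁻¹ • u n x)
  P : L2Null (fun n x => G.P x (u n x))

/-- Convergence to zero in the `𝓗₂`-norm. -/
structure Null2 (G : GaugeData F) (u : ℕ → E3 → F) (g : ℕ → Fin 3 → E3 → F)
    (h : ℕ → Fin 3 → Fin 3 → E3 → F) : Prop where
  grad : ∀ j, G.Null1 (fun n => g n j) (fun n i => h n i j)
  PP : L2Null (fun n x => G.P x (G.P x (u n x)))
  Pw : L2Null (fun n x => G.P x ((rho x)⁻¹ • u n x))
  ww : L2Null (fun n x => (rho x)⁻¹ ^ 2 • u n x)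

/-- `c`, with covariant derivative `g`, is an `𝓗₁`-limit of test functions. -/
def Approx1 (G : GaugeData F) (c : E3 → F) (g : Fin 3 → E3 → F) : Prop :=
  ∃ φ : ℕ → E3 → F, (∀ n, Test (φ n)) ∧
    G.Null1 (fun n x => c x - φ n x) (fun n i x => g i x - G.cov i (φ n) x)

/-- `c`, with covariant derivatives `g` and `h`, is an `𝓗₂`-limit of test functions. -/
def Approx2 (G : GaugeData F) (c : E3 → F) (g : Fin 3 → E3 → F)
    (h : Fin 3 → Fin 3 → E3 → F) : Prop :=
  ∃ φ : ℕ → E3 → F, (∀ n, Test (φ n)) ∧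
    G.Null2 (fun n x => c x - φ n x) (fun n i x => g i x - G.cov i (φ n) x)
      (fun n i j x => h i j x - G.cov i (G.cov j (φ n)) x)

variable {u : ℕ → E3 → F} {p : ℕ → Fin 3 → E3 → F} {q : ℕ → Fin 3 → Fin 3 → E3 → F}

theorem Null1.tendsto (H : G.Null1 u p) : Tendsto (fun n => G.n1 (u n) (p n)) atTop (𝓝 0) := by
  simp only [n1, Fin.sum_univ_three]
  exact null_add (null_add (null_add (null_add (H.grad 0).2 (H.grad 1).2) (H.grad 2).2) H.wt.2)
    H.P.2

theorem Null2.tendsto (H : G.Null2 u p q) :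
    Tendsto (fun n => G.n2 (u n) (p n) (q n)) atTop (𝓝 0) := by
  simp only [n2, Fin.sum_univ_three]
  exact null_add (null_add (null_add (null_add (null_add (H.grad 0).tendsto (H.grad 1).tendsto)
    (H.grad 2).tendsto) H.PP.2) H.Pw.2) H.ww.2

theorem Null1.loc (H : G.Null1 u p) (R : ℝ) : Tendsto (fun n => nsqOn R (u n)) atTop (𝓝 0) :=
  null_of_le (null_const_mul H.wt.2 ENNReal.ofReal_ne_top) fun n => by
    simpa only [pow_one] using nsqOn_le R 1 (u n)

theorem Null2.loc (H : G.Null2 u p q) (R : ℝ) : Tendsto (fun n => nsqOn R (u n)) atTop (𝓝 0) :=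
  null_of_le (null_const_mul H.ww.2 ENNReal.ofReal_ne_top) fun n => nsqOn_le R 2 (u n)

end GaugeData

namespace DiracCoeff

variable (T : DiracCoeff G)

/-- The operator `∑ γ_j ∇_j + β P` on a section `c` with covariant derivative `g`. -/
noncomputable def op (c : E3 → F) (g : Fin 3 → E3 → F) (x : E3) : F :=
  ∑ j, T.γ j (g j x) + T.β (G.P x (c x))

/-- The covariant derivative of `T.op c g`. -/
noncomputable def opGrad (c : E3 → F) (g : Fin 3 → E3 → F) (h : Fin 3 → Fin 3 → E3 → F) (i : Fin 3)
    (x : E3) : F :=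
  ∑ j, T.γ j (h i j x) + T.β (G.dP i x (c x) + G.P x (g i x))

theorem op_cov (φ : E3 → F) : T.op φ (fun i => G.cov i φ) = T.cl φ := rfl

theorem opGrad_cov (hφ : ContDiff ℝ ∞ φ) (i : Fin 3) :
    T.opGrad φ (fun i => G.cov i φ) (fun i j => G.cov i (G.cov j φ)) i = G.cov i (T.cl φ) := by
  funext x
  exact (T.cov_cl hφ i x).symm

theorem op_sub (c c' : E3 → F) (g g' : Fin 3 → E3 → F) (x : E3) :
    T.op (fun x => c x - c' x) (fun i x => g i x - g' i x) x = T.op c g x - T.op c' g' x := by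
  simp only [op, map_sub, Finset.sum_sub_distrib]
  abel

theorem opGrad_sub (c c' : E3 → F) (g g' : Fin 3 → E3 → F) (h h' : Fin 3 → Fin 3 → E3 → F)
    (i : Fin 3) (x : E3) :
    T.opGrad (fun x => c x - c' x) (fun i x => g i x - g' i x) (fun i j x => h i j x - h' i j x) i x
      = T.opGrad c g h i x - T.opGrad c' g' h' i x := by
  simp only [opGrad, map_sub, map_add, Finset.sum_sub_distrib]
  abel

theorem aestronglyMeasurable_op (hc : AEStronglyMeasurable c volume)
    (hg : ∀ i, AEStronglyMeasurable (g i) volume) : AEStronglyMeasurable (T.op c g) volume := by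
  have h1 := fun j => (T.γ j).continuous.comp_aestronglyMeasurable (hg j)
  have h2 := T.β.continuous.comp_aestronglyMeasurable
    (aestronglyMeasurable_clm G.smooth_P.continuous hc)
  refine (((h1 0).add (h1 1)).add (h1 2)).add h2 |>.congr (ae_of_all _ fun x => ?_)
  simp [op, Fin.sum_univ_three]

theorem aestronglyMeasurable_opGrad (hc : AEStronglyMeasurable c volume)
    (hg : ∀ i, AEStronglyMeasurable (g i) volume) (hh : ∀ i j, AEStronglyMeasurable (h i j) volume)
    (i : Fin 3) : AEStronglyMeasurable (T.opGrad c g h i) volume := by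
  have h1 := fun j => (T.γ j).continuous.comp_aestronglyMeasurable (hh i j)
  have h2 := T.β.continuous.comp_aestronglyMeasurable
    ((aestronglyMeasurable_clm (G.smooth_dP i).continuous hc).add
      (aestronglyMeasurable_clm G.smooth_P.continuous (hg i)))
  refine (((h1 0).add (h1 1)).add (h1 2)).add h2 |>.congr (ae_of_all _ fun x => ?_)
  simp [opGrad, Fin.sum_univ_three]

theorem isWeak_op (hc : ∀ i, G.IsWeak i c (g i)) (hg : ∀ i j, G.IsWeak i (g j) (h i j))
    (i : Fin 3) : G.IsWeak i (T.op c g) (T.opGrad c g h i) := by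
  have h1 := fun j => (hg i j).map (T.γ_a j i)
  have h2 := (hc i).P.map (T.β_a i)
  refine ((((h1 0).add (h1 1)).add (h1 2)).add h2).congr (ae_of_all _ fun x => ?_)
    (ae_of_all _ fun x => ?_)
  · simp [op, Fin.sum_univ_three]
  · simp [opGrad, Fin.sum_univ_three]

variable {u : ℕ → E3 → F} {p : ℕ → Fin 3 → E3 → F} {q : ℕ → Fin 3 → Fin 3 → E3 → F}

theorem null_op (H : G.Null1 u p) : L2Null (fun n => T.op (u n) (p n)) :=
  (L2Null.sum _ fun j => (H.grad j).map (T.γ j)).add (H.P.map T.β)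

/-- Each term in the `𝓗₁`-norm of `T u` is a constant symbol applied to a term of the `𝓗₂`-norm of
`u`, except `dP_i u`, which is bounded by `ρ⁻² |u|`. -/
theorem null1_op (H : G.Null2 u p q) (hu : ∀ n, AEStronglyMeasurable (u n) volume) :
    G.Null1 (fun n => T.op (u n) (p n)) (fun n => T.opGrad (u n) (p n) (q n)) := by
  refine ⟨fun i => ?_, ?_, ?_⟩
  · refine (L2Null.sum _ fun j => ((H.grad j).grad i).map (T.γ j)).add (L2Null.map ?_ T.β)
    refine L2Null.add ?_ (H.grad i).P
    refine H.ww.of_le (fun n => aestronglyMeasurable_clm (G.smooth_dP i).continuous (hu n))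
      (M := G.K) fun n x => ?_
    rw [norm_smul, Real.norm_of_nonneg (pow_nonneg (rho_inv_pos x).le 2)]
    exact G.norm_dP i x _
  · have h1 := (L2Null.sum Finset.univ fun j => (H.grad j).wt.map (T.γ j)).add (H.Pw.map T.β)
    simp only [map_smul, ← Finset.smul_sum, ← smul_add] at h1
    exact h1
  · have h1 := (L2Null.sum Finset.univ fun j => (H.grad j).P.map (T.γ j)).add (H.PP.map T.β)
    simpa only [op, map_add, map_sum, T.γ_P, T.β_P] using h1

/-- An estimate for test functions extends to limits of test functions in `𝓗₁`. -/
theorem n1_le_of_test {C κ : ℝ≥0} {R : ℝ}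
    (hT : ∀ φ : E3 → F, Test φ →
      G.n1 φ (fun i => G.cov i φ) ≤ C * (nsq (T.cl φ) + κ * nsqOn R φ))
    (hc : ∀ i, G.IsWeak i c (g i)) (H : G.Approx1 c g) :
    G.n1 c g ≤ 4 * C * (nsq (T.op c g) + κ * nsqOn R c) := by
  obtain ⟨φ, hφ, hn⟩ := H
  have mc : AEStronglyMeasurable c volume := (hc 0).1.aestronglyMeasurable
  have mg := fun i => (hc i).2.1.aestronglyMeasurable
  have mφ := fun n => (hφ n).continuous.aestronglyMeasurable (μ := volume)
  have mcφ := fun n i => ((hφ n).cov (G := G) i).continuous.aestronglyMeasurable (μ := volume)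
  -- The squared triangle inequality is used twice, from `c` to `φ n` here and from `φ n` back to
  -- `c` on the right; this is the factor `4`.
  have b1 : ∀ n, G.n1 c g ≤ 2 * G.n1 (fun x => c x - φ n x) (fun i x => g i x - G.cov i (φ n) x)
      + 2 * G.n1 (φ n) (fun i => G.cov i (φ n)) := fun n => by
    have := GaugeData.n1_sub_le (G := G) (c := fun x => c x - φ n x) (c' := fun x => -φ n x)
      (g := fun i x => g i x - G.cov i (φ n) x) (g' := fun i x => -G.cov i (φ n) x)
      (mc.sub (mφ n)) (fun i => (mg i).sub (mcφ n i))
    simpa [GaugeData.n1, nsq_neg] using this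
  have b2 : ∀ n, nsq (T.cl (φ n)) ≤ 2 * nsq (T.op c g)
      + 2 * nsq (T.op (fun x => c x - φ n x) (fun i x => g i x - G.cov i (φ n) x)) := fun n => by
    refine le_trans (le_of_eq ?_) (nsq_sub_le (T.aestronglyMeasurable_op mc mg))
    congr 1
    funext x
    rw [op_sub, ← T.op_cov]
    abel
  have b3 : ∀ n, nsqOn R (φ n) ≤ 2 * nsqOn R c + 2 * nsqOn R (fun x => c x - φ n x) := fun n => by
    refine le_trans (le_of_eq ?_) (nsqOn_sub_le R mc)
    congr 1
    funext x
    abel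
  refine le_of_le_add_null (δ := fun n =>
    2 * G.n1 (fun x => c x - φ n x) (fun i x => g i x - G.cov i (φ n) x)
    + (4 * C * nsq (T.op (fun x => c x - φ n x) (fun i x => g i x - G.cov i (φ n) x))
      + 4 * C * κ * nsqOn R (fun x => c x - φ n x))) (fun n => ?_) ?_
  · calc G.n1 c g ≤ _ := b1 n
      _ ≤ 2 * G.n1 (fun x => c x - φ n x) (fun i x => g i x - G.cov i (φ n) x) + 2 * (C *
        ((2 * nsq (T.op c g)
          + 2 * nsq (T.op (fun x => c x - φ n x) (fun i x => g i x - G.cov i (φ n) x)))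
        + κ * (2 * nsqOn R c + 2 * nsqOn R (fun x => c x - φ n x)))) := by
          gcongr
          exact (hT _ (hφ n)).trans (by gcongr; exacts [b2 n, b3 n])
      _ = _ := by ring
  · refine null_add (null_const_mul hn.tendsto ENNReal.ofNat_ne_top) (null_add
      (null_const_mul (T.null_op hn).2 ?_) (null_const_mul (hn.loc R) ?_))
    · exact ENNReal.mul_ne_top ENNReal.ofNat_ne_top ENNReal.coe_ne_top
    · exact ENNReal.mul_ne_top (ENNReal.mul_ne_top ENNReal.ofNat_ne_top ENNReal.coe_ne_top)
        ENNReal.coe_ne_top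

/-- An estimate for test functions extends to limits of test functions in `𝓗₂`. -/
theorem n2_le_of_test {C : ℝ≥0} {R : ℝ}
    (hT : ∀ φ : E3 → F, Test φ →
      G.n2 φ (fun i => G.cov i φ) (fun i j => G.cov i (G.cov j φ))
        ≤ C * (G.n1 (T.cl φ) (fun i => G.cov i (T.cl φ)) + nsqOn R φ))
    (hc : ∀ i, G.IsWeak i c (g i)) (hg : ∀ i j, G.IsWeak i (g j) (h i j)) (H : G.Approx2 c g h) :
    G.n2 c g h ≤ 4 * C * (G.n1 (T.op c g) (T.opGrad c g h) + nsqOn R c) := by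
  obtain ⟨φ, hφ, hn⟩ := H
  have mc : AEStronglyMeasurable c volume := (hc 0).1.aestronglyMeasurable
  have mg := fun i => (hc i).2.1.aestronglyMeasurable
  have mh := fun i j => (hg i j).2.1.aestronglyMeasurable
  have mφ := fun n => (hφ n).continuous.aestronglyMeasurable (μ := volume)
  have mcφ := fun n i => ((hφ n).cov (G := G) i).continuous.aestronglyMeasurable (μ := volume)
  have mccφ := fun n i j =>
    (((hφ n).cov (G := G) j).cov (G := G) i).continuous.aestronglyMeasurable (μ := volume)
  have hop := T.null1_op hn fun n => mc.sub (mφ n)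
  have b1 : ∀ n, G.n2 c g h ≤ 2 * G.n2 (fun x => c x - φ n x) (fun i x => g i x - G.cov i (φ n) x)
        (fun i j x => h i j x - G.cov i (G.cov j (φ n)) x)
      + 2 * G.n2 (φ n) (fun i => G.cov i (φ n)) (fun i j => G.cov i (G.cov j (φ n))) := fun n => by
    have := GaugeData.n2_sub_le (G := G) (c := fun x => c x - φ n x) (c' := fun x => -φ n x)
      (g := fun i x => g i x - G.cov i (φ n) x) (g' := fun i x => -G.cov i (φ n) x)
      (h := fun i j x => h i j x - G.cov i (G.cov j (φ n)) x)
      (h' := fun i j x => -G.cov i (G.cov j (φ n)) x)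
      (mc.sub (mφ n)) (fun i => (mg i).sub (mcφ n i)) (fun i j => (mh i j).sub (mccφ n i j))
    simpa [GaugeData.n2, GaugeData.n1, nsq_neg] using this
  have b2 : ∀ n, G.n1 (T.cl (φ n)) (fun i => G.cov i (T.cl (φ n)))
      ≤ 2 * G.n1 (T.op c g) (T.opGrad c g h)
      + 2 * G.n1 (T.op (fun x => c x - φ n x) (fun i x => g i x - G.cov i (φ n) x))
        (T.opGrad (fun x => c x - φ n x) (fun i x => g i x - G.cov i (φ n) x)
          (fun i j x => h i j x - G.cov i (G.cov j (φ n)) x)) := fun n => by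
    refine le_trans (le_of_eq ?_) (GaugeData.n1_sub_le (T.aestronglyMeasurable_op mc mg)
      (T.aestronglyMeasurable_opGrad mc mg mh))
    congr 1
    · funext x
      rw [op_sub, ← T.op_cov]
      abel
    · funext i x
      rw [opGrad_sub, ← T.opGrad_cov (hφ n).1]
      abel
  have b3 : ∀ n, nsqOn R (φ n) ≤ 2 * nsqOn R c + 2 * nsqOn R (fun x => c x - φ n x) := fun n => by
    refine le_trans (le_of_eq ?_) (nsqOn_sub_le R mc)
    congr 1
    funext x
    abel
  refine le_of_le_add_null (δ := fun n =>
    2 * G.n2 (fun x => c x - φ n x) (fun i x => g i x - G.cov i (φ n) x)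
        (fun i j x => h i j x - G.cov i (G.cov j (φ n)) x)
    + (4 * C * G.n1 (T.op (fun x => c x - φ n x) (fun i x => g i x - G.cov i (φ n) x))
        (T.opGrad (fun x => c x - φ n x) (fun i x => g i x - G.cov i (φ n) x)
          (fun i j x => h i j x - G.cov i (G.cov j (φ n)) x))
      + 4 * C * nsqOn R (fun x => c x - φ n x))) (fun n => ?_) ?_
  · calc G.n2 c g h ≤ _ := b1 n
      _ ≤ 2 * G.n2 (fun x => c x - φ n x) (fun i x => g i x - G.cov i (φ n) x)
          (fun i j x => h i j x - G.cov i (G.cov j (φ n)) x) + 2 * (C *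
        ((2 * G.n1 (T.op c g) (T.opGrad c g h)
          + 2 * G.n1 (T.op (fun x => c x - φ n x) (fun i x => g i x - G.cov i (φ n) x))
        (T.opGrad (fun x => c x - φ n x) (fun i x => g i x - G.cov i (φ n) x)
          (fun i j x => h i j x - G.cov i (G.cov j (φ n)) x)))
        + (2 * nsqOn R c + 2 * nsqOn R (fun x => c x - φ n x)))) := by
          gcongr
          exact (hT _ (hφ n)).trans (by gcongr; exacts [b2 n, b3 n])
      _ = _ := by ring
  · have hC : (4 * C : ℝ≥0∞) ≠ ⊤ := ENNReal.mul_ne_top ENNReal.ofNat_ne_top ENNReal.coe_ne_top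
    exact null_add (null_const_mul hn.tendsto ENNReal.ofNat_ne_top) (null_add
      (null_const_mul hop.tendsto hC) (null_const_mul (hn.loc R) hC))

theorem approx1_op (hc : ∀ i, G.IsWeak i c (g i)) (H : G.Approx2 c g h) :
    G.Approx1 (T.op c g) (T.opGrad c g h) := by
  obtain ⟨φ, hφ, hn⟩ := H
  refine ⟨fun n => T.cl (φ n), fun n => (hφ n).cl T, ?_⟩
  have h1 := T.null1_op hn
    fun n => (hc 0).1.aestronglyMeasurable.sub (hφ n).continuous.aestronglyMeasurable
  have e1 : (fun (n : ℕ) (x : E3) => T.op c g x - T.cl (φ n) x) = fun n =>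
      T.op (fun x => c x - φ n x) (fun i x => g i x - G.cov i (φ n) x) := by
    funext n x
    rw [op_sub, ← T.op_cov]
  have e2 : (fun (n : ℕ) (i : Fin 3) (x : E3) => T.opGrad c g h i x - G.cov i (T.cl (φ n)) x)
      = fun n => T.opGrad (fun x => c x - φ n x) (fun i x => g i x - G.cov i (φ n) x)
          (fun i j x => h i j x - G.cov i (G.cov j (φ n)) x) := by
    funext n i x
    rw [opGrad_sub, ← T.opGrad_cov (hφ n).1]
  rw [e1, e2]
  exact h1

theorem test_n1_le_of_s (hs : T.s = -1) (hφ : Test φ) :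
    G.n1 φ (fun i => G.cov i φ) ≤ 5 * nsq (T.cl φ) := by
  rw [hφ.n1_eq, (hφ.cl T).nsq_eq]
  refine (ENNReal.ofReal_le_ofReal (T.N1_le_of_s hs hφ)).trans (le_of_eq ?_)
  rw [ENNReal.ofReal_mul (by norm_num), ENNReal.ofReal_ofNat]

theorem exists_test_n1_le : ∃ R, 0 < R ∧ ∃ C : ℝ≥0, ∀ φ : E3 → F, Test φ →
    G.n1 φ (fun i => G.cov i φ) ≤ C * (nsq (T.cl φ) + nsqOn R φ) := by
  obtain ⟨R, hR, C, hC, h⟩ := T.coercive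
  refine ⟨R, hR, C.toNNReal, fun φ hφ => ?_⟩
  rw [hφ.n1_eq, (hφ.cl T).nsq_eq, hφ.nsqOn_eq]
  refine (ENNReal.ofReal_le_ofReal (h φ hφ)).trans (le_of_eq ?_)
  rw [ENNReal.ofReal_mul hC.le,
    ENNReal.ofReal_add (integral_nonneg fun x => by positivity) (locN_nonneg R φ)]
  rfl

theorem exists_test_n2_le : ∃ R, 0 < R ∧ ∃ C : ℝ≥0, ∀ φ : E3 → F, Test φ →
    G.n2 φ (fun i => G.cov i φ) (fun i j => G.cov i (G.cov j φ))
      ≤ C * (G.n1 (T.cl φ) (fun i => G.cov i (T.cl φ)) + nsqOn R φ) := by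
  obtain ⟨R, hR, C, hC, h⟩ := T.elliptic
  refine ⟨R, hR, C.toNNReal, fun φ hφ => ?_⟩
  rw [hφ.n2_eq, (hφ.cl T).n1_eq, hφ.nsqOn_eq]
  refine (ENNReal.ofReal_le_ofReal (h φ hφ)).trans (le_of_eq ?_)
  rw [ENNReal.ofReal_mul hC.le, ENNReal.ofReal_add (N1_nonneg _) (locN_nonneg R φ)]
  rfl

end DiracCoeff

end Generic

/-! ### Mollification -/

section Generic

variable {F : Type*} [NormedAddCommGroup F] [InnerProductSpace ℝ F] [FiniteDimensional ℝ F]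
  {u v g : E3 → F} {η : E3 → ℝ}

/-- The convolution of `η` and `u`. -/
noncomputable def mol (η : E3 → ℝ) (u : E3 → F) (x : E3) : F := ∫ y, η (x - y) • u y

theorem mol_eq_convolution (η : E3 → ℝ) (u : E3 → F) :
    mol η u = convolution η u (ContinuousLinearMap.lsmul ℝ ℝ) volume := by
  funext x
  rw [convolution_eq_swap]
  rfl

theorem contDiff_mol (hη : ContDiff ℝ ∞ η) (hs : HasCompactSupport η)
    (hu : LocallyIntegrable u volume) : ContDiff ℝ ∞ (mol η u) := by
  rw [mol_eq_convolution]
  exact hs.contDiff_convolution_left _ hη hu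

theorem integrable_mol (hη : Continuous η) (hs : HasCompactSupport η)
    (hu : LocallyIntegrable u volume) (x : E3) : Integrable fun y => η (x - y) • u y := by
  have h := (hs.convolutionExists_left (ContinuousLinearMap.lsmul ℝ ℝ) hη hu x).integrable_swap
  simpa using h

theorem mol_eq_zero {r ε : ℝ} (hη : ∀ x, ε ≤ ‖x‖ → η x = 0) (hu : ∀ x, r ≤ ‖x‖ → u x = 0) (x : E3)
    (hx : r + ε ≤ ‖x‖) : mol η u x = 0 := by
  rw [mol, integral_eq_zero_of_ae]
  refine ae_of_all _ fun y => ?_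
  rcases le_or_gt r ‖y‖ with h | h
  · simp [hu y h]
  · have : ε ≤ ‖x - y‖ := by
      have := norm_sub_norm_le x y
      linarith
    simp [hη _ this]

theorem test_of_eq_zero {r : ℝ} (hu : ContDiff ℝ ∞ u) (h0 : ∀ x, r ≤ ‖x‖ → u x = 0) : Test u :=
  ⟨hu, HasCompactSupport.of_support_subset_isCompact (isCompact_closedBall (0 : E3) r) fun x hx => by
    rw [mem_closedBall_zero_iff]
    by_contra h
    exact hx (h0 x (not_le.mp h).le)⟩

theorem mol_map (hη : Continuous η) (hs : HasCompactSupport η) (hu : LocallyIntegrable u volume)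
    (L : F →L[ℝ] F) (x : E3) : mol η (fun y => L (u y)) x = L (mol η u x) := by
  rw [mol, mol, ← L.integral_comp_comm (integrable_mol hη hs hu x)]
  simp only [map_smul]

theorem mol_sum (hη : Continuous η) (hs : HasCompactSupport η) {U : Fin 3 → E3 → F}
    (hu : ∀ j, LocallyIntegrable (U j) volume) (x : E3) :
    mol η (fun y => ∑ j, U j y) x = ∑ j, mol η (U j) x := by
  simp only [mol, Finset.smul_sum]
  exact integral_finsetSum _ fun j _ => integrable_mol hη hs (hu j) x

/-- Mollification commutes with weak derivatives. -/
theorem fderiv_mol (hη : ContDiff ℝ ∞ η) (hs : HasCompactSupport η) {i : Fin 3}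
    (h : (GaugeData.flat F).IsWeak i u g) (x : E3) :
    fderiv ℝ (mol η u) x (e i) = mol η g x := by
  have h1 := hs.hasFDerivAt_convolution_left (ContinuousLinearMap.lsmul ℝ ℝ)
    (hη.of_le (by simp)) h.1 x
  rw [← mol_eq_convolution] at h1
  have hη' : Continuous (fderiv ℝ η) := hη.continuous_fderiv (by simp)
  have h2 := ((hs.fderiv ℝ).convolutionExists_left
    ((ContinuousLinearMap.lsmul ℝ ℝ (E := F)).precompL E3) hη' h.1 x).integrable_swap
  rw [h1.fderiv, convolution_eq_swap, ContinuousLinearMap.integral_apply h2]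
  simp only [ContinuousLinearMap.precompL_apply, ContinuousLinearMap.lsmul_apply]
  have i1 : Integrable fun t => fderiv ℝ η (x - t) (e i) • u t := by
    have := h2.apply_continuousLinearMap (e i)
    simpa only [ContinuousLinearMap.precompL_apply, ContinuousLinearMap.lsmul_apply] using this
  refine ext_inner_right ℝ fun v => ?_
  -- The reflected kernel times a fixed vector is itself a test function. The sign from the
  -- reflection cancels the one in the definition of weak derivative.
  have hφ : Test (fun y => η (x - y) • v) := by
    have e1 : HasCompactSupport fun y => η (x - y) :=
      hs.comp_homeomorph (Homeomorph.subLeft x)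
    refine ⟨(hη.comp (contDiff_const.sub contDiff_id)).smul contDiff_const,
      e1.mono' fun y hy => subset_closure fun h0 => hy ?_⟩
    simp only at h0
    simp [h0]
  have h3 := h.2.2 _ hφ
  have h4 : ∀ y, (GaugeData.flat F).cov i (fun y => η (x - y) • v) y
      = -(fderiv ℝ η (x - y) (e i) • v) := by
    intro y
    rw [GaugeData.flat_cov]
    have h5 : HasFDerivAt (fun y => η (x - y))
        ((fderiv ℝ η (x - y)).comp (-ContinuousLinearMap.id ℝ E3)) y :=
      (hη.differentiable (by simp) (x - y)).hasFDerivAt.comp y ((hasFDerivAt_id y).const_sub x)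
    rw [(h5.smul_const v).fderiv]
    simp
  simp only [h4, inner_neg_right, inner_smul_right, integral_neg, neg_inj] at h3
  rw [real_inner_comm, ← integral_inner i1, mol, real_inner_comm v,
    ← integral_inner (integrable_mol hη.continuous hs h.2.1 x)]
  simp only [real_inner_comm _ v, inner_smul_left, conj_trivial]
  exact h3

theorem sq_lintegral_le {ν : Measure E3} [IsProbabilityMeasure ν] (hu : AEStronglyMeasurable u ν) :
    (∫⁻ y, ‖u y‖ₑ ∂ν) ^ 2 ≤ ∫⁻ y, ‖u y‖ₑ ^ 2 ∂ν := by
  have h := eLpNorm_le_eLpNorm_of_exponent_le (p := 1) (q := 2) (by norm_num) hu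
  rw [eLpNorm_one_eq_lintegral_enorm,
    eLpNorm_eq_lintegral_rpow_enorm_toReal (by norm_num) (by norm_num)] at h
  simp only [ENNReal.toReal_ofNat, ENNReal.rpow_ofNat, one_div] at h
  refine (pow_le_pow_left₀ zero_le h 2).trans (le_of_eq ?_)
  rw [← ENNReal.rpow_ofNat _ 2, ← ENNReal.rpow_mul]
  norm_num

/-- Translations are continuous in `L²`. -/
theorem tendsto_nsq_translate (hu : MemLp u 2 volume) :
    Tendsto (fun y => nsq (fun x => u x - u (x - y))) (𝓝 0) (𝓝 0) := by
  let τ : C(E3, C(E3, E3)) := ContinuousMap.curry ⟨fun p : E3 × E3 => p.2 - p.1, by fun_prop⟩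
  have hτ : ∀ y, MeasurePreserving (τ y) volume volume := fun y =>
    measurePreserving_sub_right volume y
  have h1 : Continuous fun y => Lp.compMeasurePreserving (τ y) (hτ y) (hu.toLp u) :=
    continuous_const.compMeasurePreservingLp τ.continuous hτ (by norm_num)
  have h2 : ∀ y, edist (hu.toLp u) (Lp.compMeasurePreserving (τ y) (hτ y) (hu.toLp u))
      = eLpNorm (fun x => u x - u (x - y)) 2 volume := by
    intro y
    rw [Lp.toLp_compMeasurePreserving, Lp.edist_toLp_toLp]
    rfl
  have h3 := (continuous_const (y := hu.toLp u)).edist h1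
  simp only [h2] at h3
  simpa [nsq_eq_eLpNorm, Function.comp_def] using ENNReal.Tendsto.pow (n := 2) (h3.tendsto 0)

/-- `u - η ∗ u` is the mean of `u - u(· - y)` over the probability measure `η(y) dy`, so Jensen's
inequality and Tonelli's theorem apply. Strong measurability provides the joint measurability used
in the interchange. -/
theorem nsq_sub_mol_le_of_stronglyMeasurable (hη : Continuous η) (hs : HasCompactSupport η)
    (h0 : ∀ x, 0 ≤ η x) (h1 : ∫ x, η x = 1) (hm : StronglyMeasurable u) (hu : MemLp u 2 volume) {ε : ℝ}
    (hε : ∀ x, ε ≤ ‖x‖ → η x = 0) {δ : ℝ≥0∞}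
    (hδ : ∀ y, ‖y‖ < ε → nsq (fun x => u x - u (x - y)) ≤ δ) :
    nsq (fun x => u x - mol η u x) ≤ δ := by
  have hul := hu.locallyIntegrable (by norm_num)
  have hint : Integrable η := hη.integrable_of_hasCompactSupport hs
  have hmass : ∫⁻ y, ENNReal.ofReal (η y) = 1 := by
    rw [← ofReal_integral_eq_lintegral_ofReal hint (ae_of_all _ h0), h1, ENNReal.ofReal_one]
  have hmη : Measurable fun y => ENNReal.ofReal (η y) := hη.measurable.ennreal_ofReal
  set ν : Measure E3 := volume.withDensity fun y => ENNReal.ofReal (η y) with hν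
  have : IsProbabilityMeasure ν := ⟨by simp [hν, hmass]⟩
  have key : ∀ x, ‖u x - mol η u x‖ₑ ^ 2 ≤ ∫⁻ y, ‖u x - u (x - y)‖ₑ ^ 2 ∂ν := by
    intro x
    have hmx : StronglyMeasurable fun y => u x - u (x - y) :=
      stronglyMeasurable_const.sub (hm.comp_measurable (measurable_const.sub measurable_id))
    have e1 : mol η u x = ∫ y, η y • u (x - y) := by
      rw [mol_eq_convolution, convolution_lsmul]
    have i1 : Integrable fun y => η y • u (x - y) := by
      have := (hs.convolutionExists_left (ContinuousLinearMap.lsmul ℝ ℝ) hη hul x).integrable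
      simpa using this
    have e2 : u x - mol η u x = ∫ y, η y • (u x - u (x - y)) := by
      simp only [smul_sub]
      rw [integral_sub (hint.smul_const _) i1, integral_smul_const, h1, one_smul, e1]
    refine le_trans (pow_le_pow_left₀ zero_le ?_ 2) (sq_lintegral_le hmx.aestronglyMeasurable)
    rw [e2, lintegral_withDensity_eq_lintegral_mul _ hmη hmx.enorm]
    refine (enorm_integral_le_lintegral_enorm _).trans (lintegral_mono fun y => le_of_eq ?_)
    rw [enorm_smul, Pi.mul_apply, Real.enorm_of_nonneg (h0 y)]
  have hm2 : Measurable fun p : E3 × E3 => ‖u p.1 - u (p.1 - p.2)‖ₑ ^ 2 :=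
    ((hm.comp_measurable measurable_fst).sub
      (hm.comp_measurable (measurable_fst.sub measurable_snd))).enorm.pow_const 2
  calc nsq (fun x => u x - mol η u x) ≤ ∫⁻ x, ∫⁻ y, ‖u x - u (x - y)‖ₑ ^ 2 ∂ν :=
        lintegral_mono key
    _ = ∫⁻ y, (∫⁻ x, ‖u x - u (x - y)‖ₑ ^ 2) ∂ν :=
        lintegral_lintegral_swap hm2.aemeasurable
    _ = ∫⁻ y, ENNReal.ofReal (η y) * nsq (fun x => u x - u (x - y)) := by
        rw [lintegral_withDensity_eq_lintegral_mul _ hmη]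
        · rfl
        · exact hm2.lintegral_prod_left'
    _ ≤ ∫⁻ y, ENNReal.ofReal (η y) * δ := by
        refine lintegral_mono fun y => ?_
        rcases lt_or_ge ‖y‖ ε with hy | hy
        · exact mul_le_mul_right (hδ y hy) _
        · simp [hε y hy]
    _ = δ := by rw [lintegral_mul_const _ hmη, hmass, one_mul]

/-- A sequence of mollifiers. -/
theorem exists_mollifier : ∃ η : ℕ → E3 → ℝ, (∀ n, ContDiff ℝ ∞ (η n)) ∧
    (∀ n, HasCompactSupport (η n)) ∧ (∀ n x, 1 ≤ ‖x‖ → η n x = 0) ∧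
    ∀ u : E3 → F, MemLp u 2 volume → L2Null (fun n x => u x - mol (η n) u x) := by
  let b : ℕ → ContDiffBump (0 : E3) := fun n =>
    ⟨((n : ℝ) + 1)⁻¹ / 2, ((n : ℝ) + 1)⁻¹, by positivity, half_lt_self (by positivity)⟩
  have hb : ∀ (n : ℕ) x, ((n : ℝ) + 1)⁻¹ ≤ ‖x‖ → (b n).normed volume x = 0 := by
    intro n x hx
    rw [← Function.notMem_support, (b n).support_normed_eq, mem_ball_zero_iff, not_lt]
    exact hx
  refine ⟨fun n => (b n).normed volume, fun n => (b n).contDiff_normed,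
    fun n => (b n).hasCompactSupport_normed, fun n x hx => hb n x (le_trans ?_ hx), fun u hu => ?_⟩
  · exact inv_le_one_of_one_le₀ (by linarith [(Nat.cast_nonneg n : (0 : ℝ) ≤ n)])
  have hul := hu.locallyIntegrable (by norm_num)
  refine ⟨fun n => hu.1.sub (contDiff_mol (b n).contDiff_normed (b n).hasCompactSupport_normed
    hul).continuous.aestronglyMeasurable, ?_⟩
  -- Neither mollification nor the `L²`-norm sees null sets, so a strongly measurable representative
  -- may be used.
  set u' := hu.1.mk u with hu'
  have hae : u =ᵐ[volume] u' := hu.1.ae_eq_mk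
  have hmol : ∀ n, mol ((b n).normed volume) u = mol ((b n).normed volume) u' := by
    intro n
    funext x
    refine integral_congr_ae ?_
    filter_upwards [hae] with y hy
    rw [hy]
  have hmem : MemLp u' 2 volume := (memLp_congr_ae hae).mp hu
  have hn : ∀ n, nsq (fun x => u x - mol ((b n).normed volume) u x)
      = nsq (fun x => u' x - mol ((b n).normed volume) u' x) := by
    intro n
    refine nsq_congr ?_
    filter_upwards [hae] with x hx
    simp only [hx, hmol]
  simp only [hn]
  rw [ENNReal.tendsto_nhds_zero]
  intro δ hδ
  have h1 := (ENNReal.tendsto_nhds_zero.mp (tendsto_nsq_translate hmem)) δ hδ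
  obtain ⟨ε, hε, hball⟩ := Metric.eventually_nhds_iff.mp h1
  have h2 : Tendsto (fun n : ℕ => ((n : ℝ) + 1)⁻¹) atTop (𝓝 0) := by
    simpa [one_div] using tendsto_one_div_add_atTop_nhds_zero_nat (𝕜 := ℝ)
  filter_upwards [h2.eventually (gt_mem_nhds hε)] with n hn
  refine nsq_sub_mol_le_of_stronglyMeasurable (b n).continuous_normed (b n).hasCompactSupport_normed
    (b n).nonneg_normed (b n).integral_normed hu.1.stronglyMeasurable_mk hmem (hb n) fun y hy => ?_
  exact hball (by simpa using hy.trans hn)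

end Generic

/-! ### Simultaneous approximation by test functions: compact supports -/

section Generic

variable {F : Type*} [NormedAddCommGroup F] [InnerProductSpace ℝ F] [FiniteDimensional ℝ F]
  {G : GaugeData F} {u v : E3 → F} {c : E3 → F} {g k : Fin 3 → E3 → F} {i : Fin 3}

theorem exists_clm_bound {B : E3 → F →L[ℝ] F} (hB : Continuous B) (r : ℝ) :
    ∃ M, 0 ≤ M ∧ ∀ x, ‖x‖ ≤ r → ∀ v, ‖B x v‖ ≤ M * ‖v‖ := by
  obtain ⟨C, hC⟩ := (isCompact_closedBall (0 : E3) r).exists_bound_of_continuousOn hB.continuousOn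
  refine ⟨|C|, abs_nonneg _, fun x hx v => ((B x).le_opNorm v).trans ?_⟩
  gcongr
  exact (hC x (by simpa using hx)).trans (le_abs_self C)

/-- Square integrable functions with compact support. -/
def L2c (u : E3 → F) : Prop := MemLp u 2 volume ∧ ∃ r : ℝ, ∀ x, r ≤ ‖x‖ → u x = 0

/-- Sequences which tend to zero in `L²` and have supports in a fixed ball. -/
def NullC (U : ℕ → E3 → F) : Prop := L2Null U ∧ ∃ r : ℝ, ∀ n x, r ≤ ‖x‖ → U n x = 0

namespace L2c

theorem add (h : L2c u) (h' : L2c v) : L2c (fun x => u x + v x) := by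
  obtain ⟨r, hr⟩ := h.2
  obtain ⟨r', hr'⟩ := h'.2
  refine ⟨h.1.add h'.1, max r r', fun x hx => ?_⟩
  simp only [hr x ((le_max_left _ _).trans hx), hr' x ((le_max_right _ _).trans hx), add_zero]

/-- Coefficients such as the connection form are only known to be continuous, hence bounded on the
support but perhaps not globally. This is why compact supports are treated first. -/
theorem clm (h : L2c u) {B : E3 → F →L[ℝ] F} (hB : Continuous B) : L2c (fun x => B x (u x)) := by
  obtain ⟨r, hr⟩ := h.2
  obtain ⟨M, hM, hBM⟩ := exists_clm_bound hB r
  refine ⟨h.1.of_le_mul (c := M) (aestronglyMeasurable_clm hB h.1.1) (ae_of_all _ fun x => ?_), r,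
    fun x hx => by simp only [hr x hx, map_zero]⟩
  rcases le_total ‖x‖ r with hx | hx
  · exact hBM x hx _
  · simp [hr x hx]

theorem map (h : L2c u) (L : F →L[ℝ] F) : L2c (fun x => L (u x)) :=
  h.clm (B := fun _ => L) continuous_const

theorem neg (h : L2c u) : L2c (fun x => -u x) := by
  simpa using h.map (-ContinuousLinearMap.id ℝ F)

theorem sub (h : L2c u) (h' : L2c v) : L2c (fun x => u x - v x) := by
  simpa only [sub_eq_add_neg] using h.add h'.neg

theorem sum {U : Fin 3 → E3 → F} (h : ∀ j, L2c (U j)) : L2c (fun x => ∑ j, U j x) := by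
  simpa only [Fin.sum_univ_three] using ((h 0).add (h 1)).add (h 2)

end L2c

namespace NullC

variable {U V : ℕ → E3 → F}

theorem add (h : NullC U) (h' : NullC V) : NullC (fun n x => U n x + V n x) := by
  obtain ⟨r, hr⟩ := h.2
  obtain ⟨r', hr'⟩ := h'.2
  refine ⟨h.1.add h'.1, max r r', fun n x hx => ?_⟩
  simp only [hr n x ((le_max_left _ _).trans hx), hr' n x ((le_max_right _ _).trans hx), add_zero]

theorem clm (h : NullC U) {B : E3 → F →L[ℝ] F} (hB : Continuous B) :
    NullC (fun n x => B x (U n x)) := by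
  obtain ⟨r, hr⟩ := h.2
  obtain ⟨M, hM, hBM⟩ := exists_clm_bound hB r
  refine ⟨h.1.of_le (fun n => aestronglyMeasurable_clm hB (h.1.1 n)) (M := M) fun n x => ?_, r,
    fun n x hx => by simp only [hr n x hx, map_zero]⟩
  rcases le_total ‖x‖ r with hx | hx
  · exact hBM x hx _
  · simp [hr n x hx]

end NullC

theorem memLp_of_nsq (hu : AEStronglyMeasurable u volume) (h : nsq u ≠ ⊤) : MemLp u 2 volume := by
  refine ⟨hu, lt_top_iff_ne_top.mpr fun h' => h ?_⟩
  rw [nsq_eq_eLpNorm, h']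
  simp

theorem GaugeData.IsWeak.clm_skew (h : (flat F).IsWeak i c u) {B : E3 → F →L[ℝ] F}
    (hB : ContDiff ℝ ∞ B) (hs : ∀ x v w, inner ℝ (B x v) w = -inner ℝ v (B x w)) :
    (flat F).IsWeak i (fun x => B x (c x)) (fun x => fderiv ℝ B x (e i) (c x) + B x (u x)) := by
  have hB' := (contDiff_pderiv hB (e i)).continuous
  refine h.clm (Bt := fun x => -B x) (Bt' := fun x => -fderiv ℝ B x (e i)) hB.continuous hB'
    hB.neg hB'.neg (fun x v w => by simp [hs]) (fun x v w => by simp [skew_fderiv hB hs]) ?_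
  intro φ hφ x
  have h1 := ((hB.differentiable (by simp) x).hasFDerivAt.clm_apply
    (hφ.1.differentiable (by simp) x).hasFDerivAt).neg
  have h2 : (fun y => (-B y) (φ y)) = -fun y => B y (φ y) := by
    funext y; simp
  rw [flat_cov, flat_cov, h2, h1.fderiv]
  simp only [neg_apply, add_apply, ContinuousLinearMap.comp_apply,
    ContinuousLinearMap.flip_apply]
  abel

namespace DiracCoeff

variable (T : DiracCoeff G)

/-- The zeroth order part of the operator, relative to the trivial connection. -/
noncomputable def zeroth (x : E3) : F →L[ℝ] F :=
  ∑ j, (T.γ j).comp (G.a j x) + T.β.comp (G.P x)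

/-- The derivative of the zeroth order part. -/
noncomputable def zerothDeriv (i : Fin 3) (x : E3) : F →L[ℝ] F :=
  ∑ j, (T.γ j).comp (fderiv ℝ (G.a j) x (e i)) + T.β.comp (fderiv ℝ G.P x (e i))

theorem continuous_zeroth : Continuous T.zeroth :=
  (continuous_finsetSum _ fun j _ => continuous_const.clm_comp (G.smooth_a j).continuous).add
    (continuous_const.clm_comp G.smooth_P.continuous)

theorem continuous_zerothDeriv (i : Fin 3) : Continuous (T.zerothDeriv i) :=
  (continuous_finsetSum _ fun j _ =>
    continuous_const.clm_comp (contDiff_pderiv (G.smooth_a j) (e i)).continuous).add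
    (continuous_const.clm_comp (contDiff_pderiv G.smooth_P (e i)).continuous)

theorem zeroth_apply (x : E3) (v : F) :
    T.zeroth x v = ∑ j, T.γ j (G.a j x v) + T.β (G.P x v) := by
  simp [zeroth]

theorem isWeak_zeroth (h : (GaugeData.flat F).IsWeak i c u) :
    (GaugeData.flat F).IsWeak i (fun x => T.zeroth x (c x))
      (fun x => T.zerothDeriv i x (c x) + T.zeroth x (u x)) := by
  have hL : ∀ L : F →L[ℝ] F, ∀ x v,
      L ((GaugeData.flat F).a i x v) = (GaugeData.flat F).a i x (L v) := by
    intro L x v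
    simp [GaugeData.flat]
  have h1 := fun j => (h.clm_skew (G.smooth_a j) (G.skew_a j)).map (hL (T.γ j))
  have h2 := (h.clm_skew G.smooth_P G.skew_P).map (hL T.β)
  refine ((((h1 0).add (h1 1)).add (h1 2)).add h2).congr (ae_of_all _ fun x => ?_)
    (ae_of_all _ fun x => ?_)
  · simp [zeroth, Fin.sum_univ_three]
  · simp only [zeroth, zerothDeriv, Fin.sum_univ_three, add_apply, ContinuousLinearMap.comp_apply,
      map_add]
    abel

/-- A compactly supported section `c`, such that `c` and `T c` have finite `𝓗₁`-norm, can be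
approximated by test functions. -/
theorem exists_test_of_compact (hc : ∀ i, G.IsWeak i c (g i))
    (hk : ∀ i, G.IsWeak i (T.op c g) (k i)) (lc : L2c c) (lg : ∀ i, L2c (g i))
    (lk : ∀ i, L2c (k i)) :
    ∃ φ : ℕ → E3 → F, (∀ n, Test (φ n)) ∧
      G.Null1 (fun n x => c x - φ n x) (fun n i x => g i x - G.cov i (φ n) x) ∧
      G.Null1 (fun n x => T.op c g x - T.cl (φ n) x)
        (fun n i x => k i x - G.cov i (T.cl (φ n)) x) := by
  have ha := fun i => (G.smooth_a i).continuous
  have hP := G.smooth_P.continuous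
  set f := T.op c g with hf
  set d : Fin 3 → E3 → F := fun i x => g i x - G.a i x (c x) with hd
  have wd : ∀ i, (GaugeData.flat F).IsWeak i c (d i) := fun i =>
    GaugeData.isWeak_flat_iff.mpr (hc i)
  have ld : ∀ i, L2c (d i) := fun i => (lg i).sub (lc.clm (ha i))
  -- The principal part of `T c` in the trivialization. Second derivatives of `c` are not available,
  -- but `v` is weakly differentiable, being `T c` minus a term of order zero.
  set v : E3 → F := fun x => ∑ j, T.γ j (d j x) with hv
  have lv : L2c v := L2c.sum fun j => (ld j).map (T.γ j)
  have hfv : ∀ x, f x = v x + T.zeroth x (c x) := by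
    intro x
    simp only [hf, hv, op, hd, zeroth_apply, map_sub, Finset.sum_sub_distrib]
    abel
  have lf : L2c f := by
    have : f = fun x => v x + T.zeroth x (c x) := funext hfv
    rw [this]
    exact lv.add (lc.clm T.continuous_zeroth)
  set dv : Fin 3 → E3 → F := fun i x => (k i x - G.a i x (f x))
    - (T.zerothDeriv i x (c x) + T.zeroth x (d i x)) with hdv
  have ldv : ∀ i, L2c (dv i) := fun i => ((lk i).sub (lf.clm (ha i))).sub
    ((lc.clm (T.continuous_zerothDeriv i)).add ((ld i).clm T.continuous_zeroth))
  have wv : ∀ i, (GaugeData.flat F).IsWeak i v (dv i) := fun i =>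
    ((GaugeData.isWeak_flat_iff.mpr (hk i)).sub (T.isWeak_zeroth (wd i))).congr
      (ae_of_all _ fun x => by simp only [hfv]; abel) (ae_of_all _ fun x => rfl)
  obtain ⟨η, hη, hηs, hη1, hηn⟩ := exists_mollifier (F := F)
  have hloc : ∀ {w : E3 → F}, L2c w → LocallyIntegrable w volume := fun hw =>
    hw.1.locallyIntegrable (by norm_num)
  have hsm : ∀ {w : E3 → F}, L2c w → ∀ n, ContDiff ℝ ∞ (mol (η n) w) := fun hw n =>
    contDiff_mol (hη n) (hηs n) (hloc hw)
  have hnull : ∀ {w : E3 → F}, L2c w → NullC (fun n x => w x - mol (η n) w x) := by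
    intro w hw
    obtain ⟨r, hr⟩ := hw.2
    refine ⟨hηn w hw.1, r + 1, fun n x hx => ?_⟩
    simp only [hr x (by linarith), mol_eq_zero (hη1 n) hr x hx, sub_zero]
  set φ : ℕ → E3 → F := fun n => mol (η n) c with hφ
  have tφ : ∀ n, Test (φ n) := fun n => by
    obtain ⟨r, hr⟩ := lc.2
    exact test_of_eq_zero (hsm lc n) (mol_eq_zero (hη1 n) hr)
  have covφ : ∀ n i x, G.cov i (φ n) x = mol (η n) (d i) x + G.a i x (φ n x) := fun n i x => by
    rw [GaugeData.cov, hφ, fderiv_mol (hη n) (hηs n) (wd i)]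
  -- The symbols are constant, so mollifying the principal part of `T c` gives exactly the principal
  -- part of `T φ_n`; no commutator estimate is needed.
  have molv : ∀ n x, mol (η n) v x = ∑ j, T.γ j (mol (η n) (d j) x) := fun n x => by
    rw [hv, mol_sum (hη n).continuous (hηs n) fun j => hloc ((ld j).map (T.γ j))]
    exact Finset.sum_congr rfl fun j _ => mol_map (hη n).continuous (hηs n) (hloc (ld j)) _ x
  have nw := hnull lc
  have nd := fun i => hnull (ld i)
  have nz := hnull lv
  have ndz := fun i => hnull (ldv i)
  have hq : ∀ n x, f x - T.cl (φ n) x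
      = (v x - mol (η n) v x) + T.zeroth x (c x - φ n x) := fun n x => by
    rw [hfv, molv, cl]
    simp only [covφ, map_add, map_sub, Finset.sum_add_distrib, zeroth_apply]
    abel
  have nq : NullC (fun n x => f x - T.cl (φ n) x) := by
    simp only [hq]
    exact nz.add (nw.clm T.continuous_zeroth)
  have clw : Continuous fun x => (rho x)⁻¹ • ContinuousLinearMap.id ℝ F :=
    continuous_rho_inv.smul continuous_const
  refine ⟨φ, tφ, ⟨fun i => ?_, (nw.clm clw).1, (nw.clm hP).1⟩, ⟨fun i => ?_, (nq.clm clw).1,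
    (nq.clm hP).1⟩⟩
  · have h1 := ((nd i).add (nw.clm (ha i))).1
    refine h1.congr fun n => ae_of_all _ fun x => ?_
    simp only [covφ, hd, map_sub]
    abel
  · have h1 := ((((ndz i).add ((nw.clm (T.continuous_zerothDeriv i)).add
      ((nd i).clm T.continuous_zeroth))).add (nq.clm (ha i)))).1
    refine h1.congr fun n => ?_
    have flatsm : ∀ {w dw : E3 → F}, L2c w → (GaugeData.flat F).IsWeak i w dw →
        (GaugeData.flat F).IsWeak i (fun x => w x - mol (η n) w x)
          (fun x => dw x - mol (η n) dw x) := fun hw hdw =>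
      hdw.sub ((GaugeData.isWeak_cov (hsm hw n) i).congr (ae_of_all _ fun x => rfl)
        (ae_of_all _ fun x => by rw [GaugeData.flat_cov, fderiv_mol (hη n) (hηs n) hdw]))
    -- The weak derivative of `T c - T φ_n` is computed a second time, through its splitting into
    -- principal and zeroth order parts, where each piece visibly tends to zero. Uniqueness
    -- identifies it with the required one.
    have w1 := (flatsm lv (wv i)).add (T.isWeak_zeroth (flatsm lc (wd i)))
    have w2 : G.IsWeak i (fun x => f x - T.cl (φ n) x) _ :=
      GaugeData.isWeak_flat_iff.mp (w1.congr (ae_of_all _ fun x => (hq n x).symm)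
        (ae_of_all _ fun x => (add_sub_cancel_right _ (G.a i x (f x - T.cl (φ n) x))).symm))
    have w3 := (hk i).sub (GaugeData.isWeak_cov (T.contDiff_cl (tφ n).1) i)
    exact w2.unique w3

end DiracCoeff

end Generic

/-! ### Simultaneous approximation by test functions: cutoff -/

/-- A sequence of cutoff functions. -/
theorem exists_cutoff_seq : ∃ (χ : ℕ → E3 → ℝ) (M : ℝ), 0 ≤ M ∧ (∀ n, ContDiff ℝ ∞ (χ n)) ∧
    (∀ n, HasCompactSupport (χ n)) ∧ (∀ (n : ℕ) x, ‖x‖ ≤ n → χ n x = 1) ∧ (∀ n x, |1 - χ n x| ≤ M) ∧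
    (∀ (n : ℕ) j x, ‖x‖ ≤ n → fderiv ℝ (χ n) x (e j) = 0) ∧
    (∀ n j x, |fderiv ℝ (χ n) x (e j)| ≤ M * (rho x)⁻¹) ∧
    (∀ (n : ℕ) i j x, ‖x‖ ≤ n → fderiv ℝ (fun y => fderiv ℝ (χ n) y (e j)) x (e i) = 0) ∧
    (∀ n i j x, |fderiv ℝ (fun y => fderiv ℝ (χ n) y (e j)) x (e i)| ≤ M * (rho x)⁻¹) := by
  let b : ContDiffBump (0 : E3) := ⟨1, 2, one_pos, one_lt_two⟩
  have hb : ContDiff ℝ ∞ b := b.contDiff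
  have hpos : ∀ n : ℕ, (0 : ℝ) < (n : ℝ) + 1 := fun n => by positivity
  have hscale : ∀ (ψ : E3 → ℝ), ContDiff ℝ ∞ ψ → ∀ (t : ℝ) (v x : E3),
      fderiv ℝ (fun y => ψ (t • y)) x v = t * fderiv ℝ ψ (t • x) v := by
    intro ψ hψ t v x
    have h1 : HasFDerivAt (fun y => ψ (t • y))
        ((fderiv ℝ ψ (t • x)).comp (t • ContinuousLinearMap.id ℝ E3)) x :=
      (hψ.differentiable (by simp) (t • x)).hasFDerivAt.comp x ((hasFDerivAt_id x).const_smul t)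
    rw [h1.fderiv]
    simp
  have hbound : ∀ ψ : E3 → ℝ, Continuous ψ → HasCompactSupport ψ →
      ∃ M, 0 ≤ M ∧ ∀ (n : ℕ) x, |((n : ℝ) + 1)⁻¹ * ψ (((n : ℝ) + 1)⁻¹ • x)| ≤ M * (rho x)⁻¹ := by
    intro ψ hψ hs
    -- With `y = x / (n + 1)` one has `ρ(x) / (n + 1) ≤ 1 + ‖y‖`, so a bound for `(1 + ‖y‖) ψ(y)`
    -- gives decay `ρ⁻¹` uniformly in `n`.
    have h1 : HasCompactSupport fun y => (1 + ‖y‖) * ψ y := hs.mul_left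
    obtain ⟨M, hM⟩ := h1.exists_bound_of_continuous (by fun_prop)
    refine ⟨M, (norm_nonneg _).trans (hM 0), fun n x => ?_⟩
    have hn := hpos n
    have h2 := hM (((n : ℝ) + 1)⁻¹ • x)
    have hr := rho_pos x
    rw [← div_eq_mul_inv, le_div_iff₀ hr]
    refine le_trans ?_ h2
    rw [Real.norm_eq_abs, abs_mul, abs_mul, abs_of_pos (inv_pos.mpr hn), norm_smul,
      Real.norm_of_nonneg (inv_pos.mpr hn).le, 
      abs_of_nonneg (a := 1 + ((n : ℝ) + 1)⁻¹ * ‖x‖) (by positivity)]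
    have h3 : ((n : ℝ) + 1)⁻¹ * rho x ≤ 1 + ((n : ℝ) + 1)⁻¹ * ‖x‖ := by
      have h4 : ((n : ℝ) + 1)⁻¹ ≤ 1 :=
        inv_le_one_of_one_le₀ (by linarith [(Nat.cast_nonneg n : (0 : ℝ) ≤ n)])
      have h5 := mul_le_mul_of_nonneg_left (rho_le x) (inv_pos.mpr hn).le
      linarith
    calc ((n : ℝ) + 1)⁻¹ * |ψ (((n : ℝ) + 1)⁻¹ • x)| * rho x
        = ((n : ℝ) + 1)⁻¹ * rho x * |ψ (((n : ℝ) + 1)⁻¹ • x)| := by ring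
      _ ≤ _ := by gcongr
  have hs1 : ∀ j, HasCompactSupport fun y => fderiv ℝ b y (e j) := fun j =>
    b.hasCompactSupport.fderiv_apply ℝ (e j)
  have hc1 : ∀ j, ContDiff ℝ ∞ fun y => fderiv ℝ b y (e j) := fun j => contDiff_pderiv hb (e j)
  have hs2 : ∀ i j, HasCompactSupport fun y => fderiv ℝ (fun z => fderiv ℝ b z (e j)) y (e i) :=
    fun i j => (hs1 j).fderiv_apply ℝ (e i)
  have hc2 : ∀ i j, ContDiff ℝ ∞ fun y => fderiv ℝ (fun z => fderiv ℝ b z (e j)) y (e i) :=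
    fun i j => contDiff_pderiv (hc1 j) (e i)
  choose M1 hM1 hb1 using fun j => hbound _ (hc1 j).continuous (hs1 j)
  choose M2 hM2 hb2 using fun i j => hbound _ (hc2 i j).continuous (hs2 i j)
  set M := 1 + (∑ j, M1 j + ∑ i, ∑ j, M2 i j) with hMdef
  have p1 : 0 ≤ ∑ j, M1 j := Finset.sum_nonneg fun j _ => hM1 j
  have p2 : 0 ≤ ∑ i, ∑ j, M2 i j := Finset.sum_nonneg fun i _ => Finset.sum_nonneg fun j _ => hM2 i j
  have l1 : ∀ j, M1 j ≤ M := fun j => by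
    have := Finset.single_le_sum (f := M1) (fun j _ => hM1 j) (Finset.mem_univ j)
    linarith
  have l2 : ∀ i j, M2 i j ≤ M := fun i j => by
    have h1 := Finset.single_le_sum (f := M2 i) (fun j _ => hM2 i j) (Finset.mem_univ j)
    have h2 := Finset.single_le_sum (f := fun i => ∑ j, M2 i j)
      (fun i _ => Finset.sum_nonneg fun j _ => hM2 i j) (Finset.mem_univ i)
    linarith
  have d1 : ∀ (n : ℕ) j x, fderiv ℝ (fun y => b (((n : ℝ) + 1)⁻¹ • y)) x (e j)
      = ((n : ℝ) + 1)⁻¹ * fderiv ℝ b (((n : ℝ) + 1)⁻¹ • x) (e j) := fun n j x => hscale b hb _ _ x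
  have d2 : ∀ (n : ℕ) i j x,
      fderiv ℝ (fun z => fderiv ℝ (fun y => b (((n : ℝ) + 1)⁻¹ • y)) z (e j)) x (e i)
      = ((n : ℝ) + 1)⁻¹ * (((n : ℝ) + 1)⁻¹ *
        fderiv ℝ (fun z => fderiv ℝ b z (e j)) (((n : ℝ) + 1)⁻¹ • x) (e i)) := fun n i j x => by
    simp only [d1]
    rw [fderiv_const_mul, smul_apply, hscale _ (hc1 j), smul_eq_mul]
    exact ((hc1 j).comp (contDiff_const_smul _)).differentiable (by simp) x
  -- The scale `n + 1` makes `χ_n` equal to `1` on an open set containing the closed ball of radius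
  -- `n`, so its derivatives vanish there. It also avoids division by zero at `n = 0`.
  have hnear : ∀ (n : ℕ) x, ‖x‖ ≤ n → (fun y => b (((n : ℝ) + 1)⁻¹ • y)) =ᶠ[𝓝 x] fun _ => 1 := by
    intro n x hx
    have hx' : x ∈ Metric.ball (0 : E3) ((n : ℝ) + 1) := by
      rw [mem_ball_zero_iff]; linarith
    filter_upwards [Metric.isOpen_ball.mem_nhds hx'] with y hy
    refine b.one_of_mem_closedBall ?_
    rw [mem_closedBall_zero_iff, norm_smul, Real.norm_of_nonneg (inv_pos.mpr (hpos n)).le,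
      ← div_eq_inv_mul]
    exact (div_le_one (hpos n)).mpr (mem_ball_zero_iff.mp hy).le
  refine ⟨fun n x => b (((n : ℝ) + 1)⁻¹ • x), M, by positivity, fun n => ?_, fun n => ?_,
    fun n x hx => (hnear n x hx).eq_of_nhds, fun n x => ?_, fun n j x hx => ?_, fun n j x => ?_,
    fun n i j x hx => ?_, fun n i j x => ?_⟩
  · exact hb.comp (contDiff_const_smul ((n : ℝ) + 1)⁻¹)
  · exact b.hasCompactSupport.comp_smul (inv_ne_zero (hpos n).ne')
  · have h1 := b.nonneg (x := ((n : ℝ) + 1)⁻¹ • x)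
    have h2 := b.le_one (x := ((n : ℝ) + 1)⁻¹ • x)
    rw [abs_of_nonneg (by linarith)]
    linarith
  · rw [(hnear n x hx).fderiv_eq]
    simp
  · rw [d1]
    exact (hb1 j n x).trans (mul_le_mul_of_nonneg_right (l1 j) (rho_inv_pos x).le)
  · have h1 : (fun y => fderiv ℝ (fun z => b (((n : ℝ) + 1)⁻¹ • z)) y (e j)) =ᶠ[𝓝 x]
        fun _ => 0 := by
      filter_upwards [(hnear n x hx).fderiv (𝕜 := ℝ)] with y hy
      rw [hy]
      simp
    rw [h1.fderiv_eq]
    simp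
  · rw [d2, abs_mul, abs_of_pos (inv_pos.mpr (hpos n))]
    have h1 : ((n : ℝ) + 1)⁻¹ ≤ 1 :=
      inv_le_one_of_one_le₀ (by linarith [(Nat.cast_nonneg n : (0 : ℝ) ≤ n)])
    exact (mul_le_of_le_one_left (abs_nonneg _) h1).trans
      ((hb2 i j n x).trans (mul_le_mul_of_nonneg_right (l2 i j) (rho_inv_pos x).le))

section Generic

variable {F : Type*} [NormedAddCommGroup F] [InnerProductSpace ℝ F] [FiniteDimensional ℝ F]
  {G : GaugeData F} {u v : E3 → F} {c : E3 → F} {g k : Fin 3 → E3 → F} {i : Fin 3}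

/-- Dominated convergence: at each point the sequence is eventually zero. -/
theorem tendsto_nsq_tail {θ : ℕ → E3 → ℝ} (hθ : ∀ n, Continuous (θ n))
    (h0 : ∀ (n : ℕ) x, ‖x‖ ≤ n → θ n x = 0) {M : ℝ} (hM : ∀ n x, |θ n x| ≤ M) (hu : MemLp u 2 volume) :
    L2Null (fun n x => θ n x • u x) := by
  refine ⟨fun n => (hθ n).aestronglyMeasurable.smul hu.1, ?_⟩
  have hfin : nsq u ≠ ⊤ := by
    rw [nsq_eq_eLpNorm]
    exact ENNReal.pow_ne_top hu.2.ne
  have h := tendsto_lintegral_of_dominated_convergence' (μ := volume)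
    (F := fun n x => ‖θ n x • u x‖ₑ ^ 2) (f := fun _ => 0)
    (fun x => ENNReal.ofReal (M ^ 2) * ‖u x‖ₑ ^ 2)
    (fun n => ((hθ n).aestronglyMeasurable.smul hu.1).enorm.pow_const 2)
    (fun n => ae_of_all _ fun x => ?_) ?_ (ae_of_all _ fun x => ?_)
  · simpa [nsq] using h
  · simp only
    rw [enorm_smul, mul_pow, Real.enorm_eq_ofReal_abs,
      ← ENNReal.ofReal_pow (abs_nonneg _)]
    gcongr
    exact hM n x
  · rw [lintegral_const_mul' _ _ ENNReal.ofReal_ne_top]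
    exact ENNReal.mul_ne_top ENNReal.ofReal_ne_top hfin
  · refine tendsto_const_nhds.congr' ?_
    obtain ⟨N, hN⟩ := exists_nat_ge ‖x‖
    filter_upwards [eventually_ge_atTop N] with n hn
    have h1 : ‖x‖ ≤ n := hN.trans (by exact_mod_cast hn)
    simp [h0 n x h1]

/-- Only `ρ⁻¹ u` is square integrable. The decay of `θ` compensates, through `θ u = (θ ρ) (ρ⁻¹ u)`.
-/
theorem tendsto_nsq_tail_weight {θ : ℕ → E3 → ℝ} (hθ : ∀ n, Continuous (θ n))
    (h0 : ∀ (n : ℕ) x, ‖x‖ ≤ n → θ n x = 0) {M : ℝ} (hM : ∀ n x, |θ n x| ≤ M * (rho x)⁻¹)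
    (hu : MemLp (fun x => (rho x)⁻¹ • u x) 2 volume) :
    L2Null (fun n x => θ n x • u x) := by
  have h := tendsto_nsq_tail (θ := fun n x => θ n x * rho x)
    (fun n => (hθ n).mul continuous_rho) (fun n x hx => by simp [h0 n x hx]) (M := M)
    (fun n x => ?_) hu
  · refine h.congr fun n => ae_of_all _ fun x => ?_
    simp only [smul_smul, mul_assoc, mul_inv_cancel₀ (rho_pos x).ne', mul_one]
  · rw [abs_mul, abs_of_pos (rho_pos x)]
    have := mul_le_mul_of_nonneg_right (hM n x) (rho_pos x).le
    rwa [mul_assoc, inv_mul_cancel₀ (rho_pos x).ne', mul_one] at this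

theorem L2c.of_smul {θ : E3 → ℝ} (hθ : Continuous θ) (hs : HasCompactSupport θ)
    (hu : MemLp (fun x => (rho x)⁻¹ • u x) 2 volume) : L2c (fun x => θ x • u x) := by
  have h1 : HasCompactSupport fun x => θ x * rho x := hs.mul_right
  obtain ⟨M, hM⟩ := h1.exists_bound_of_continuous (hθ.mul continuous_rho)
  have h2 : ∀ x, θ x • u x = (θ x * rho x) • ((rho x)⁻¹ • u x) := fun x => by
    rw [smul_smul, mul_assoc, mul_inv_cancel₀ (rho_pos x).ne', mul_one]
  refine ⟨hu.of_le_mul (c := M) ?_ (ae_of_all _ fun x => ?_), ?_⟩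
  · simp only [h2]
    exact (hθ.mul continuous_rho).aestronglyMeasurable.smul hu.1
  · rw [h2, norm_smul]
    gcongr
    exact hM x
  · obtain ⟨r, hr⟩ := hs.isCompact.isBounded.subset_closedBall (0 : E3)
    refine ⟨r + 1, fun x hx => ?_⟩
    have : θ x = 0 := image_eq_zero_of_notMem_tsupport fun hx' => by
      have := mem_closedBall_zero_iff.mp (hr hx')
      linarith
    simp [this]

theorem memLp_weight (hu : MemLp u 2 volume) : MemLp (fun x => (rho x)⁻¹ • u x) 2 volume :=
  hu.of_le_mul (c := 1) (continuous_rho_inv.aestronglyMeasurable.smul hu.1) (ae_of_all _ fun x => by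
    rw [norm_smul, Real.norm_of_nonneg (rho_inv_pos x).le]
    gcongr
    exact rho_inv_le_one x)

namespace GaugeData

variable {U V : ℕ → E3 → F} {p q : ℕ → Fin 3 → E3 → F}

theorem Null1.add (h : G.Null1 U p) (h' : G.Null1 V q) :
    G.Null1 (fun n x => U n x + V n x) (fun n i x => p n i x + q n i x) :=
  ⟨fun i => (h.grad i).add (h'.grad i), by simpa only [smul_add] using h.wt.add h'.wt,
    by simpa only [map_add] using h.P.add h'.P⟩

theorem nsq_le_n1 (c : E3 → F) (g : Fin 3 → E3 → F) (i : Fin 3) : nsq (g i) ≤ G.n1 c g :=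
  (Finset.single_le_sum (f := fun i => nsq (g i)) (fun _ _ => zero_le) (Finset.mem_univ i)).trans
    ((le_add_right le_self_add))

theorem nsq_weight_le_n1 (c : E3 → F) (g : Fin 3 → E3 → F) :
    nsq (fun x => (rho x)⁻¹ • c x) ≤ G.n1 c g := le_add_right le_add_self

theorem nsq_P_le_n1 (c : E3 → F) (g : Fin 3 → E3 → F) :
    nsq (fun x => G.P x (c x)) ≤ G.n1 c g := le_add_self

theorem Null1.of_tendsto (hU : ∀ n, AEStronglyMeasurable (U n) volume)
    (hp : ∀ n i, AEStronglyMeasurable (p n i) volume)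
    (h : Tendsto (fun n => G.n1 (U n) (p n)) atTop (𝓝 0)) : G.Null1 U p :=
  ⟨fun i => ⟨fun n => hp n i, null_of_le h fun _ => nsq_le_n1 _ _ i⟩,
    ⟨fun n => continuous_rho_inv.aestronglyMeasurable.smul (hU n),
      null_of_le h fun _ => nsq_weight_le_n1 _ _⟩,
    ⟨fun n => aestronglyMeasurable_clm G.smooth_P.continuous (hU n),
      null_of_le h fun _ => nsq_P_le_n1 _ _⟩⟩

theorem Null2.of_tendsto {w : ℕ → Fin 3 → Fin 3 → E3 → F}
    (hU : ∀ n, AEStronglyMeasurable (U n) volume)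
    (hp : ∀ n i, AEStronglyMeasurable (p n i) volume)
    (hw : ∀ n i j, AEStronglyMeasurable (w n i j) volume)
    (h : Tendsto (fun n => G.n2 (U n) (p n) (w n)) atTop (𝓝 0)) : G.Null2 U p w := by
  have hP := G.smooth_P.continuous
  refine ⟨fun j => Null1.of_tendsto (fun n => hp n j) (fun n i => hw n i j)
    (null_of_le h fun n => ?_), ⟨fun n => aestronglyMeasurable_clm hP
      (aestronglyMeasurable_clm hP (hU n)), null_of_le h fun n => ?_⟩,
    ⟨fun n => aestronglyMeasurable_clm hP (continuous_rho_inv.aestronglyMeasurable.smul (hU n)),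
      null_of_le h fun n => ?_⟩,
    ⟨fun n => aestronglyMeasurable_weight (hU n) 2, null_of_le h fun n => le_add_self⟩⟩
  · refine le_add_right (le_add_right (le_add_right ?_))
    exact Finset.single_le_sum (f := fun j => G.n1 (p n j) (fun i => w n i j))
      (fun _ _ => zero_le) (Finset.mem_univ j)
  · exact le_add_right (le_add_right le_add_self)
  · exact le_add_right le_add_self

end GaugeData

namespace DiracCoeff

variable (T : DiracCoeff G)

/-- If `c` and `T c` have finite `𝓗₁`-norm, then `c` can be approximated by test functions `φ` such
that `T φ` approximates `T c`. -/
theorem exists_test_dense (hc : ∀ i, G.IsWeak i c (g i))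
    (hk : ∀ i, G.IsWeak i (T.op c g) (k i)) (hn : G.n1 c g ≠ ⊤) (hn' : G.n1 (T.op c g) k ≠ ⊤) :
    ∃ φ : ℕ → E3 → F, (∀ n, Test (φ n)) ∧
      G.Null1 (fun n x => c x - φ n x) (fun n i x => g i x - G.cov i (φ n) x) ∧
      G.Null1 (fun n x => T.op c g x - T.cl (φ n) x)
        (fun n i x => k i x - G.cov i (T.cl (φ n)) x) := by
  have hP := G.smooth_P.continuous
  set f := T.op c g with hf
  have mc := (hc 0).1.aestronglyMeasurable
  have mf := (hk 0).1.aestronglyMeasurable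
  have lg : ∀ i, MemLp (g i) 2 volume := fun i => memLp_of_nsq (hc i).2.1.aestronglyMeasurable
    (ne_top_of_le_ne_top hn (GaugeData.nsq_le_n1 _ _ i))
  have lk : ∀ i, MemLp (k i) 2 volume := fun i => memLp_of_nsq (hk i).2.1.aestronglyMeasurable
    (ne_top_of_le_ne_top hn' (GaugeData.nsq_le_n1 _ _ i))
  have lc : MemLp (fun x => (rho x)⁻¹ • c x) 2 volume :=
    memLp_of_nsq (continuous_rho_inv.aestronglyMeasurable.smul mc)
      (ne_top_of_le_ne_top hn (GaugeData.nsq_weight_le_n1 _ _))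
  have lf : MemLp (fun x => (rho x)⁻¹ • f x) 2 volume :=
    memLp_of_nsq (continuous_rho_inv.aestronglyMeasurable.smul mf)
      (ne_top_of_le_ne_top hn' (GaugeData.nsq_weight_le_n1 _ _))
  have lPc : MemLp (fun x => G.P x (c x)) 2 volume :=
    memLp_of_nsq (aestronglyMeasurable_clm hP mc)
      (ne_top_of_le_ne_top hn (GaugeData.nsq_P_le_n1 _ _))
  have lPf : MemLp (fun x => G.P x (f x)) 2 volume :=
    memLp_of_nsq (aestronglyMeasurable_clm hP mf)
      (ne_top_of_le_ne_top hn' (GaugeData.nsq_P_le_n1 _ _))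
  obtain ⟨χ, M, hM, hχ, hχs, hχ1, hχM, hχd0, hχd, hχdd0, hχdd⟩ := exists_cutoff_seq
  have cχ : ∀ n, Continuous (χ n) := fun n => (hχ n).continuous
  have cχ1 : ∀ n, Continuous fun x => 1 - χ n x := fun n => continuous_const.sub (cχ n)
  have sχd : ∀ n j, ContDiff ℝ ∞ fun x => fderiv ℝ (χ n) x (e j) := fun n j =>
    contDiff_pderiv (hχ n) (e j)
  have cχd : ∀ n j, Continuous fun x => fderiv ℝ (χ n) x (e j) := fun n j => (sχd n j).continuous
  have cχdd : ∀ n i j, Continuous fun x => fderiv ℝ (fun y => fderiv ℝ (χ n) y (e j)) x (e i) :=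
    fun n i j => (contDiff_pderiv (sχd n j) (e i)).continuous
  have χsd : ∀ n j, HasCompactSupport fun x => fderiv ℝ (χ n) x (e j) := fun n j =>
    (hχs n).fderiv_apply ℝ (e j)
  have χsdd : ∀ n i j,
      HasCompactSupport fun x => fderiv ℝ (fun y => fderiv ℝ (χ n) y (e j)) x (e i) :=
    fun n i j => (χsd n j).fderiv_apply ℝ (e i)
  have h10 : ∀ n x, ‖x‖ ≤ (n : ℕ) → 1 - χ n x = 0 := fun n x hx => by rw [hχ1 n x hx, sub_self]
  have hχdM : ∀ n j x, |fderiv ℝ (χ n) x (e j)| ≤ M := fun n j x =>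
    (hχd n j x).trans (mul_le_of_le_one_right hM (rho_inv_le_one x))
  set C : ℕ → E3 → F := fun n x => χ n x • c x with hC
  set D : ℕ → Fin 3 → E3 → F := fun n i x => fderiv ℝ (χ n) x (e i) • c x + χ n x • g i x with hD
  -- The derivative of `T(χ c) = χ T c + ∑ (∂_j χ) γ_j c`. It involves only `c`, `∇c`, `T c` and
  -- `∇(T c)`, never separate second derivatives of `c`.
  set L : ℕ → Fin 3 → E3 → F := fun n i x =>
    ∑ j, T.γ j (fderiv ℝ (fun y => fderiv ℝ (χ n) y (e j)) x (e i) • c x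
      + fderiv ℝ (χ n) x (e j) • g i x) + (fderiv ℝ (χ n) x (e i) • f x + χ n x • k i x) with hL
  have hop : ∀ n x, T.op (C n) (D n) x
      = ∑ j, T.γ j (fderiv ℝ (χ n) x (e j) • c x) + χ n x • f x := fun n x => by
    simp only [op, hC, hD, hf, map_add, map_smul, Finset.sum_add_distrib, smul_add,
      Finset.smul_sum]
    abel
  have wC : ∀ n i, G.IsWeak i (C n) (D n i) := fun n i => (hc i).smul (hχ n)
  have wL : ∀ n i, G.IsWeak i (T.op (C n) (D n)) (L n i) := fun n i => by
    have h1 := fun j => ((hc i).smul (sχd n j)).map (T.γ_a j i)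
    have h2 := (hk i).smul (hχ n)
    refine ((((h1 0).add (h1 1)).add (h1 2)).add h2).congr (ae_of_all _ fun x => ?_)
      (ae_of_all _ fun x => ?_)
    · simp only [hop, Fin.sum_univ_three]
    · simp only [hL, Fin.sum_univ_three]
  have n1 : G.Null1 (fun n x => c x - C n x) (fun n i x => g i x - D n i x) := by
    have e1 : ∀ n x, c x - C n x = (1 - χ n x) • c x := fun n x => by
      simp only [hC, sub_smul, one_smul]
    refine ⟨fun i => ?_, ?_, ?_⟩
    · have h1 := (tendsto_nsq_tail cχ1 h10 hχM (lg i)).sub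
        (tendsto_nsq_tail_weight (fun n => cχd n i) (fun n x hx => hχd0 n i x hx)
          (fun n x => hχd n i x) lc)
      refine h1.congr fun n => ae_of_all _ fun x => ?_
      simp only [hD, sub_smul, one_smul]
      abel
    · refine (tendsto_nsq_tail cχ1 h10 hχM lc).congr fun n => ae_of_all _ fun x => ?_
      simp only [e1]
      exact smul_comm _ _ _
    · simpa only [e1, map_smul] using tendsto_nsq_tail cχ1 h10 hχM lPc
  have n2 : G.Null1 (fun n x => f x - T.op (C n) (D n) x) (fun n i x => k i x - L n i x) := by
    have e1 : ∀ n x, f x - T.op (C n) (D n) x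
        = (1 - χ n x) • f x - ∑ j, T.γ j (fderiv ℝ (χ n) x (e j) • c x) := fun n x => by
      simp only [hop, sub_smul, one_smul]
      abel
    refine ⟨fun i => ?_, ?_, ?_⟩
    · have h1 := (tendsto_nsq_tail cχ1 h10 hχM (lk i)).sub
        (tendsto_nsq_tail_weight (fun n => cχd n i) (fun n x hx => hχd0 n i x hx)
          (fun n x => hχd n i x) lf)
      have h2 := fun j => ((tendsto_nsq_tail_weight (fun n => cχdd n i j)
        (fun n x hx => hχdd0 n i j x hx) (fun n x => hχdd n i j x) lc).add
        (tendsto_nsq_tail (fun n => cχd n j) (fun n x hx => hχd0 n j x hx)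
          (fun n x => hχdM n j x) (lg i))).map (T.γ j)
      refine (h1.sub (L2Null.sum Finset.univ h2)).congr fun n => ae_of_all _ fun x => ?_
      simp only [hL, sub_smul, one_smul]
      abel
    · have h1 := tendsto_nsq_tail cχ1 h10 hχM lf
      have h2 := fun j => (tendsto_nsq_tail (fun n => cχd n j) (fun n x hx => hχd0 n j x hx)
          (fun n x => hχdM n j x) lc).map (T.γ j)
      refine (h1.sub (L2Null.sum Finset.univ h2)).congr fun n => ae_of_all _ fun x => ?_
      simp only [e1, smul_sub, Finset.smul_sum, map_smul]
      exact congrArg₂ _ (smul_comm _ _ _) (Finset.sum_congr rfl fun j _ => smul_comm _ _ _)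
    · have h1 := tendsto_nsq_tail cχ1 h10 hχM lPf
      have h2 := fun j => (tendsto_nsq_tail (fun n => cχd n j) (fun n x hx => hχd0 n j x hx)
          (fun n x => hχdM n j x) lPc).map (T.γ j)
      refine (h1.sub (L2Null.sum Finset.univ h2)).congr fun n => ae_of_all _ fun x => ?_
      simp only [e1, map_sub, map_sum, map_smul, T.γ_P]
  have lC : ∀ n, L2c (C n) := fun n => L2c.of_smul (cχ n) (hχs n) lc
  have lD : ∀ n i, L2c (D n i) := fun n i => (L2c.of_smul (cχd n i) (χsd n i) lc).add
    (L2c.of_smul (cχ n) (hχs n) (memLp_weight (lg i)))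
  have lL : ∀ n i, L2c (L n i) := fun n i =>
    (L2c.sum fun j => ((L2c.of_smul (cχdd n i j) (χsdd n i j) lc).add
      (L2c.of_smul (cχd n j) (χsd n j) (memLp_weight (lg i)))).map (T.γ j)).add
    ((L2c.of_smul (cχd n i) (χsd n i) lf).add
      (L2c.of_smul (cχ n) (hχs n) (memLp_weight (lk i))))
  -- Diagonal choice: the `n`-th cut off section is mollified until both errors are at most `1 / (n
  -- + 1)`.
  have hstep : ∀ n : ℕ, ∃ φ : E3 → F, Test φ ∧
      G.n1 (fun x => C n x - φ x) (fun i x => D n i x - G.cov i φ x) ≤ ENNReal.ofReal (1 / (n + 1)) ∧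
      G.n1 (fun x => T.op (C n) (D n) x - T.cl φ x) (fun i x => L n i x - G.cov i (T.cl φ) x)
        ≤ ENNReal.ofReal (1 / (n + 1)) := fun n => by
    obtain ⟨φ, hφ, h1, h2⟩ := T.exists_test_of_compact (wC n) (wL n) (lC n) (lD n) (lL n)
    have hpos : 0 < ENNReal.ofReal (1 / ((n : ℝ) + 1)) := by
      rw [ENNReal.ofReal_pos]; positivity
    obtain ⟨m, hm1, hm2⟩ := ((ENNReal.tendsto_nhds_zero.mp h1.tendsto _ hpos).and
      (ENNReal.tendsto_nhds_zero.mp h2.tendsto _ hpos)).exists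
    exact ⟨φ m, hφ m, hm1, hm2⟩
  choose φ hφ hφ1 hφ2 using hstep
  have hlim : Tendsto (fun n : ℕ => ENNReal.ofReal (1 / ((n : ℝ) + 1))) atTop (𝓝 0) := by
    simpa using ENNReal.tendsto_ofReal (tendsto_one_div_add_atTop_nhds_zero_nat (𝕜 := ℝ))
  have m1 := GaugeData.Null1.of_tendsto (G := G)
    (fun n => (wC n 0).1.aestronglyMeasurable.sub (hφ n).continuous.aestronglyMeasurable)
    (fun n i => (wC n i).2.1.aestronglyMeasurable.sub
      ((hφ n).cov (G := G) i).continuous.aestronglyMeasurable) (null_of_le hlim hφ1)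
  have m2 := GaugeData.Null1.of_tendsto (G := G)
    (fun n => (wL n 0).1.aestronglyMeasurable.sub ((hφ n).cl T).continuous.aestronglyMeasurable)
    (fun n i => (wL n i).2.1.aestronglyMeasurable.sub
      (((hφ n).cl T).cov (G := G) i).continuous.aestronglyMeasurable) (null_of_le hlim hφ2)
  refine ⟨φ, hφ, ?_, ?_⟩
  · have := n1.add m1
    simpa only [Pi.sub_apply, sub_add_sub_cancel] using this
  · have := n2.add m2
    simpa only [Pi.sub_apply, sub_add_sub_cancel] using this

end DiracCoeff

end Generic

/-! ### Regularity -/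

section Generic

variable {F : Type*} [NormedAddCommGroup F] [InnerProductSpace ℝ F] [FiniteDimensional ℝ F]
  {G : GaugeData F} {φ u v : E3 → F} {c : E3 → F} {g k : Fin 3 → E3 → F} {i : Fin 3}

theorem L2Null.tendsto_integral_inner {U : ℕ → E3 → F} (h : L2Null U) (hφ : Test φ) :
    Tendsto (fun n => ∫ x, inner ℝ (U n x) (φ x)) atTop (𝓝 0) := by
  rw [tendsto_zero_iff_enorm_tendsto_zero]
  have hle : ∀ n, ‖∫ x, inner ℝ (U n x) (φ x)‖ₑ
      ≤ nsq (U n) ^ (1 / 2 : ℝ) * nsq φ ^ (1 / 2 : ℝ) := by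
    intro n
    have h1 := ENNReal.lintegral_mul_le_Lp_mul_Lq volume Real.HolderConjugate.two_two
      (h.1 n).enorm (hφ.continuous.aestronglyMeasurable (μ := volume)).enorm
    simp only [ENNReal.rpow_ofNat] at h1
    refine (enorm_integral_le_lintegral_enorm _).trans (le_trans (lintegral_mono fun x => ?_) h1)
    simp only [Pi.mul_apply, enorm_eq_nnnorm]
    exact_mod_cast nnnorm_inner_le_nnnorm (𝕜 := ℝ) (U n x) (φ x)
  refine null_of_le (δ := fun n => nsq φ ^ (1 / 2 : ℝ) * nsq (U n) ^ (1 / 2 : ℝ))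
    (null_const_mul ?_ ?_) (fun n => (hle n).trans (le_of_eq (mul_comm _ _)))
  · have := (ENNReal.continuous_rpow_const (y := (1 / 2 : ℝ))).tendsto 0 |>.comp h.2
    simpa [Function.comp_def] using this
  · rw [hφ.nsq_eq]
    exact ENNReal.rpow_ne_top_of_nonneg (by norm_num) ENNReal.ofReal_ne_top

/-- Weak derivatives are closed under convergence in `L²`. -/
theorem GaugeData.IsWeak.of_null {U V : ℕ → E3 → F} (h : ∀ n, G.IsWeak i (U n) (V n))
    (hu : LocallyIntegrable u volume) (hv : LocallyIntegrable v volume)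
    (hU : L2Null (fun n x => u x - U n x)) (hV : L2Null (fun n x => v x - V n x)) :
    G.IsWeak i u v := by
  refine ⟨hu, hv, fun φ hφ => ?_⟩
  have t := hφ.cov (G := G) i
  have h1 := (hU.tendsto_integral_inner t).add (hV.tendsto_integral_inner hφ)
  have h2 : ∀ n, (∫ x, inner ℝ (u x - U n x) (G.cov i φ x)) + ∫ x, inner ℝ (v x - V n x) (φ x)
      = (∫ x, inner ℝ (u x) (G.cov i φ x)) + ∫ x, inner ℝ (v x) (φ x) := by
    intro n
    simp only [inner_sub_left]
    rw [integral_sub (integrable_inner_of_locallyIntegrable hu t.continuous t.2)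
      (integrable_inner_of_locallyIntegrable (h n).1 t.continuous t.2),
      integral_sub (integrable_inner_of_locallyIntegrable hv hφ.continuous hφ.2)
      (integrable_inner_of_locallyIntegrable (h n).2.1 hφ.continuous hφ.2), (h n).2.2 φ hφ]
    ring
  simp only [h2] at h1
  have h3 := tendsto_nhds_unique h1 tendsto_const_nhds
  linarith

/-- Completeness of `L²`. -/
theorem exists_limit_of_cauchy {V : ℕ → E3 → F} (hV : ∀ n, MemLp (V n) 2 volume) {a : ℕ → ℝ≥0∞}
    (ha : Tendsto a atTop (𝓝 0)) (h : ∀ n m, nsq (fun x => V n x - V m x) ≤ a n + a m) :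
    ∃ W, MemLp W 2 volume ∧ L2Null (fun n x => W x - V n x) := by
  have hc : CauchySeq fun n => (hV n).toLp (V n) := by
    rw [EMetric.cauchySeq_iff]
    intro ε hε
    have hε2 : 0 < ε ^ 2 / 2 := ENNReal.div_pos (ENNReal.pow_pos hε 2).ne' ENNReal.ofNat_ne_top
    obtain ⟨N, hN⟩ := eventually_atTop.mp (ha.eventually (gt_mem_nhds hε2))
    refine ⟨N, fun m hm n hn => ?_⟩
    rw [Lp.edist_toLp_toLp]
    have h1 := h m n
    rw [nsq_eq_eLpNorm] at h1
    have h2 := lt_of_le_of_lt h1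
      ((ENNReal.add_lt_add (hN m hm) (hN n hn)).trans_eq (ENNReal.add_halves _))
    by_contra hlt
    exact absurd h2 (not_lt.mpr (pow_le_pow_left₀ zero_le (not_lt.mp hlt) 2))
  obtain ⟨W, hW⟩ := cauchySeq_tendsto_of_complete hc
  refine ⟨W, Lp.memLp W, fun n => (Lp.memLp W).1.sub (hV n).1, ?_⟩
  have h1 := tendsto_iff_edist_tendsto_0.mp hW
  have h2 := ENNReal.Tendsto.pow (n := 2) h1
  simp only [ne_eq, OfNat.ofNat_ne_zero, not_false_eq_true, zero_pow] at h2
  refine h2.congr fun n => ?_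
  rw [nsq_eq_eLpNorm, edist_comm]
  congr 1
  conv_lhs => rw [← Lp.toLp_coeFn W (Lp.memLp W)]
  rw [Lp.edist_toLp_toLp]
  rfl

theorem GaugeData.Approx1.n1_ne_top (hc : ∀ i, G.IsWeak i c (g i)) (H : G.Approx1 c g) :
    G.n1 c g ≠ ⊤ := by
  obtain ⟨φ, hφ, hn⟩ := H
  obtain ⟨n, hn⟩ := (ENNReal.tendsto_nhds_zero.mp hn.tendsto 1 one_pos).exists
  have h1 := GaugeData.n1_sub_le (G := G) (c := fun x => c x - φ n x) (c' := fun x => -φ n x)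
      (g := fun i x => g i x - G.cov i (φ n) x) (g' := fun i x => -G.cov i (φ n) x)
      ((hc 0).1.aestronglyMeasurable.sub (hφ n).continuous.aestronglyMeasurable)
      (fun i => (hc i).2.1.aestronglyMeasurable.sub
        ((hφ n).cov i).continuous.aestronglyMeasurable)
  have h2 : G.n1 c g ≤ 2 * G.n1 (fun x => c x - φ n x) (fun i x => g i x - G.cov i (φ n) x)
      + 2 * G.n1 (φ n) (fun i => G.cov i (φ n)) := by
    simpa [GaugeData.n1, nsq_neg] using h1
  refine ne_top_of_le_ne_top (ENNReal.add_ne_top.mpr ⟨ENNReal.mul_ne_top ENNReal.ofNat_ne_top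
    (ne_top_of_le_ne_top ENNReal.one_ne_top hn), ENNReal.mul_ne_top ENNReal.ofNat_ne_top ?_⟩) h2
  rw [(hφ n).n1_eq]
  exact ENNReal.ofReal_ne_top

namespace DiracCoeff

variable (T : DiracCoeff G)

/-- If `c` and `T c` are in `𝓗₁`, then `c` is in `𝓗₂`. -/
theorem exists_approx2 (hc : ∀ i, G.IsWeak i c (g i)) (hk : ∀ i, G.IsWeak i (T.op c g) (k i))
    (H : G.Approx1 c g) (H' : G.Approx1 (T.op c g) k) :
    ∃ h : Fin 3 → Fin 3 → E3 → F, (∀ i j, G.IsWeak i (g j) (h i j)) ∧ G.Approx2 c g h := by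
  obtain ⟨φ, hφ, n1, n2⟩ := T.exists_test_dense hc hk (H.n1_ne_top hc) (H'.n1_ne_top hk)
  obtain ⟨R, hR, C, hC⟩ := T.exists_test_n2_le
  have mc := (hc 0).1.aestronglyMeasurable
  have mf := (hk 0).1.aestronglyMeasurable
  set f := T.op c g with hf
  set X : ℕ → ℝ≥0∞ := fun n =>
    G.n1 (fun x => f x - T.cl (φ n) x) (fun i x => k i x - G.cov i (T.cl (φ n)) x) with hX
  set Y : ℕ → ℝ≥0∞ := fun n => nsqOn R (fun x => c x - φ n x) with hY
  have ha : Tendsto (fun n => C * (2 * X n + 2 * Y n)) atTop (𝓝 0) :=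
    null_const_mul (null_add (null_const_mul n2.tendsto ENNReal.ofNat_ne_top)
      (null_const_mul (n1.loc R) ENNReal.ofNat_ne_top)) ENNReal.coe_ne_top
  -- The `𝓗₂` estimate applied to `φ n - φ m`: its right side is small since `T φ_n` converges in
  -- `𝓗₁` and `φ_n` converges locally in `L²`.
  have hcauchy : ∀ i j n m, nsq (fun x => G.cov i (G.cov j (φ n)) x - G.cov i (G.cov j (φ m)) x)
      ≤ C * (2 * X n + 2 * Y n) + C * (2 * X m + 2 * Y m) := by
    intro i j n m
    have ht := (hφ n).sub (hφ m)
    have e1 : ∀ j, G.cov j (fun x => φ n x - φ m x) = fun x => G.cov j (φ n) x - G.cov j (φ m) x :=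
      fun j => funext fun x => cov_sub (hφ n).1 (hφ m).1 j x
    have e2 : ∀ i j, G.cov i (G.cov j (fun x => φ n x - φ m x))
        = fun x => G.cov i (G.cov j (φ n)) x - G.cov i (G.cov j (φ m)) x := fun i j => by
      funext x
      rw [e1]
      exact cov_sub ((hφ n).cov j).1 ((hφ m).cov j).1 i x
    have e3 : T.cl (fun x => φ n x - φ m x) = fun x => T.cl (φ n) x - T.cl (φ m) x :=
      funext fun x => T.cl_sub (hφ n).1 (hφ m).1 x
    have e4 : ∀ i, G.cov i (T.cl (fun x => φ n x - φ m x))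
        = fun x => G.cov i (T.cl (φ n)) x - G.cov i (T.cl (φ m)) x := fun i => by
      funext x
      rw [e3]
      exact cov_sub ((hφ n).cl T).1 ((hφ m).cl T).1 i x
    have h1 : nsq (G.cov i (G.cov j (fun x => φ n x - φ m x)))
        ≤ G.n2 (fun x => φ n x - φ m x) (fun i => G.cov i (fun x => φ n x - φ m x))
          (fun i j => G.cov i (G.cov j (fun x => φ n x - φ m x))) := by
      refine (GaugeData.nsq_le_n1 (G := G) (G.cov j (fun x => φ n x - φ m x))
        (fun i => G.cov i (G.cov j (fun x => φ n x - φ m x))) i).trans ?_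
      refine le_add_right (le_add_right (le_add_right ?_))
      exact Finset.single_le_sum (f := fun j => G.n1 (G.cov j (fun x => φ n x - φ m x))
        (fun i => G.cov i (G.cov j (fun x => φ n x - φ m x)))) (fun _ _ => zero_le)
        (Finset.mem_univ j)
    have h2 : G.n1 (T.cl (fun x => φ n x - φ m x)) (fun i => G.cov i (T.cl (fun x => φ n x - φ m x)))
        ≤ 2 * X m + 2 * X n := by
      have := GaugeData.n1_sub_le (G := G) (c := fun x => f x - T.cl (φ m) x)
        (c' := fun x => f x - T.cl (φ n) x) (g := fun i x => k i x - G.cov i (T.cl (φ m)) x)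
        (g' := fun i x => k i x - G.cov i (T.cl (φ n)) x)
        (mf.sub ((hφ m).cl T).continuous.aestronglyMeasurable)
        (fun i => (hk i).2.1.aestronglyMeasurable.sub
          (((hφ m).cl T).cov i).continuous.aestronglyMeasurable)
      simp only [sub_sub_sub_cancel_left] at this
      rw [show (fun i => G.cov i (T.cl (fun x => φ n x - φ m x))) = _ from funext e4, e3]
      exact this
    have h3 : nsqOn R (fun x => φ n x - φ m x) ≤ 2 * Y m + 2 * Y n := by
      have := nsqOn_sub_le R (u := fun x => c x - φ m x) (v := fun x => c x - φ n x)
        (mc.sub (hφ m).continuous.aestronglyMeasurable)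
      simpa only [sub_sub_sub_cancel_left] using this
    rw [e2] at h1
    refine h1.trans ((hC _ ht).trans ?_)
    calc (C : ℝ≥0∞) * _ ≤ C * ((2 * X m + 2 * X n) + (2 * Y m + 2 * Y n)) := by gcongr
      _ = _ := by ring
  have hmem : ∀ i j n, MemLp (G.cov i (G.cov j (φ n))) 2 volume := fun i j n => by
    have t := (((hφ n).cov (G := G) j).cov (G := G) i)
    exact t.continuous.memLp_of_hasCompactSupport t.2
  choose h hh hnull using fun i j => exists_limit_of_cauchy (hmem i j) ha (hcauchy i j)
  have mφ := fun n => (hφ n).continuous.aestronglyMeasurable (μ := volume)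
  -- Since `ρ⁻¹ ≤ 1` and `P` is bounded, all other terms of the `𝓗₂`-norm already converge by the
  -- `𝓗₁` convergence.
  have hw1 : ∀ {U : ℕ → E3 → F}, L2Null U → L2Null (fun n x => (rho x)⁻¹ • U n x) := fun hU =>
    hU.of_le (fun n => continuous_rho_inv.aestronglyMeasurable.smul (hU.1 n)) (M := 1)
      fun n x => by
        rw [norm_smul, Real.norm_of_nonneg (rho_inv_pos x).le]
        gcongr
        exact rho_inv_le_one x
  have hP1 : ∀ {U : ℕ → E3 → F}, L2Null U → L2Null (fun n x => G.P x (U n x)) := fun hU =>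
    hU.of_le (fun n => aestronglyMeasurable_clm G.smooth_P.continuous (hU.1 n))
      fun n x => G.norm_P x _
  refine ⟨h, fun i j => ?_, φ, hφ, fun j => ⟨fun i => hnull i j, hw1 (n1.grad j), hP1 (n1.grad j)⟩,
    hP1 n1.P, hP1 n1.wt, ?_⟩
  · exact GaugeData.IsWeak.of_null (fun n => GaugeData.isWeak_cov ((hφ n).cov j).1 i) (hc j).2.1
      ((hh i j).locallyIntegrable (by norm_num)) (n1.grad j) (hnull i j)
  · refine (hw1 n1.wt).congr fun n => ae_of_all _ fun x => ?_
    simp only [smul_smul, pow_two]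

end DiracCoeff

end Generic

/-! ### The gauge data of a monopole -/

section

variable {𝔤 : Type*} [NormedAddCommGroup 𝔤] [InnerProductSpace ℝ 𝔤] [InvariantLieAlgebra 𝔤]
  [FiniteDimensional ℝ 𝔤]

/-- The map `X ↦ [X, c]`. -/
noncomputable def adRight (c : Fib 𝔤) : 𝔤 →L[ℝ] Fib 𝔤 :=
  LinearMap.toContinuousLinearMap
    { toFun := fun X => adFib X c
      map_add' := fun X Y => Fib.ext (fun i => add_lie X Y (c.fst i)) (add_lie X Y c.snd)
      map_smul' := fun t X => Fib.ext (fun i => smul_lie t X (c.fst i)) (smul_lie t X c.snd) }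

theorem adRight_apply (c : Fib 𝔤) (X : 𝔤) : adRight c X = adFib X c := rfl

theorem contDiff_adL {X : E3 → 𝔤} (hX : ContDiff ℝ ∞ X) :
    ContDiff ℝ ∞ fun x => (adL (X x) : Fib 𝔤 →L[ℝ] Fib 𝔤) := by
  rw [contDiff_clm_apply_iff]
  intro v
  exact (adRight v).contDiff.comp hX

theorem fderiv_adL {X : E3 → 𝔤} (hX : ContDiff ℝ ∞ X) (x y : E3) (v : Fib 𝔤) :
    fderiv ℝ (fun x => (adL (X x) : Fib 𝔤 →L[ℝ] Fib 𝔤)) x y v = adFib (fderiv ℝ X x y) v := by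
  have h1 := ((contDiff_adL hX).differentiable (by simp) x).hasFDerivAt.clm_apply
    (hasFDerivAt_const v x)
  have h2 : HasFDerivAt (fun x => adL (X x) v) ((adRight v).comp (fderiv ℝ X x)) x :=
    (adRight v).hasFDerivAt.comp x (hX.differentiable (by simp) x).hasFDerivAt
  have h3 := DFunLike.congr_fun (h1.unique h2) y
  simpa [adRight_apply] using h3

variable {m : Monopole 𝔤} {K B : ℝ}

/-- The gauge data on sections of `(Λ¹ ⊕ Λ⁰) ⊗ 𝔤` given by a monopole. -/
noncomputable def Monopole.Decay.gauge (h : m.Decay K) (hB : 0 ≤ B)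
    (hle : ∀ (X : 𝔤) (c : Fib 𝔤), ‖adFib X c‖ ≤ B * ‖X‖ * ‖c‖) : GaugeData (Fib 𝔤) where
  a i x := adL (m.A i x)
  P x := adL (m.Φ x)
  dP i x := adL (cov m.A i m.Φ x)
  -- The first summand serves the operator bounds on `P` and `dP`, the second the refined bound
  -- `adFib_dΦ`.
  K := B * K + 2 * K
  smooth_a i := contDiff_adL (m.smooth_A i)
  smooth_P := contDiff_adL m.smooth_Φ
  smooth_dP i := contDiff_adL (m.contDiff_cov_Φ i)
  skew_a i x v w := adFib_skew _ _ _
  skew_P x v w := adFib_skew _ _ _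
  fderiv_P i x v := by
    rw [fderiv_adL m.smooth_Φ]
    simp only [adL_apply]
    rw [adFib_lie (m.A i x) (m.Φ x) v, add_sub_cancel_right, ← adRight_apply, ← adRight_apply,
      ← adRight_apply, ← map_sub]
    simp [cov]
  curvature i x v := by
    rw [fderiv_adL (m.smooth_A _), fderiv_adL (m.smooth_A _)]
    simp only [adL_apply]
    -- The Jacobi identity turns the commutator of adjoint actions into the action of a bracket, and
    -- the Bogomolny equation replaces `∇_i Φ` by the curvature.
    rw [adFib_lie (m.A (i + 1) x), add_sub_cancel_right, ← m.bogomolny]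
    simp only [← adRight_apply, ← map_sub, ← map_add]
    rfl
  K_pos := by
    have := h.pos
    positivity
  norm_P x v := by
    have := h.pos
    refine (hle (m.Φ x) v).trans ?_
    gcongr
    have := mul_le_mul_of_nonneg_left (h.Φ x) hB
    linarith
  norm_dP i x v := by
    have := h.pos
    have hr := rho_inv_pos x
    refine (hle (cov m.A i m.Φ x) v).trans ?_
    rw [← mul_assoc]
    refine mul_le_mul_of_nonneg_right ?_ (norm_nonneg v)
    have h1 := mul_le_mul_of_nonneg_left (h.dΦ i x) hB
    have h2 : 0 ≤ 2 * K * (rho x)⁻¹ ^ 2 := by positivity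
    nlinarith
  dP_le i x v := by
    have := h.pos
    have hr := rho_inv_pos x
    refine (h.adFib_dΦ i x v).trans ?_
    have h1 : 0 ≤ B * K := by positivity
    exact mul_le_mul_of_nonneg_right (by linarith) (by positivity)

/-- The coefficients of `D` and `D^*` relative to the gauge data of a monopole. -/
noncomputable def DiracOp.coeff (T : DiracOp 𝔤) (h : m.Decay K) (hB : 0 ≤ B)
    (hle : ∀ (X : 𝔤) (c : Fib 𝔤), ‖adFib X c‖ ≤ B * ‖X‖ * ‖c‖) : DiracCoeff (h.gauge hB hle) where
  γ := T.γ
  β := T.β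
  s := T.s
  γ_a j _ _ v := T.γ_ad j _ v
  γ_P j _ v := T.γ_ad j _ v
  β_a _ _ v := T.β_ad _ v
  β_P _ v := T.β_ad _ v
  norm_γ := T.norm_γ
  norm_β := T.norm_β
  γ_anti := T.γ_anti
  γ_β := T.γ_β
  γ_γ := T.γ_γ

variable (h : m.Decay K) (hB : 0 ≤ B)
  (hle : ∀ (X : 𝔤) (c : Fib 𝔤), ‖adFib X c‖ ≤ B * ‖X‖ * ‖c‖)

theorem op_Dstar (c : E3 → Fib 𝔤) :
    ((diracOp 1 (by norm_num)).coeff h hB hle).op c (fun i => m.wcov i c) = m.Dstar c := by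
  funext x
  apply Fib.ext
  · intro i
    change (∑ j, symb 1 j (m.wcov j c x) + symb0 1 (adFib (m.Φ x) (c x))).fst i = _
    rw [Fin.sum_univ_three]
    simp only [WithLp.add_fst, PiLp.add_apply, symb_fst, symb0_fst, Monopole.Dstar, mkFib_fst,
      adFib_fst]
    fin_cases i <;> simp [-lie_skew] <;> abel
  · change (∑ j, symb 1 j (m.wcov j c x) + symb0 1 (adFib (m.Φ x) (c x))).snd = _
    rw [Fin.sum_univ_three]
    simp only [WithLp.add_snd, symb_snd, symb0_snd, Monopole.Dstar, mkFib_snd, adFib_snd, one_smul,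
      Fin.sum_univ_three]

theorem op_D (c : E3 → Fib 𝔤) :
    ((diracOp (-1) (by norm_num)).coeff h hB hle).op c (fun i => m.wcov i c) = m.D c := by
  funext x
  apply Fib.ext
  · intro i
    change (∑ j, symb (-1) j (m.wcov j c x) + symb0 (-1) (adFib (m.Φ x) (c x))).fst i = _
    rw [Fin.sum_univ_three]
    simp only [WithLp.add_fst, PiLp.add_apply, symb_fst, symb0_fst, Monopole.D, mkFib_fst,
      adFib_fst]
    rw [← lie_skew (m.Φ x) ((c x).fst i)]
    fin_cases i <;> simp [-lie_skew] <;> abel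
  · change (∑ j, symb (-1) j (m.wcov j c x) + symb0 (-1) (adFib (m.Φ x) (c x))).snd = _
    rw [Fin.sum_univ_three]
    simp only [WithLp.add_snd, symb_snd, symb0_snd, Monopole.D, mkFib_snd, adFib_snd, neg_smul,
      one_smul, Fin.sum_univ_three]
    abel

/-! ### Comparison of the function spaces -/

theorem isWeakCov_iff (i : Fin 3) (c g : E3 → Fib 𝔤) :
    m.IsWeakCov i c g ↔ (h.gauge hB hle).IsWeak i c g := Iff.rfl

variable {c : E3 → Fib 𝔤} {g : Fin 3 → E3 → Fib 𝔤} {q : Fin 3 → Fin 3 → E3 → Fib 𝔤}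

theorem isWeak_wcov (hc : m.HasWeakGrad c) (i : Fin 3) :
    (h.gauge hB hle).IsWeak i c (m.wcov i c) := by
  rw [← isWeakCov_iff, Monopole.wcov, dif_pos (hc i)]
  exact (hc i).choose_spec

/-- `wcov` is an arbitrary choice; uniqueness allows the norms to be computed from any weak
derivative at hand. -/
theorem wcov_ae_eq {i : Fin 3} {g : E3 → Fib 𝔤} (hg : (h.gauge hB hle).IsWeak i c g) :
    m.wcov i c =ᵐ[volume] g := by
  have hex : ∃ g, m.IsWeakCov i c g := ⟨g, hg⟩
  rw [Monopole.wcov, dif_pos hex]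
  exact GaugeData.IsWeak.unique (G := h.gauge hB hle) hex.choose_spec hg

theorem normSqH1_eq (hc : ∀ i, (h.gauge hB hle).IsWeak i c (g i)) :
    m.normSqH1 c = (h.gauge hB hle).n1 c g := by
  have hw : m.HasWeakGrad c := fun i => ⟨g i, hc i⟩
  rw [Monopole.normSqH1, if_pos hw]
  have h1 : ∀ i, normSqH0 (m.wcov i c) = nsq (g i) := fun i =>
    nsq_congr (wcov_ae_eq h hB hle (hc i))
  simp only [h1]
  rfl

theorem normSqH2_eq (hc : ∀ i, (h.gauge hB hle).IsWeak i c (g i))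
    (hq : ∀ i j, (h.gauge hB hle).IsWeak i (g j) (q i j)) :
    m.normSqH2 c = (h.gauge hB hle).n2 c g q := by
  have hw : m.HasWeakGrad c := fun i => ⟨g i, hc i⟩
  have ha := fun i => wcov_ae_eq h hB hle (hc i)
  have hq' : ∀ i j, (h.gauge hB hle).IsWeak i (m.wcov j c) (q i j) := fun i j =>
    (hq i j).congr (ha j).symm (ae_eq_refl _)
  have hw' : ∀ j, m.HasWeakGrad (m.wcov j c) := fun j i => ⟨q i j, hq' i j⟩
  rw [Monopole.normSqH2, if_pos ⟨hw, hw'⟩]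
  have h1 : ∀ i j, normSqH0 (m.wcov i (m.wcov j c)) = nsq (q i j) := fun i j =>
    nsq_congr (wcov_ae_eq h hB hle (hq' i j))
  have h2 : ∀ i, normSqH0 (fun x => (rho x)⁻¹ • m.wcov i c x) = nsq (fun x => (rho x)⁻¹ • g i x) :=
    fun i => nsq_congr (by filter_upwards [ha i] with x hx; rw [hx])
  have h3 : ∀ i, normSqH0 (fun x => adFib (m.Φ x) (m.wcov i c x))
      = nsq (fun x => adFib (m.Φ x) (g i x)) :=
    fun i => nsq_congr (by filter_upwards [ha i] with x hx; rw [hx])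
  simp only [h1, h2, h3]
  -- The terms are regrouped by the index of the first derivative, so that they form the `𝓗₁`-norms
  -- of the `∇_j c`.
  rw [Finset.sum_comm, ← Finset.sum_add_distrib, ← Finset.sum_add_distrib]
  simp only [← inv_pow]
  rfl

theorem Monopole.MemH1.approx (H : m.MemH1 c) :
    m.HasWeakGrad c ∧ (h.gauge hB hle).Approx1 c (fun i => m.wcov i c) := by
  obtain ⟨φ, hφ, hlim⟩ := H
  have t : ∀ n, Test (φ n) := hφ
  -- A finite value of `normSqH1` at some `c - φ n` forces weak derivatives to exist, and adding
  -- back the smooth `φ n` gives them for `c`.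
  have hw : m.HasWeakGrad c := by
    obtain ⟨n, hn⟩ := (ENNReal.tendsto_nhds_zero.mp hlim 1 one_pos).exists
    have h1 : m.HasWeakGrad fun x => c x - φ n x := by
      by_contra hcon
      rw [Monopole.normSqH1, if_neg hcon] at hn
      exact absurd hn (by simp)
    intro i
    obtain ⟨g, hg⟩ := h1 i
    have h2 := GaugeData.IsWeak.add (G := h.gauge hB hle) hg
      (GaugeData.isWeak_cov (t n).1 i)
    exact ⟨_, h2.congr (ae_of_all _ fun x => sub_add_cancel _ _) (ae_eq_refl _)⟩
  have hc := isWeak_wcov h hB hle hw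
  have hd : ∀ n i, (h.gauge hB hle).IsWeak i (fun x => c x - φ n x)
      (fun x => m.wcov i c x - (h.gauge hB hle).cov i (φ n) x) := fun n i =>
    (hc i).sub (GaugeData.isWeak_cov (t n).1 i)
  refine ⟨hw, φ, t, GaugeData.Null1.of_tendsto (fun n => (hd n 0).1.aestronglyMeasurable)
    (fun n i => (hd n i).2.1.aestronglyMeasurable) ?_⟩
  refine hlim.congr fun n => ?_
  exact normSqH1_eq h hB hle (hd n)

theorem memH1_of_approx (hc : ∀ i, (h.gauge hB hle).IsWeak i c (g i))
    (H : (h.gauge hB hle).Approx1 c g) : m.MemH1 c := by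
  obtain ⟨φ, hφ, hn⟩ := H
  refine ⟨φ, hφ, hn.tendsto.congr fun n => ?_⟩
  exact (normSqH1_eq h hB hle fun i => (hc i).sub (GaugeData.isWeak_cov (hφ n).1 i)).symm

theorem memH2_of_approx (hc : ∀ i, (h.gauge hB hle).IsWeak i c (g i))
    (hq : ∀ i j, (h.gauge hB hle).IsWeak i (g j) (q i j))
    (H : (h.gauge hB hle).Approx2 c g q) : m.MemH2 c := by
  obtain ⟨φ, hφ, hn⟩ := H
  refine ⟨φ, hφ, hn.tendsto.congr fun n => ?_⟩
  exact (normSqH2_eq h hB hle (fun i => (hc i).sub (GaugeData.isWeak_cov (hφ n).1 i))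
    fun i j => (hq i j).sub (GaugeData.isWeak_cov ((hφ n).cov j).1 i)).symm

theorem Monopole.MemH2.approx (H : m.MemH2 c) :
    m.HasWeakGrad c ∧ (∀ j, m.HasWeakGrad (m.wcov j c)) ∧
      (h.gauge hB hle).Approx2 c (fun i => m.wcov i c) (fun i j => m.wcov i (m.wcov j c)) := by
  obtain ⟨φ, hφ, hlim⟩ := H
  have t : ∀ n, Test (φ n) := hφ
  obtain ⟨n, hn⟩ := (ENNReal.tendsto_nhds_zero.mp hlim 1 one_pos).exists
  have h1 : (m.HasWeakGrad fun x => c x - φ n x) ∧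
      ∀ j, m.HasWeakGrad (m.wcov j fun x => c x - φ n x) := by
    by_contra hcon
    rw [Monopole.normSqH2, if_neg hcon] at hn
    exact absurd hn (by simp)
  have hw : m.HasWeakGrad c := by
    intro i
    obtain ⟨g, hg⟩ := h1.1 i
    have h2 := GaugeData.IsWeak.add (G := h.gauge hB hle) hg
      (GaugeData.isWeak_cov (t n).1 i)
    exact ⟨_, h2.congr (ae_of_all _ fun x => sub_add_cancel _ _) (ae_eq_refl _)⟩
  have hc := isWeak_wcov h hB hle hw
  have hw' : ∀ j, m.HasWeakGrad (m.wcov j c) := by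
    intro j i
    obtain ⟨g, hg⟩ := h1.2 j i
    have h2 := GaugeData.IsWeak.add (G := h.gauge hB hle) hg
      (GaugeData.isWeak_cov ((t n).cov (G := h.gauge hB hle) j).1 i)
    have h3 := wcov_ae_eq h hB hle ((hc j).sub (GaugeData.isWeak_cov (t n).1 j))
    refine ⟨_, h2.congr ?_ (ae_eq_refl _)⟩
    filter_upwards [h3] with x hx
    rw [hx, sub_add_cancel]
  have hq := fun i j => isWeak_wcov h hB hle (hw' j) i
  have hd : ∀ n i, (h.gauge hB hle).IsWeak i (fun x => c x - φ n x)
      (fun x => m.wcov i c x - (h.gauge hB hle).cov i (φ n) x) := fun n i =>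
    (hc i).sub (GaugeData.isWeak_cov (t n).1 i)
  have hdd : ∀ n i j, (h.gauge hB hle).IsWeak i
      (fun x => m.wcov j c x - (h.gauge hB hle).cov j (φ n) x)
      (fun x => m.wcov i (m.wcov j c) x - (h.gauge hB hle).cov i ((h.gauge hB hle).cov j (φ n)) x) :=
    fun n i j => (hq i j).sub (GaugeData.isWeak_cov ((t n).cov j).1 i)
  refine ⟨hw, hw', φ, t, GaugeData.Null2.of_tendsto (fun n => (hd n 0).1.aestronglyMeasurable)
    (fun n i => (hd n i).2.1.aestronglyMeasurable)
    (fun n i j => (hdd n i j).2.1.aestronglyMeasurable) ?_⟩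
  refine hlim.congr fun n => ?_
  exact normSqH2_eq h hB hle (hd n) (hdd n)

end

/-! ### The estimates in terms of `𝓗₁` and `𝓗₂` -/

section

variable {𝔤 : Type*} [NormedAddCommGroup 𝔤] [InnerProductSpace ℝ 𝔤] [InvariantLieAlgebra 𝔤]
  [FiniteDimensional ℝ 𝔤] {m : Monopole 𝔤} {K B : ℝ}
  (h : m.Decay K) (hB : 0 ≤ B) (hle : ∀ (X : 𝔤) (c : Fib 𝔤), ‖adFib X c‖ ≤ B * ‖X‖ * ‖c‖)
  {c : E3 → Fib 𝔤} (T : DiracCoeff (h.gauge hB hle))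

theorem memH2_of_memH1_op (hc : m.MemH1 c) (H : m.MemH1 (T.op c fun i => m.wcov i c)) :
    m.MemH2 c := by
  obtain ⟨hw, ha⟩ := hc.approx h hB hle
  obtain ⟨hw', ha'⟩ := H.approx h hB hle
  obtain ⟨q, hq, hq'⟩ := T.exists_approx2 (isWeak_wcov h hB hle hw) (isWeak_wcov h hB hle hw')
    ha ha'
  exact memH2_of_approx h hB hle (isWeak_wcov h hB hle hw) hq hq'

theorem memH1_op (hc : m.MemH2 c) : m.MemH1 (T.op c fun i => m.wcov i c) := by
  obtain ⟨hw, hw', ha⟩ := hc.approx h hB hle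
  have h1 := isWeak_wcov h hB hle hw
  have h2 := fun i j => isWeak_wcov h hB hle (hw' j) i
  exact memH1_of_approx h hB hle (T.isWeak_op h1 h2) (T.approx1_op h1 ha)

theorem normSqH2_le_op {C : ℝ≥0} {R : ℝ}
    (hT : ∀ φ : E3 → Fib 𝔤, Test φ →
      (h.gauge hB hle).n2 φ (fun i => (h.gauge hB hle).cov i φ)
          (fun i j => (h.gauge hB hle).cov i ((h.gauge hB hle).cov j φ))
        ≤ C * ((h.gauge hB hle).n1 (T.cl φ) (fun i => (h.gauge hB hle).cov i (T.cl φ))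
          + nsqOn R φ))
    (hc : m.MemH2 c) :
    m.normSqH2 c ≤ 4 * C * (m.normSqH1 (T.op c fun i => m.wcov i c)
      + normSqL2On (Metric.ball 0 R) c) := by
  obtain ⟨hw, hw', ha⟩ := hc.approx h hB hle
  have h1 := isWeak_wcov h hB hle hw
  have h2 := fun i j => isWeak_wcov h hB hle (hw' j) i
  rw [normSqH2_eq h hB hle h1 h2, normSqH1_eq h hB hle (T.isWeak_op h1 h2)]
  have := T.n2_le_of_test hT h1 h2 ha
  rwa [nsqOn_eq] at this

theorem normSqH1_le_op {C κ : ℝ≥0} {R : ℝ}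
    (hT : ∀ φ : E3 → Fib 𝔤, Test φ →
      (h.gauge hB hle).n1 φ (fun i => (h.gauge hB hle).cov i φ)
        ≤ C * (nsq (T.cl φ) + κ * nsqOn R φ))
    (hc : m.MemH1 c) :
    m.normSqH1 c ≤ 4 * C * (normSqH0 (T.op c fun i => m.wcov i c)
      + κ * normSqL2On (Metric.ball 0 R) c) := by
  obtain ⟨hw, ha⟩ := hc.approx h hB hle
  have h1 := isWeak_wcov h hB hle hw
  rw [normSqH1_eq h hB hle h1]
  have := T.n1_le_of_test hT h1 ha
  rwa [nsqOn_eq] at this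

end

end BPS

theorem mainTheorem5 {𝔤 : Type*} [NormedAddCommGroup 𝔤] [InnerProductSpace ℝ 𝔤]
    [FiniteDimensional ℝ 𝔤] [BPS.InvariantLieAlgebra 𝔤]
    (m : BPS.Monopole 𝔤) (d : BPS.AsymptoticExpansion m) (hd : d.MaximalSymmetryBreaking) :
    ∃ R : ℝ, 0 < R ∧ ∃ C : ℝ≥0, 0 < C ∧
      (∀ c : BPS.E3 → BPS.Fib 𝔤, m.MemH1 c →
        m.normSqH1 c ≤ C * BPS.normSqH0 (m.Dstar c) ∧
        m.normSqH1 c ≤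
          C * (BPS.normSqH0 (m.D c) + BPS.normSqL2On (Metric.ball 0 R) c) ∧
        (m.MemH1 (m.Dstar c) → m.MemH2 c) ∧
        (m.MemH1 (m.D c) → m.MemH2 c)) ∧
      (∀ c : BPS.E3 → BPS.Fib 𝔤, m.MemH2 c →
        (m.MemH1 (m.Dstar c) ∧
          m.normSqH2 c ≤
            C * (m.normSqH1 (m.Dstar c) + BPS.normSqL2On (Metric.ball 0 R) c)) ∧
        (m.MemH1 (m.D c) ∧
          m.normSqH2 c ≤
            C * (m.normSqH1 (m.D c) + BPS.normSqL2On (Metric.ball 0 R) c))) := by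
  obtain ⟨K, h⟩ := d.exists_decay hd
  obtain ⟨B, hB, hle⟩ := BPS.exists_norm_adFib_le (𝔤 := 𝔤)
  set S := (BPS.diracOp (𝔤 := 𝔤) 1 (by norm_num)).coeff h hB hle with hS
  set T := (BPS.diracOp (𝔤 := 𝔤) (-1) (by norm_num)).coeff h hB hle with hT
  have eS : ∀ c, S.op c (fun i => m.wcov i c) = m.Dstar c := BPS.op_Dstar h hB hle
  have eT : ∀ c, T.op c (fun i => m.wcov i c) = m.D c := BPS.op_D h hB hle
  obtain ⟨R₁, hR₁, C₁, h₁⟩ := T.exists_test_n1_le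
  obtain ⟨R₂, hR₂, C₂, h₂⟩ := S.exists_test_n2_le
  obtain ⟨R₃, hR₃, C₃, h₃⟩ := T.exists_test_n2_le
  have mono : ∀ {C : ℝ≥0} {C' : ℝ≥0∞} {a X : ℝ≥0∞} {R R₀ : ℝ} {c : BPS.E3 → BPS.Fib 𝔤},
      a ≤ 4 * C * (X + BPS.normSqL2On (Metric.ball 0 R₀) c) → 4 * C ≤ C' → R₀ ≤ R →
      a ≤ C' * (X + BPS.normSqL2On (Metric.ball 0 R) c) := by
    intro C C' a X R R₀ c ha hC hR
    refine ha.trans (mul_le_mul' hC (add_le_add le_rfl ?_))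
    exact lintegral_mono_set (Metric.ball_subset_ball hR)
  -- The extension by density multiplies each constant by `4`; `20 = 4 * 5` belongs to the global
  -- estimate for `D^*`.
  refine ⟨max R₁ (max R₂ R₃), lt_max_of_lt_left hR₁, 20 + 4 * C₁ + 4 * C₂ + 4 * C₃, by positivity,
    fun c hc => ⟨?_, ?_, fun H => ?_, fun H => ?_⟩, fun c hc => ⟨⟨?_, ?_⟩, ?_, ?_⟩⟩
  -- For `D^*` the sign is `s = -1`, so no local term is needed: `κ = 0`, and the radius is a dummy.
  · have := BPS.normSqH1_le_op h hB hle S (C := 5) (κ := 0) (R := 0)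
      (fun φ hφ => by simpa using S.test_n1_le_of_s rfl hφ) hc
    rw [eS, ENNReal.coe_zero, zero_mul, add_zero] at this
    refine this.trans (mul_le_mul' ?_ le_rfl)
    have : (4 * 5 : ℝ≥0) ≤ 20 + 4 * C₁ + 4 * C₂ + 4 * C₃ := by
      rw [add_assoc, add_assoc]
      exact le_add_right (by norm_num)
    exact_mod_cast this
  · have := BPS.normSqH1_le_op h hB hle T (C := C₁) (κ := 1)
      (fun φ hφ => by simpa using h₁ φ hφ) hc
    rw [eT, ENNReal.coe_one, one_mul] at this
    refine mono this ?_ (le_max_left _ _)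
    have : 4 * C₁ ≤ 20 + 4 * C₁ + 4 * C₂ + 4 * C₃ :=
      le_add_right (le_add_right le_add_self)
    exact_mod_cast this
  · exact BPS.memH2_of_memH1_op h hB hle S hc (by rwa [eS])
  · exact BPS.memH2_of_memH1_op h hB hle T hc (by rwa [eT])
  · rw [← eS]
    exact BPS.memH1_op h hB hle S hc
  · have := BPS.normSqH2_le_op h hB hle S h₂ hc
    rw [eS] at this
    refine mono this ?_ ((le_max_left _ _).trans (le_max_right _ _))
    have : 4 * C₂ ≤ 20 + 4 * C₁ + 4 * C₂ + 4 * C₃ := le_add_right le_add_self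
    exact_mod_cast this
  · rw [← eT]
    exact BPS.memH1_op h hB hle T hc
  · have := BPS.normSqH2_le_op h hB hle T h₃ hc
    rw [eT] at this
    refine mono this ?_ ((le_max_right _ _).trans (le_max_right _ _))
    have : 4 * C₃ ≤ 20 + 4 * C₁ + 4 * C₂ + 4 * C₃ := le_add_self
    exact_mod_cast this
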